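/- Let $\mathcal{Y}=\{(x,y,z)\in\mathbb{R}^3 : x^2+y^2=1\}$. Let $G=(V,E)$ be a finite simple graph with $V\neq\emptyset$, let $\Gamma$ be a group, let $\phi:\Gamma\to\operatorname{Aut}(G)$ be a homomorphism, and let $\tau:\Gamma\to O(\mathbb{R}^3)$ be an injective homomorphism whose image $\tau(\Gamma)$ is either $C_i$, the group of order two generated by the inversion $x\mapsto -x$, or $C_s$, a group of order two generated by the reflection in a plane through the origin that contains the $z$-axis or is perpendicular to it. A $\tau(\Gamma)$-symmetric framework on $\mathcal{Y}$ is a pair $(G,p)$ with $p:V\to\mathcal{Y}$, $p(u)\ne p(v)$ for all $uv\in E$, and $\tau(\gamma)p(v)=p(\phi(\gamma)v)$ for all $\gamma\in\Gamma$, $v\in V$. Write $p(v)=(x_v,y_v,z_v)$. The infinitesimal motions of $(G,p)$ are the maps $\dot p:V\to\mathbb{R}^3$ with $(p(u)-p(v))\cdot(\dot p(u)-\dot p(v))=0$ for all $uv\in E$ and $(x_v,y_v,0)\cdot\dot p(v)=0$ for all $v\in V$. The framework is infinitesimally rigid if every infinitesimal motion is of the form $\dot p(v)=a(0,0,1)+b(-y_v,x_v,0)$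 with $a,b\in\mathbb{R}$; it is isostatic if, moreover, the $|E|+|V|$ rows of the matrix of this linear system (the rigidity matrix of $(G,p)$ on $\mathcal{Y}$) are linearly independent. The graph $G$ is $\tau(\Gamma)$-isostatic on $\mathcal{Y}$ (with respect to $\phi$ and $\tau$) if some $\tau(\Gamma)$-symmetric framework $(G,p)$ on $\mathcal{Y}$ is isostatic. Let $\gamma$ be the non-trivial element of $\Gamma$. (1) If $\tau(\Gamma)=C_s$, then $G$ is $\tau(\Gamma)$-isostatic on $\mathcal{Y}$ if and only if $G$ is the edge-disjoint union of two spanning trees $T_1,T_2$ with $T_1=\phi(\gamma)(T_2)$. (2) If $\tau(\Gamma)=C_i$, then $G$ is $\tau(\Gamma)$-isostatic on $\mathcal{Y}$ if and only if $\phi(\gamma)$ fixes no vertex of $G$ and $G$ is the edge-disjoint union of two spanning trees $T_1,T_2$ with $T_1=\phi(\gamma)(T_2)$. -/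

import Mathlib

/-- Euclidean 3-space. -/
abbrev E3 : Type := EuclideanSpace ℝ (Fin 3)

/-- The infinite circular cylinder `x² + y² = 1` in `ℝ³`, with axis the `z`-axis. -/
def cylinder : Set E3 := {x | x 0 ^ 2 + x 1 ^ 2 = 1}

section Frameworks

variable {V : Type*}

/-- `(G, p)` is a framework on the cylinder. -/
def IsCylinderFramework (G : SimpleGraph V) (p : V → E3) : Prop :=
  (∀ v, p v ∈ cylinder) ∧ ∀ u v, G.Adj u v → p u ≠ p v

/-- Infinitesimal motions of `(G, p)` on the cylinder. -/
def IsInfinitesimalMotion (G : SimpleGraph V) (p p' : V → E3) : Prop :=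
  (∀ u v, G.Adj u v → inner ℝ (p u - p v) (p' u - p' v) = 0) ∧
    ∀ v, p v 0 * p' v 0 + p v 1 * p' v 1 = 0

/-- Trivial motions: combinations of the translation along the `z`-axis and of the rotation
about the `z`-axis. -/
def IsTrivialMotion (p p' : V → E3) : Prop :=
  ∃ a b : ℝ, ∀ v, p' v = a • !₂[(0 : ℝ), 0, 1] + b • !₂[-(p v 1), p v 0, 0]

/-- Infinitesimal rigidity on the cylinder. -/
def IsInfinitesimallyRigid (G : SimpleGraph V) (p : V → E3) : Prop :=
  ∀ p' : V → E3, IsInfinitesimalMotion G p p' → IsTrivialMotion p p'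

open Classical in
/-- The row of the rigidity matrix of an edge `uv`: it has `p u - p v` in the columns of `u`,
`p v - p u` in the columns of `v`, and `0` elsewhere. -/
noncomputable def edgeRow (p : V → E3) (e : Sym2 V) : V × Fin 3 → ℝ :=
  Sym2.lift
    ⟨fun u v wk =>
      (if wk.1 = u then p u wk.2 - p v wk.2 else 0) +
        (if wk.1 = v then p v wk.2 - p u wk.2 else 0),
      fun _ _ => funext fun _ => add_comm _ _⟩ e

open Classical in
/-- The row of the rigidity matrix of a vertex `v`: it has the normal `(x, y, 0)` of the cylinder
at `p v = (x, y, z)` in the columns of `v`, and `0` elsewhere. -/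
noncomputable def vertexRow (p : V → E3) (v : V) : V × Fin 3 → ℝ :=
  fun wk => if wk.1 = v then !₂[p v 0, p v 1, (0 : ℝ)] wk.2 else 0

/-- The rigidity matrix of `(G, p)` on the cylinder, with `|E| + |V|` rows and `3|V|` columns. -/
noncomputable def rigidityMatrix (G : SimpleGraph V) (p : V → E3) :
    Matrix (G.edgeSet ⊕ V) (V × Fin 3) ℝ :=
  Matrix.of (Sum.elim (fun e => edgeRow p e.1) (fun v => vertexRow p v))

/-- `(G, p)` is isostatic on the cylinder: it is infinitesimally rigid, and the rigidity matrix has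
no non-trivial row dependence. -/
def IsIsostaticFramework (G : SimpleGraph V) (p : V → E3) : Prop :=
  IsInfinitesimallyRigid G p ∧ LinearIndependent ℝ (rigidityMatrix G p).row

variable {Γ : Type*} [Group Γ]

/-- `(G, p)` is a `Γ`-symmetric framework on the cylinder with respect to the action
`φ : Γ → Aut G` and the representation `τ : Γ → O(ℝ³)`. -/
def IsSymmetricFramework {G : SimpleGraph V} (φ : Γ →* (G ≃g G)) (τ : Γ →* (E3 ≃ₗᵢ[ℝ] E3))
    (p : V → E3) : Prop :=
  IsCylinderFramework G p ∧ ∀ (γ : Γ) (v : V), τ γ (p v) = p (φ γ v)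

/-- `G` is `τ(Γ)`-isostatic on the cylinder (with respect to `φ` and `τ`). -/
def IsSymmetricIsostatic {G : SimpleGraph V} (φ : Γ →* (G ≃g G))
    (τ : Γ →* (E3 ≃ₗᵢ[ℝ] E3)) : Prop :=
  ∃ p : V → E3, IsSymmetricFramework φ τ p ∧ IsIsostaticFramework G p

/-- For a group `Γ` of order two: `G` is the edge-disjoint union of two spanning trees
`T₁`, `T₂`, where `T₁` is the image of `T₂` under the automorphism of `G` that is given by the
non-trivial element of `Γ`. -/
def IsUnionOfTwoSymmetricTrees {G : SimpleGraph V} (φ : Γ →* (G ≃g G)) : Prop :=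
  ∃ T₁ T₂ : SimpleGraph V, T₁.IsTree ∧ T₂.IsTree ∧
    Disjoint T₁.edgeSet T₂.edgeSet ∧ T₁.edgeSet ∪ T₂.edgeSet = G.edgeSet ∧
    ∃ γ : Γ, γ ≠ 1 ∧ T₁ = T₂.map (φ γ).toEquiv.toEmbedding

end Frameworks

/-- The group `C_i`, generated by the inversion in the origin. -/
noncomputable def groupCi : Subgroup (E3 ≃ₗᵢ[ℝ] E3) :=
  Subgroup.zpowers (LinearIsometryEquiv.neg ℝ)

/-- `H` is a group `C_s`: it is generated by the reflection in a plane through the origin, with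
normal vector `n`, that contains the `z`-axis or is perpendicular to it. -/
def IsGroupCs (H : Subgroup (E3 ≃ₗᵢ[ℝ] E3)) : Prop :=
  ∃ n : E3, n ≠ 0 ∧ (n 2 = 0 ∨ (n 0 = 0 ∧ n 1 = 0)) ∧
    H = Subgroup.zpowers ((Submodule.span ℝ {n})ᗮ).reflection

/-! A tangent motion of the cylinder is a pair of functions on the vertices, the angular velocity
`x` and the axial velocity `y`. An edge with direction `d = dirn (p u) (p v)` demands `d.1 * (x u -
x v) + d.2 * (y u - y v) = 0`, and the trivial motions are the pairs of constants. The inversion and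
the admissible reflections act on the angular and the axial part with opposite signs. Hence the
motions with `x ∘ g = σ x` and `y ∘ g = -σ y`, for `σ = ±1`, are exactly `x = f + σ f ∘ g`, `y = f -
σ f ∘ g` for a single function `f`. The two edges of an orbit give the same equation in `f`, a
combination of the differences of `f` along these edges (`orbitRow`). The framework is rigid if and
only if, for both signs, only constant `f` solve all these equations
(`isInfinitesimallyRigid_iff_orbitRow`).

Necessity (`exists_transversal_tree`): for one of the signs an edge fixed by `g` imposes no
condition, so there are at least `|V| - 1` orbits of two edges, while independence of the rows gives
`|E| ≤ 2|V| - 2`. So no edge is fixed and there are exactly `|V| - 1` orbits. The direction of one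
orbit may be moved anywhere off one line without losing rigidity (`OrbitRigid.exists_exchange`), in
particular to a direction whose equation is the equality of `f` along one edge of the orbit.
Rigidity then says that the chosen edges connect the graph: they form a spanning tree, and the other
edges form its image.

Sufficiency (`IsLabelledTree.realizable`): a tree disjoint from its image is realized by induction.
The average degree is less than two, so some `v` has degrees at `v` and `g v` adding up to at most
three. These vertices are removed and put back as in a Henneberg construction. In the main case `v`
is joined to `a` and `b`, and `g v` to one vertex. The two edges at `v` are replaced by an edge `ab`
whose direction is not tied to the points, which is why trees carry labels. The exchange property
moves this direction to one that is common to the lines from a new point to `a` and to `b`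
(`exists_parallel`). Each sign excludes only one line of directions, so one configuration serves
both. Counting edges turns rigid into isostatic. -/

/-! ### Linear algebra of the orbit equations. -/

section OrbitRigidity

variable {V ι : Type*}

/-- The equation of the orbit of an edge with end-vertices `e` and direction `D` under an
involution `g`, on the motions that `g` multiplies by the sign `σ`; such motions are encoded by
one function on the vertices. -/
def orbitRow (g : V → V) (σ : ℝ) (D : ℝ × ℝ) (e : V × V) (f : V → ℝ) : ℝ :=
  D.1 * ((f e.1 - f e.2) + σ * (f (g e.1) - f (g e.2))) +
    D.2 * ((f e.1 - f e.2) - σ * (f (g e.1) - f (g e.2)))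

/-- The orbit equations have only constant solutions on `S`. -/
def OrbitRigid (g : V → V) (σ : ℝ) (S : Finset V) (I : Finset ι) (ends : ι → V × V)
    (D : ι → ℝ × ℝ) : Prop :=
  ∀ f : V → ℝ, (∀ i ∈ I, orbitRow g σ (D i) (ends i) f = 0) → ∀ u ∈ S, ∀ v ∈ S, f u = f v

/-- The edges `ends i`, `i ∈ I`, join all the vertices of `S` to each other. -/
def Joins (S : Finset V) (I : Finset ι) (ends : ι → V × V) : Prop :=
  ∀ f : V → ℝ, (∀ i ∈ I, f (ends i).1 = f (ends i).2) → ∀ u ∈ S, ∀ v ∈ S, f u = f v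

lemma orbitRow_add (g : V → V) (σ : ℝ) (D : ℝ × ℝ) (e : V × V) (f h : V → ℝ) :
    orbitRow g σ D e (fun v => f v + h v) = orbitRow g σ D e f + orbitRow g σ D e h := by
  simp only [orbitRow]; ring

lemma orbitRow_smul (g : V → V) (σ : ℝ) (D : ℝ × ℝ) (e : V × V) (c : ℝ) (f : V → ℝ) :
    orbitRow g σ D e (fun v => c * f v) = c * orbitRow g σ D e f := by
  simp only [orbitRow]; ring

lemma orbitRow_sub_mul (g : V → V) (σ : ℝ) (D : ℝ × ℝ) (e : V × V) (c : ℝ) (f h : V → ℝ) :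
    orbitRow g σ D e (fun v => f v - c * h v) = orbitRow g σ D e f - c * orbitRow g σ D e h := by
  simp only [orbitRow]; ring

/-- The link with connectedness: for this direction, and for the one in `orbitRow_half_neg`, the
equation involves one edge of the orbit only. -/
lemma orbitRow_half (g : V → V) (σ : ℝ) (e : V × V) (f : V → ℝ) :
    orbitRow g σ (1 / 2, 1 / 2) e f = f e.1 - f e.2 := by
  simp only [orbitRow]; ring

lemma orbitRow_half_neg (g : V → V) (σ : ℝ) (e : V × V) (f : V → ℝ) :
    orbitRow g σ (1 / 2, -1 / 2) e f = σ * (f (g e.1) - f (g e.2)) := by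
  simp only [orbitRow]; ring

lemma orbitRow_swap (g : V → V) (σ : ℝ) (D : ℝ × ℝ) (e : V × V) (f : V → ℝ) :
    orbitRow g σ (-D) e.swap f = orbitRow g σ D e f := by
  simp only [orbitRow, Prod.fst_swap, Prod.snd_swap, Prod.fst_neg, Prod.snd_neg]; ring

/-- The isometry negates one coordinate of a direction relative to the other, so the two edges of an
orbit carry the same equation up to sign. -/
lemma orbitRow_map {g : V → V} (hg : Function.Involutive g) {σ : ℝ} (hσ : σ * σ = 1) (D : ℝ × ℝ)
    (e : V × V) (f : V → ℝ) :
    orbitRow g σ (D.1, -D.2) (g e.1, g e.2) f = σ * orbitRow g σ D e f := by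
  simp only [orbitRow, hg e.1, hg e.2]
  linear_combination (D.2 - D.1) * (f (g e.1) - f (g e.2)) * hσ

lemma orbitRow_mul (g : V → V) (σ : ℝ) (c : ℝ) (D : ℝ × ℝ) (e : V × V) (f : V → ℝ) :
    orbitRow g σ (c • D) e f = c * orbitRow g σ D e f := by
  simp only [orbitRow, Prod.smul_fst, Prod.smul_snd, smul_eq_mul]; ring

lemma joins_iff_orbitRigid (g : V → V) (σ : ℝ) (S : Finset V) (I : Finset ι) (ends : ι → V × V) :
    Joins S I ends ↔ OrbitRigid g σ S I ends fun _ => (1 / 2, 1 / 2) := by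
  simp only [Joins, OrbitRigid, orbitRow_half, sub_eq_zero]

lemma OrbitRigid.card_le {g : V → V} {σ : ℝ} {S : Finset V} {I : Finset ι} {ends : ι → V × V}
    {D : ι → ℝ × ℝ} (h : OrbitRigid g σ S I ends D) : S.card ≤ I.card + 1 := by
  classical
  rcases S.eq_empty_or_nonempty with rfl | ⟨r, hr⟩
  · simp
  -- Rigidity speaks about functions on all of `V`, so functions on `S` are extended by zero; the
  -- value at `r` then removes the constants.
  let ext : (S → ℝ) → V → ℝ := fun f v => if hv : v ∈ S then f ⟨v, hv⟩ else 0
  have hadd : ∀ f f' v, ext (f + f') v = ext f v + ext f' v := by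
    intro f f' v; by_cases hv : v ∈ S <;> simp [ext, hv]
  have hsmul : ∀ (c : ℝ) f v, ext (c • f) v = c * ext f v := by
    intro c f v; by_cases hv : v ∈ S <;> simp [ext, hv]
  let L : (S → ℝ) →ₗ[ℝ] (I → ℝ) × ℝ :=
    { toFun := fun f => (fun i => orbitRow g σ (D i) (ends i) (ext f), f ⟨r, hr⟩)
      map_add' := by
        intro f f'
        ext i
        · simp only [Prod.fst_add, Pi.add_apply, ← orbitRow_add]
          congr 1; funext v; exact hadd f f' v
        · simp
      map_smul' := by
        intro c f
        ext i
        · simp only [Prod.smul_fst, Pi.smul_apply, smul_eq_mul, ← orbitRow_smul, RingHom.id_apply]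
          congr 1; funext v; exact hsmul c f v
        · simp }
  have hL : Function.Injective L := by
    rw [← LinearMap.ker_eq_bot, LinearMap.ker_eq_bot']
    intro f hf
    have h1 : ∀ i ∈ I, orbitRow g σ (D i) (ends i) (ext f) = 0 := fun i hi =>
      congrFun (congrArg Prod.fst hf) ⟨i, hi⟩
    have h2 : f ⟨r, hr⟩ = 0 := congrArg Prod.snd hf
    funext v
    have := h (ext f) h1 v v.2 r hr
    simpa [ext, hr, h2] using this
  have := LinearMap.finrank_le_finrank_of_injective hL
  simpa using this

lemma Joins.card_le {S : Finset V} {I : Finset ι} {ends : ι → V × V} (h : Joins S I ends) :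
    S.card ≤ I.card + 1 :=
  ((joins_iff_orbitRigid id 1 S I ends).1 h).card_le

/-- The direction of one orbit may be changed to any direction off one line. -/
lemma OrbitRigid.exists_exchange [DecidableEq ι] {g : V → V} {σ : ℝ} {S : Finset V} {I : Finset ι}
    {ends : ι → V × V} {D : ι → ℝ × ℝ} (h : OrbitRigid g σ S I ends D) (hgS : ∀ v ∈ S, g v ∈ S) {j : ι} (hj : j ∈ I)
    (hS : (ends j).1 ∈ S ∧ (ends j).2 ∈ S) :
    ∃ A B : ℝ, (A ≠ 0 ∨ B ≠ 0) ∧ ∀ D' : ℝ × ℝ, A * D'.1 + B * D'.2 ≠ 0 →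
      OrbitRigid g σ S I ends (Function.update D j D') := by
  -- If the other equations already force constancy, the direction at `j` is irrelevant. Otherwise
  -- they have a solution `k` that is not constant on `S`, and `A`, `B` are the coefficients of the
  -- equation at `j`, evaluated at `k`, as a linear form in the direction.
  by_cases hK : ∀ f : V → ℝ, (∀ i ∈ I, i ≠ j → orbitRow g σ (D i) (ends i) f = 0) →
      ∀ u ∈ S, ∀ v ∈ S, f u = f v
  · refine ⟨1, 0, Or.inl one_ne_zero, fun D' _ f hf => hK f fun i hi hij => ?_⟩
    simpa [Function.update_of_ne hij] using hf i hi
  push Not at hK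
  obtain ⟨k, hk, u, hu, v, hv, huv⟩ := hK
  have hkj : orbitRow g σ (D j) (ends j) k ≠ 0 := fun h0 =>
    huv (h k (fun i hi => if hij : i = j then hij ▸ h0 else hk i hi hij) u hu v hv)
  refine ⟨(k (ends j).1 - k (ends j).2) + σ * (k (g (ends j).1) - k (g (ends j).2)),
    (k (ends j).1 - k (ends j).2) - σ * (k (g (ends j).1) - k (g (ends j).2)), ?_, ?_⟩
  · by_contra! h0
    exact hkj (by simp only [orbitRow, h0.1, h0.2]; ring)
  intro D' hD' f hf
  have hrow : orbitRow g σ D' (ends j) k ≠ 0 := by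
    simp only [orbitRow]; intro h0; exact hD' (by linarith)
  -- Subtracting `c * k` turns a solution of the new system into one of the old system, which is
  -- constant on `S`. The new equation at `j` vanishes on constants, which forces `c = 0`.
  set c := orbitRow g σ (D j) (ends j) f / orbitRow g σ (D j) (ends j) k with hc
  have h1 : ∀ a ∈ S, ∀ b ∈ S, f a - c * k a = f b - c * k b := by
    refine h (fun w => f w - c * k w) fun i hi => ?_
    rw [orbitRow_sub_mul]
    by_cases hij : i = j
    · subst hij; rw [hc]; field_simp; ring
    · have := hf i hi
      rw [Function.update_of_ne hij] at this
      rw [this, hk i hi hij]; ring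
  have h2 : c = 0 := by
    have h3 := hf j hj
    rw [Function.update_self] at h3
    have h4 : orbitRow g σ D' (ends j) (fun w => f w - c * k w) = 0 := by
      simp only [orbitRow, h1 _ hS.1 _ hS.2, h1 _ (hgS _ hS.1) _ (hgS _ hS.2)]; ring
    rw [orbitRow_sub_mul, h3] at h4
    have h5 : c * orbitRow g σ D' (ends j) k = 0 := by linarith
    exact (mul_eq_zero.1 h5).resolve_right hrow
  intro a ha b hb
  have := h1 a ha b hb
  rw [h2] at this; linarith

/-- Rigidity is stable under small changes of the directions. -/
lemma OrbitRigid.eventually [Finite V] {g : V → V} {σ : ℝ} {S : Finset V}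
    {I : Finset ι} {ends : ι → V × V} (hgS : ∀ v ∈ S, g v ∈ S)
    (hS : ∀ i ∈ I, (ends i).1 ∈ S ∧ (ends i).2 ∈ S)
    {X : Type*} [TopologicalSpace X] {D : X → ι → ℝ × ℝ} (hD : Continuous D) {x₀ : X}
    (h : OrbitRigid g σ S I ends (D x₀)) :
    ∀ᶠ x in nhds x₀, OrbitRigid g σ S I ends (D x) := by
  classical
  have := Fintype.ofFinite V
  rcases S.eq_empty_or_nonempty with rfl | ⟨r, hr⟩
  · exact Filter.Eventually.of_forall fun x f _ u hu => absurd hu (Finset.notMem_empty u)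
  -- The second component records `f` at the root `r` and outside `S`, that is, everything that
  -- rigidity leaves undetermined. Injectivity of `L x` is therefore rigidity, and injectivity is an
  -- open condition.
  let L (x : X) : (V → ℝ) →ₗ[ℝ] (I → ℝ) × (V → ℝ) :=
    { toFun := fun f => (fun i => orbitRow g σ (D x i) (ends i) f,
        fun v => if v ∈ S ∧ v ≠ r then 0 else f v)
      map_add' := by
        intro f f'
        ext i
        · exact orbitRow_add g σ (D x i) (ends i) f f'
        · by_cases hi : i ∈ S ∧ i ≠ r <;> simp [hi]
      map_smul' := by
        intro c f
        ext i
        · exact orbitRow_smul g σ (D x i) (ends i) c f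
        · by_cases hi : i ∈ S ∧ i ≠ r <;> simp [hi] }
  have hiff : ∀ x, Function.Injective (L x) ↔ OrbitRigid g σ S I ends (D x) := by
    intro x
    rw [← LinearMap.ker_eq_bot, LinearMap.ker_eq_bot']
    constructor
    · intro hinj f hf
      have hz : (fun v => if v ∈ S then f v - f r else 0) = (0 : V → ℝ) := by
        refine hinj _ (Prod.ext ?_ ?_)
        · funext i
          have hi := hS i i.2
          have h0 := hf i i.2
          simp only [orbitRow] at h0
          simp only [L, LinearMap.coe_mk, AddHom.coe_mk, orbitRow, hi.1, hi.2, hgS _ hi.1,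
            hgS _ hi.2, if_true, Prod.fst_zero, Pi.zero_apply]
          rw [← h0]; ring
        · funext v
          by_cases hv : v ∈ S
          · by_cases hvr : v = r <;> simp [L, hv, hvr]
          · simp [L, hv]
      intro u hu v hv
      have h1 := congrFun hz u
      have h2 := congrFun hz v
      simp only [hu, hv, if_true, Pi.zero_apply] at h1 h2
      linarith
    · intro hr' f hf
      have h1 : ∀ i ∈ I, orbitRow g σ (D x i) (ends i) f = 0 := fun i hi =>
        congrFun (congrArg Prod.fst hf) ⟨i, hi⟩
      have h2 : ∀ v, (if v ∈ S ∧ v ≠ r then 0 else f v) = 0 := fun v =>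
        congrFun (congrArg Prod.snd hf) v
      have h3 : f r = 0 := by simpa using h2 r
      funext v
      by_cases hv : v ∈ S
      · rw [hr' f h1 v hv r hr, h3]; rfl
      · simpa [hv] using h2 v
  have hcont : Continuous fun x => LinearMap.toContinuousLinearMap (L x) := by
    rw [continuous_clm_apply]
    intro f
    simp only [LinearMap.coe_toContinuousLinearMap', L, LinearMap.coe_mk, AddHom.coe_mk, orbitRow]
    fun_prop
  have hopen := (ContinuousLinearMap.isOpen_injective (𝕜 := ℝ) (E := V → ℝ)
    (F := (I → ℝ) × (V → ℝ))).preimage hcont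
  have hx₀ : x₀ ∈ (fun x => LinearMap.toContinuousLinearMap (L x)) ⁻¹'
      {L | Function.Injective L} := (hiff x₀).2 h
  filter_upwards [hopen.mem_nhds hx₀] with x hx
  exact (hiff x).1 hx

end OrbitRigidity

/-! ### Points of the cylinder with prescribed directions. -/

section CylinderPoints

/-- The direction of an edge between two points of the cylinder: the coefficients of the
difference of the angular velocities and of the difference of the axial velocities. -/
def dirn (p q : Fin 3 → ℝ) : ℝ × ℝ := (p 1 * q 0 - p 0 * q 1, p 2 - q 2)

/-- The point lies on the cylinder. -/
def OnCylinder (p : Fin 3 → ℝ) : Prop := p 0 ^ 2 + p 1 ^ 2 = 1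

lemma dirn_swap (p q : Fin 3 → ℝ) : dirn q p = -dirn p q := by
  simp only [dirn]; ext <;> simp; ring

lemma dirn_ne_zero_comm {p q : Fin 3 → ℝ} : dirn p q ≠ 0 ↔ dirn q p ≠ 0 := by
  rw [dirn_swap q p, neg_ne_zero]

lemma dirn_ne_zero_iff {p q : Fin 3 → ℝ} :
    dirn p q ≠ 0 ↔ p 1 * q 0 - p 0 * q 1 ≠ 0 ∨ p 2 ≠ q 2 := by
  simp only [dirn, Ne, Prod.mk_eq_zero, sub_eq_zero, not_and_or]

open Polynomial in
lemma exists_forall_eval_ne_zero {n : ℕ} (P : Fin n → ℝ[X]) (hP : ∀ k, P k ≠ 0) :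
    ∃ t : ℝ, ∀ k, (P k).eval t ≠ 0 := by
  have h : (∏ k, P k) ≠ 0 := Finset.prod_ne_zero_iff.2 fun k _ => hP k
  by_contra! hcon
  refine h (Polynomial.funext fun t => ?_)
  obtain ⟨k, hk⟩ := hcon t
  rw [eval_prod, eval_zero]
  exact Finset.prod_eq_zero (Finset.mem_univ k) hk

open Polynomial in
lemma exists_forall_affine_ne_zero {n : ℕ} (α β : Fin n → ℝ) (h : ∀ k, α k ≠ 0 ∨ β k ≠ 0) :
    ∃ t : ℝ, ∀ k, α k * t + β k ≠ 0 := by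
  obtain ⟨t, ht⟩ := exists_forall_eval_ne_zero (fun k => C (α k) * X + C (β k)) (by
    intro k h0
    have h1 := congrArg (fun P => P.coeff 0) h0
    have h2 := congrArg (fun P => P.coeff 1) h0
    simp at h1 h2
    rcases h k with h' | h'
    · exact h' h2
    · exact h' h1)
  exact ⟨t, fun k => by simpa using ht k⟩

-- The rational parametrization `((1 - t²) / (1 + t²), 2t / (1 + t²))` turns each form into a
-- nonzero polynomial of degree at most two in `t`, after multiplication by `1 + t²`.
open Polynomial in
lemma exists_circle_forall_ne_zero {n : ℕ} (α β γ : Fin n → ℝ)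
    (h : ∀ k, α k ≠ 0 ∨ β k ≠ 0 ∨ γ k ≠ 0) :
    ∃ x y : ℝ, x ^ 2 + y ^ 2 = 1 ∧ ∀ k, α k * x + β k * y + γ k ≠ 0 := by
  obtain ⟨t, ht⟩ := exists_forall_eval_ne_zero
    (fun k => C (γ k - α k) * X ^ 2 + C (2 * β k) * X + C (γ k + α k)) (by
    intro k h0
    have h1 := congrArg (fun P => P.coeff 0) h0
    have h2 := congrArg (fun P => P.coeff 1) h0
    have h3 := congrArg (fun P => P.coeff 2) h0
    simp only [coeff_add, coeff_C_mul, coeff_X_pow, coeff_X, coeff_C, coeff_zero] at h1 h2 h3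
    norm_num at h1 h2 h3
    rcases h k with h' | h' | h'
    · exact h' (by linarith)
    · exact h' h2
    · exact h' (by linarith))
  have hpos : (1 + t ^ 2) ≠ 0 := by positivity
  refine ⟨(1 - t ^ 2) / (1 + t ^ 2), 2 * t / (1 + t ^ 2), by field_simp; ring, fun k hk => ht k ?_⟩
  simp only [eval_add, eval_mul, eval_C, eval_X, eval_pow]
  field_simp at hk
  linarith

/-- A line through two points of the cylinder with different heights and different horizontal parts
meets the cylinder in these two points only. -/
lemma collinear_aux {a0 a1 a2 b0 b1 b2 c0 c1 c2 : ℝ} (ha : a0 ^ 2 + a1 ^ 2 = 1)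
    (hb : b0 ^ 2 + b1 ^ 2 = 1) (hc : c0 ^ 2 + c1 ^ 2 = 1) (hdot : a0 * b0 + a1 * b1 ≠ 1)
    (hz : a2 ≠ b2) (h0 : a0 * (b2 - c2) + b0 * (c2 - a2) + c0 * (a2 - b2) = 0)
    (h1 : a1 * (b2 - c2) + b1 * (c2 - a2) + c1 * (a2 - b2) = 0) :
    (c0 = a0 ∧ c1 = a1 ∧ c2 = a2) ∨ (c0 = b0 ∧ c1 = b1 ∧ c2 = b2) := by
  have hz' : a2 - b2 ≠ 0 := sub_ne_zero.2 hz
  -- Along the line through `a` and `b`, `x² + y² - 1` is a quadratic in the height with roots `a2`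
  -- and `b2`; its leading coefficient is nonzero because of `hdot`.
  have key : (b2 - c2) * (c2 - a2) * (a0 * b0 + a1 * b1 - 1) * 2 = 0 := by
    have e0 : c0 * (a2 - b2) = -(a0 * (b2 - c2) + b0 * (c2 - a2)) := by linarith
    have e1 : c1 * (a2 - b2) = -(a1 * (b2 - c2) + b1 * (c2 - a2)) := by linarith
    have : (c0 * (a2 - b2)) ^ 2 + (c1 * (a2 - b2)) ^ 2 = (a2 - b2) ^ 2 := by
      linear_combination (a2 - b2) ^ 2 * hc
    rw [e0, e1] at this
    linear_combination this - (b2 - c2) ^ 2 * ha - (c2 - a2) ^ 2 * hb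
  have hdot' : a0 * b0 + a1 * b1 - 1 ≠ 0 := sub_ne_zero.2 hdot
  have h3 : b2 - c2 = 0 ∨ c2 - a2 = 0 := by
    simpa [hdot'] using key
  rcases h3 with h3 | h3
  · right
    have h4 : c2 = b2 := by linarith
    subst h4
    refine ⟨mul_right_cancel₀ hz' ?_, mul_right_cancel₀ hz' ?_, rfl⟩ <;> linarith
  · left
    have h4 : c2 = a2 := by linarith
    subst h4
    refine ⟨mul_right_cancel₀ hz' ?_, mul_right_cancel₀ hz' ?_, rfl⟩ <;> linarith

/-- For a given horizontal part `(x, y)` of `p`, parallelism of the directions to `a` and `b` is a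
linear equation for the height of `p`. All other conditions become affine forms in `(x, y)` that
must not vanish, so a generic point of the circle works. -/
lemma exists_parallel_of_height_ne {a b c : Fin 3 → ℝ} (ha : OnCylinder a) (hb : OnCylinder b)
    (hc : OnCylinder c) (hdot : a 0 * b 0 + a 1 * b 1 ≠ 1) (hz : a 2 ≠ b 2)
    (hac : dirn a c ≠ 0) (hbc : dirn b c ≠ 0) {A B A' B' : ℝ} (hAB : A ≠ 0 ∨ B ≠ 0)
    (hAB' : A' ≠ 0 ∨ B' ≠ 0) :
    ∃ (p : Fin 3 → ℝ) (D : ℝ × ℝ) (k l : ℝ), OnCylinder p ∧ k ≠ 0 ∧ l ≠ 0 ∧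
      dirn p a = k • D ∧ dirn p b = l • D ∧ A * D.1 + B * D.2 ≠ 0 ∧ A' * D.1 + B' * D.2 ≠ 0 ∧
      D.1 * (dirn p c).2 - D.2 * (dirn p c).1 ≠ 0 := by
  simp only [OnCylinder] at *
  have hz' : b 2 - a 2 ≠ 0 := sub_ne_zero.2 hz.symm
  have hcirc : ∀ {x y : ℝ}, x ^ 2 + y ^ 2 = 1 → -y ≠ 0 ∨ x ≠ 0 ∨ (0 : ℝ) ≠ 0 := by
    intro x y h
    by_contra! h0
    rw [neg_eq_zero.1 h0.1, h0.2.1] at h; norm_num at h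
  have hdiff : -(a 1 - b 1) ≠ 0 ∨ a 0 - b 0 ≠ 0 := by
    by_contra! h0
    exact hdot (by
      have e1 : b 1 = a 1 := by linarith
      have e0 : b 0 = a 0 := by linarith
      rw [e1, e0]; linarith)
  have hQ : ∀ {A B : ℝ}, (A ≠ 0 ∨ B ≠ 0) → A * -(a 1 - b 1) ≠ 0 ∨ A * (a 0 - b 0) ≠ 0 ∨
      B * (b 2 - a 2) ≠ 0 := by
    intro A B h
    rcases h with h | h
    · rcases hdiff with h' | h'
      · exact Or.inl (mul_ne_zero h h')
      · exact Or.inr (Or.inl (mul_ne_zero h h'))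
    · exact Or.inr (Or.inr (mul_ne_zero h hz'))
  -- Both coefficients of the form belonging to `c` vanish only if `a`, `b`, `c` are collinear, and
  -- then `c` is `a` or `b`.
  have hK : -(a 1 * (b 2 - c 2) + b 1 * (c 2 - a 2) + c 1 * (a 2 - b 2)) ≠ 0 ∨
      a 0 * (b 2 - c 2) + b 0 * (c 2 - a 2) + c 0 * (a 2 - b 2) ≠ 0 ∨ (0 : ℝ) ≠ 0 := by
    by_contra! h0
    rcases collinear_aux ha hb hc hdot hz h0.2.1 (neg_eq_zero.1 h0.1) with h | h
    · exact hac (by simp only [dirn, h.1, h.2.1, h.2.2]; ext <;> simp; ring)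
    · exact hbc (by simp only [dirn, h.1, h.2.1, h.2.2]; ext <;> simp; ring)
  obtain ⟨x, y, hxy, h⟩ := exists_circle_forall_ne_zero
    ![-a 1, -b 1, -(a 1 - b 1), A * -(a 1 - b 1), A' * -(a 1 - b 1),
      -(a 1 * (b 2 - c 2) + b 1 * (c 2 - a 2) + c 1 * (a 2 - b 2))]
    ![a 0, b 0, a 0 - b 0, A * (a 0 - b 0), A' * (a 0 - b 0),
      a 0 * (b 2 - c 2) + b 0 * (c 2 - a 2) + c 0 * (a 2 - b 2)]
    ![0, 0, 0, B * (b 2 - a 2), B' * (b 2 - a 2), 0] (by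
      intro k
      fin_cases k
      · exact hcirc ha
      · exact hcirc hb
      · exact hdiff.imp_right Or.inl
      · exact hQ hAB
      · exact hQ hAB'
      · exact hK)
  have h0 := h 0
  have h1 := h 1
  have h2 := h 2
  have h3 := h 3
  have h4 := h 4
  have h5 := h 5
  simp only [Matrix.cons_val] at h0 h1 h2 h3 h4 h5
  set sa := y * a 0 - x * a 1 with hsa
  set sb := y * b 0 - x * b 1 with hsb
  set sc := y * c 0 - x * c 1 with hsc
  have hsa0 : sa ≠ 0 := fun h => h0 (by linarith)
  have hsb0 : sb ≠ 0 := fun h => h1 (by linarith)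
  have hd : sa - sb ≠ 0 := fun h => h2 (by linarith)
  refine ⟨![x, y, (b 2 * sa - a 2 * sb) / (sa - sb)], (sa - sb, b 2 - a 2), sa / (sa - sb),
    sb / (sa - sb), by simpa using hxy, div_ne_zero hsa0 hd, div_ne_zero hsb0 hd, ?_, ?_, ?_, ?_,
    ?_⟩
  · ext
    · simp [dirn, ← hsa]; field_simp
    · simp [dirn]; field_simp; ring
  · ext
    · simp [dirn, ← hsb]; field_simp
    · simp [dirn]; field_simp; ring
  · intro h; exact h3 (by rw [hsa, hsb] at h; simp only at h; linarith)
  · intro h; exact h4 (by rw [hsa, hsb] at h; simp only at h; linarith)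
  · intro h
    simp [dirn, ← hsc] at h
    apply h5
    field_simp at h
    rw [hsa, hsb, hsc] at h
    linarith

/-- At equal heights the second coordinates of the two directions agree, so the first coordinates
are made equal as well: the horizontal part of `p` is taken parallel to the chord from `b` to `a`.
The height stays free and is used to satisfy the other conditions. -/
lemma exists_parallel_of_height_eq {a b c : Fin 3 → ℝ} (ha : OnCylinder a) (hb : OnCylinder b)
    (hc : OnCylinder c) (hab : dirn a b ≠ 0) (hz : a 2 = b 2)
    (hac : dirn a c ≠ 0) (hbc : dirn b c ≠ 0) {A B A' B' : ℝ} (hAB : A ≠ 0 ∨ B ≠ 0)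
    (hAB' : A' ≠ 0 ∨ B' ≠ 0) :
    ∃ (p : Fin 3 → ℝ) (D : ℝ × ℝ) (k l : ℝ), OnCylinder p ∧ k ≠ 0 ∧ l ≠ 0 ∧
      dirn p a = k • D ∧ dirn p b = l • D ∧ A * D.1 + B * D.2 ≠ 0 ∧ A' * D.1 + B' * D.2 ≠ 0 ∧
      D.1 * (dirn p c).2 - D.2 * (dirn p c).1 ≠ 0 := by
  have hX : a 1 * b 0 - a 0 * b 1 ≠ 0 := (dirn_ne_zero_iff.1 hab).resolve_right (not_not.2 hz)
  simp only [OnCylinder] at *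
  have hN : 0 < (a 0 - b 0) ^ 2 + (a 1 - b 1) ^ 2 := by
    rcases (by positivity : 0 ≤ (a 0 - b 0) ^ 2 + (a 1 - b 1) ^ 2).lt_or_eq with h | h
    · exact h
    · exfalso
      have e0 : a 0 = b 0 := by nlinarith [sq_nonneg (a 0 - b 0), sq_nonneg (a 1 - b 1)]
      have e1 : a 1 = b 1 := by nlinarith [sq_nonneg (a 0 - b 0), sq_nonneg (a 1 - b 1)]
      exact hX (by rw [e0, e1]; ring)
  set N := Real.sqrt ((a 0 - b 0) ^ 2 + (a 1 - b 1) ^ 2) with hNdef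
  have hN0 : N ≠ 0 := (Real.sqrt_pos.2 hN).ne'
  have hNsq : N ^ 2 = (a 0 - b 0) ^ 2 + (a 1 - b 1) ^ 2 := Real.sq_sqrt hN.le
  set x := (a 0 - b 0) / N with hx
  set y := (a 1 - b 1) / N with hy
  have hxN : x * N = a 0 - b 0 := by rw [hx]; field_simp
  have hyN : y * N = a 1 - b 1 := by rw [hy]; field_simp
  have hxy : x ^ 2 + y ^ 2 = 1 := by rw [hx, hy]; field_simp; linarith
  set s := y * a 0 - x * a 1 with hs
  have hsN : s * N = -(b 1 * a 0 - b 0 * a 1) := by rw [hs]; linear_combination a 0 * hyN - a 1 * hxN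
  have hs0 : s ≠ 0 := fun h => hX (by rw [h] at hsN; linarith)
  have hsb : y * b 0 - x * b 1 = s := mul_right_cancel₀ hN0 (by
    rw [hsN]; linear_combination b 0 * hyN - b 1 * hxN)
  -- Otherwise `a`, `b`, `c` have the same height and lie on one chord of the circle. Their
  -- coordinates along it have equal squares, so two of the three coincide.
  have hK : s - (y * c 0 - x * c 1) ≠ 0 ∨ s * (a 2 - c 2) ≠ 0 := by
    by_contra! h0
    have hzc : c 2 = a 2 := by
      have := (mul_eq_zero.1 h0.2).resolve_left hs0; linarith
    have hXac := (dirn_ne_zero_iff.1 hac).resolve_right (not_not.2 hzc.symm)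
    have hXbc := (dirn_ne_zero_iff.1 hbc).resolve_right (not_not.2 (hz ▸ hzc.symm))
    have hsc : y * c 0 - x * c 1 = s := by linarith [h0.1]
    have hsum : ∀ u v u' v' : ℝ, y * u - x * v = s → y * u' - x * v' = s →
        v * u' - u * v' = s * ((x * u + y * v) - (x * u' + y * v')) := by
      intro u v u' v' h h'
      linear_combination -(x * u' + y * v') * h + (x * u + y * v) * h' + (u * v' - v * u') * hxy
    have hsq : ∀ u v : ℝ, u ^ 2 + v ^ 2 = 1 → y * u - x * v = s →
        (x * u + y * v) ^ 2 = 1 - s ^ 2 := by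
      intro u v h h'
      rw [← h', ← h]; linear_combination (u ^ 2 + v ^ 2) * hxy
    rw [hsum _ _ _ _ hs.symm hsc] at hXac
    rw [hsum _ _ _ _ hsb hsc] at hXbc
    rw [hsum _ _ _ _ hs.symm hsb] at hX
    have q1 := hsq _ _ ha hs.symm
    have q2 := hsq _ _ hb hsb
    have q3 := hsq _ _ hc hsc
    rw [← q3] at q1 q2
    have r1 := (sq_eq_sq_iff_eq_or_eq_neg.1 q1).resolve_left fun h => hXac (by rw [h]; ring)
    have r2 := (sq_eq_sq_iff_eq_or_eq_neg.1 q2).resolve_left fun h => hXbc (by rw [h]; ring)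
    exact hX (by rw [r1, r2]; ring)
  obtain ⟨t, ht⟩ := exists_forall_affine_ne_zero
    ![B, B', s - (y * c 0 - x * c 1)] ![A * s, A' * s, s * (a 2 - c 2)] (by
      intro k
      fin_cases k
      · exact hAB.symm.imp_right fun h => mul_ne_zero h hs0
      · exact hAB'.symm.imp_right fun h => mul_ne_zero h hs0
      · exact hK)
  have h0 := ht 0
  have h1 := ht 1
  have h2 := ht 2
  simp only [Matrix.cons_val] at h0 h1 h2
  refine ⟨![x, y, a 2 + t], (s, t), 1, 1, by simpa using hxy, one_ne_zero, one_ne_zero, ?_, ?_,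
    ?_, ?_, ?_⟩
  · ext <;> simp [dirn, ← hs]
  · ext <;> simp [dirn, hsb, hz]
  · intro h; exact h0 (by simp only at h; linarith)
  · intro h; exact h1 (by simp only at h; linarith)
  · intro h; simp [dirn] at h; exact h2 (by linarith)

lemma exists_dirn_ne_zero {a : Fin 3 → ℝ} (ha : OnCylinder a) (b : Fin 3 → ℝ) :
    ∃ c, OnCylinder c ∧ dirn a c ≠ 0 ∧ dirn b c ≠ 0 := by
  refine ⟨![a 0, a 1, |a 2| + |b 2| + 1], by simpa [OnCylinder] using ha,
    dirn_ne_zero_iff.2 (Or.inr ?_), dirn_ne_zero_iff.2 (Or.inr ?_)⟩ <;>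
  · simp only [Matrix.cons_val]
    intro h
    linarith [le_abs_self (a 2), le_abs_self (b 2), abs_nonneg (a 2), abs_nonneg (b 2)]

/-- Places a new vertex joined to `a` and `b`: both edges get a common direction `D` off two
forbidden lines, one for each sign. Without `hdot`, the points `a` and `b` could lie on one
generator, where only the axial direction is common. -/
lemma exists_parallel {a b c : Fin 3 → ℝ} (ha : OnCylinder a) (hb : OnCylinder b)
    (hc : OnCylinder c) (hdot : a 0 * b 0 + a 1 * b 1 ≠ 1) (hab : dirn a b ≠ 0)
    (hac : dirn a c ≠ 0) (hbc : dirn b c ≠ 0) {A B A' B' : ℝ} (hAB : A ≠ 0 ∨ B ≠ 0)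
    (hAB' : A' ≠ 0 ∨ B' ≠ 0) :
    ∃ (p : Fin 3 → ℝ) (D : ℝ × ℝ) (k l : ℝ), OnCylinder p ∧ k ≠ 0 ∧ l ≠ 0 ∧
      dirn p a = k • D ∧ dirn p b = l • D ∧ A * D.1 + B * D.2 ≠ 0 ∧ A' * D.1 + B' * D.2 ≠ 0 ∧
      D.1 * (dirn p c).2 - D.2 * (dirn p c).1 ≠ 0 := by
  by_cases hz : a 2 = b 2
  · exact exists_parallel_of_height_eq ha hb hc hab hz hac hbc hAB hAB'
  · exact exists_parallel_of_height_ne ha hb hc hdot hz hac hbc hAB hAB'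

/-- The horizontal part is chosen so that none of the conditions degenerates; each of them is then
affine in the height and not identically zero. -/
lemma exists_not_parallel {a c : Fin 3 → ℝ} (ha : OnCylinder a)
    (hac : dirn a c ≠ 0) {A B A' B' : ℝ} (hAB : A ≠ 0 ∨ B ≠ 0) (hAB' : A' ≠ 0 ∨ B' ≠ 0) :
    ∃ p : Fin 3 → ℝ, OnCylinder p ∧ A * (dirn p a).1 + B * (dirn p a).2 ≠ 0 ∧
      A' * (dirn p a).1 + B' * (dirn p a).2 ≠ 0 ∧
      (dirn p a).1 * (dirn p c).2 - (dirn p a).2 * (dirn p c).1 ≠ 0 := by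
  simp only [OnCylinder] at *
  have hK : ∃ x y : ℝ, x ^ 2 + y ^ 2 = 1 ∧ y * a 0 - x * a 1 ≠ 0 ∧
      ((y * a 0 - x * a 1) - (y * c 0 - x * c 1) ≠ 0 ∨ (y * a 0 - x * a 1) * (a 2 - c 2) ≠ 0) := by
    have ha' : -a 1 ≠ 0 ∨ a 0 ≠ 0 ∨ (0 : ℝ) ≠ 0 := by
      by_contra! h0
      rw [neg_eq_zero.1 h0.1, h0.2.1] at ha; norm_num at ha
    rcases dirn_ne_zero_iff.1 hac with h | h
    · obtain ⟨x, y, hxy, hk⟩ := exists_circle_forall_ne_zero ![-a 1, -(a 1 - c 1)]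
        ![a 0, a 0 - c 0] ![0, 0] (by
          intro k
          fin_cases k
          · exact ha'
          · by_contra! h0
            simp only [Fin.mk_one, Fin.isValue, Matrix.cons_val_one, Matrix.cons_val_fin_one] at h0
            have e0 : c 0 = a 0 := by linarith
            have e1 : c 1 = a 1 := by linarith
            exact h (by rw [e0, e1]; ring))
      have h0 := hk 0
      have h1 := hk 1
      simp only [Matrix.cons_val] at h0 h1
      exact ⟨x, y, hxy, fun h => h0 (by linarith), Or.inl fun h => h1 (by linarith)⟩
    · obtain ⟨x, y, hxy, hk⟩ := exists_circle_forall_ne_zero ![-a 1] ![a 0] ![0] (by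
        intro k
        fin_cases k
        exact ha')
      have h0 := hk 0
      simp only [Matrix.cons_val] at h0
      have h1 : y * a 0 - x * a 1 ≠ 0 := fun h => h0 (by linarith)
      exact ⟨x, y, hxy, h1, Or.inr (mul_ne_zero h1 (sub_ne_zero.2 h))⟩
  obtain ⟨x, y, hxy, hs0, hK⟩ := hK
  obtain ⟨t, ht⟩ := exists_forall_affine_ne_zero
    ![B, B', (y * a 0 - x * a 1) - (y * c 0 - x * c 1)]
    ![A * (y * a 0 - x * a 1), A' * (y * a 0 - x * a 1), (y * a 0 - x * a 1) * (a 2 - c 2)] (by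
      intro k
      fin_cases k
      · exact hAB.symm.imp_right fun h => mul_ne_zero h hs0
      · exact hAB'.symm.imp_right fun h => mul_ne_zero h hs0
      · exact hK)
  have h0 := ht 0
  have h1 := ht 1
  have h2 := ht 2
  simp only [Matrix.cons_val] at h0 h1 h2
  refine ⟨![x, y, a 2 + t], by simpa using hxy, ?_, ?_, ?_⟩ <;> intro h <;> simp [dirn] at h
  · exact h0 (by linarith)
  · exact h1 (by linarith)
  · exact h2 (by linarith)

end CylinderPoints

/-! ### Labelled trees, their realizations, and general position. -/

section LabelledTrees

variable {V ι : Type*}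

/-- A tree on the vertex set `S` with edges `ends i`, `i ∈ I`, some of which are labelled as
geometric, such that no geometric edge is the image of a geometric edge under the involution. -/
structure IsLabelledTree (g : V → V) (S : Finset V) (I : Finset ι) (ends : ι → V × V)
    (geo : ι → Prop) : Prop where
  maps : ∀ v ∈ S, g v ∈ S
  ends_mem : ∀ i ∈ I, (ends i).1 ∈ S ∧ (ends i).2 ∈ S
  joins : Joins S I ends
  card_eq : I.card + 1 = S.card
  geo_map : ∀ i ∈ I, ∀ j ∈ I, geo i → geo j →
    s((ends i).1, (ends i).2) ≠ s(g (ends j).1, g (ends j).2)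

/-- A symmetric configuration on the cylinder, for the isometry that multiplies the coordinates
by the signs `e`. -/
structure IsConfig (g : V → V) (e : Fin 3 → ℝ) (p : V → Fin 3 → ℝ) : Prop where
  on : ∀ v, OnCylinder (p v)
  symm : ∀ v k, p (g v) k = e k * p v k

/-- The signs of a reflection in a coordinate plane that is horizontal or contains the axis, or of
the inversion. -/
def IsMirrorSign (e : Fin 3 → ℝ) : Prop :=
  e = ![1, 1, -1] ∨ e = ![-1, -1, -1] ∨ e = ![1, -1, 1]

/-- The configuration `p` and the directions `D` are rigid, and `D` is given by `p` on the
geometric edges. -/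
structure IsRealization (g : V → V) (e : Fin 3 → ℝ) (S : Finset V) (I : Finset ι)
    (ends : ι → V × V) (geo : ι → Prop) (p : V → Fin 3 → ℝ) (D : ι → ℝ × ℝ) : Prop where
  config : IsConfig g e p
  dir_eq : ∀ i ∈ I, geo i → D i = dirn (p (ends i).1) (p (ends i).2)
  rigid : ∀ σ : ℝ, σ * σ = 1 → OrbitRigid g σ S I ends D
  -- A free edge may arise from a removed vertex joined to both ends, and `exists_parallel` then
  -- needs ends on different generators. Fixed vertices of a mirror containing the axis lie on only
  -- two generators, so a perturbation cannot separate them and the condition is carried through the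
  -- induction.
  dot_ne : ∀ i ∈ I, ¬geo i → g (ends i).1 = (ends i).1 → g (ends i).2 = (ends i).2 →
    p (ends i).1 0 * p (ends i).2 0 + p (ends i).1 1 * p (ends i).2 1 ≠ 1

/-- There is a realization. -/
def Realizable (g : V → V) (e : Fin 3 → ℝ) (S : Finset V) (I : Finset ι) (ends : ι → V × V)
    (geo : ι → Prop) : Prop :=
  ∃ p D, IsRealization g e S I ends geo p D

/-- The feature shared by the three symmetries: `κ` is the action on the sense of rotation, and the
axial direction is multiplied by the opposite sign. -/
lemma IsMirrorSign.exists_sign {e : Fin 3 → ℝ} (he : IsMirrorSign e) :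
    ∃ κ : ℝ, κ * κ = 1 ∧ e 0 * e 1 = κ ∧ e 2 = -κ := by
  rcases he with rfl | rfl | rfl
  · exact ⟨1, by simp⟩
  · exact ⟨1, by simp⟩
  · exact ⟨-1, by simp⟩

lemma IsMirrorSign.mul_self {e : Fin 3 → ℝ} (he : IsMirrorSign e) (k : Fin 3) : e k * e k = 1 := by
  rcases he with rfl | rfl | rfl <;> fin_cases k <;> simp

lemma IsConfig.dirn_map {g : V → V} {e : Fin 3 → ℝ} {p : V → Fin 3 → ℝ} (h : IsConfig g e p)
    {κ : ℝ} (h1 : e 0 * e 1 = κ) (h2 : e 2 = -κ) (u v : V) :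
    dirn (p (g u)) (p (g v)) = κ • ((dirn (p u) (p v)).1, -(dirn (p u) (p v)).2) := by
  simp only [dirn, h.symm]
  ext
  · simp only [Prod.smul_mk, smul_eq_mul, ← h1]; ring
  · simp only [Prod.smul_mk, smul_eq_mul, h2]; ring

/-- Realizability does not depend on the representatives of the edge orbits. -/
lemma Realizable.of_orbit {g : V → V} (hg : Function.Involutive g) {e : Fin 3 → ℝ}
    (he : IsMirrorSign e) {S : Finset V} {I : Finset ι} {ends ends' : ι → V × V} {geo : ι → Prop}
    (h : Realizable g e S I ends geo) (hends : ∀ i ∈ I, ends' i = ends i ∨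
      ends' i = (ends i).swap ∨ ends' i = (g (ends i).1, g (ends i).2)) :
    Realizable g e S I ends' geo := by
  obtain ⟨p, D, hR⟩ := h
  obtain ⟨κ, hκ, hκ1, hκ2⟩ := he.exists_sign
  have hex : ∀ i, ∃ D' : ℝ × ℝ, i ∈ I → (geo i → D' = dirn (p (ends' i).1) (p (ends' i).2)) ∧
      ∀ σ : ℝ, σ * σ = 1 → ∀ f, orbitRow g σ D' (ends' i) f = 0 →
        orbitRow g σ (D i) (ends i) f = 0 := by
    intro i
    by_cases hi : i ∈ I
    swap
    · exact ⟨0, fun h => absurd h hi⟩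
    rcases hends i hi with h | h | h
    · exact ⟨D i, fun _ => ⟨fun hgeo => h ▸ hR.dir_eq i hi hgeo, fun σ _ f hf => h ▸ hf⟩⟩
    · refine ⟨-D i, fun _ => ⟨fun hgeo => ?_, fun σ _ f hf => ?_⟩⟩
      · rw [hR.dir_eq i hi hgeo, h, ← dirn_swap]; rfl
      · rwa [h, orbitRow_swap] at hf
    · refine ⟨κ • ((D i).1, -(D i).2), fun _ => ⟨fun hgeo => ?_, fun σ hσ f hf => ?_⟩⟩
      · rw [hR.dir_eq i hi hgeo, h, hR.config.dirn_map hκ1 hκ2]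
      · rw [h, orbitRow_mul, orbitRow_map hg hσ] at hf
        rcases mul_eq_zero.1 hf with h0 | h0
        · rw [h0] at hκ; norm_num at hκ
        · rcases mul_eq_zero.1 h0 with h0 | h0
          · rw [h0] at hσ; norm_num at hσ
          · exact h0
  choose D' hD' using hex
  refine ⟨p, D', hR.config, fun i hi => (hD' i hi).1, fun σ hσ f hf => ?_, fun i hi hgeo h1 h2 => ?_⟩
  · exact hR.rigid σ hσ f fun i hi => (hD' i hi).2 σ hσ f (hf i hi)
  · rcases hends i hi with h | h | h <;> rw [h] at h1 h2 ⊢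
    · exact hR.dot_ne i hi hgeo h1 h2
    · have := hR.dot_ne i hi hgeo h2 h1
      simp only [Prod.fst_swap, Prod.snd_swap] at *
      intro h0; exact this (by linarith)
    · simp only at h1 h2
      rw [hg] at h1 h2
      have := hR.dot_ne i hi hgeo h1.symm h2.symm
      rwa [← h1, ← h2]

open Classical in
/-- The configuration `p` with the vertex `v` moved to `q`, and `g v` moved accordingly. -/
noncomputable def place (g : V → V) (e : Fin 3 → ℝ) (p : V → Fin 3 → ℝ) (v : V)
    (q : Fin 3 → ℝ) : V → Fin 3 → ℝ :=
  fun w => if w = v then q else if w = g v then fun k => e k * q k else p w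

lemma place_self (g : V → V) (e : Fin 3 → ℝ) (p : V → Fin 3 → ℝ) (v : V) (q : Fin 3 → ℝ) :
    place g e p v q v = q := by simp [place]

lemma place_map {g : V → V} {v : V} (hv : g v ≠ v) (e : Fin 3 → ℝ) (p : V → Fin 3 → ℝ)
    (q : Fin 3 → ℝ) : place g e p v q (g v) = fun k => e k * q k := by simp [place, hv]

lemma place_of_ne {g : V → V} {v w : V} (h1 : w ≠ v) (h2 : w ≠ g v) (e : Fin 3 → ℝ)
    (p : V → Fin 3 → ℝ) (q : Fin 3 → ℝ) : place g e p v q w = p w := by simp [place, h1, h2]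

lemma IsMirrorSign.onCylinder {e : Fin 3 → ℝ} (he : IsMirrorSign e) {q : Fin 3 → ℝ}
    (hq : OnCylinder q) : OnCylinder fun k => e k * q k := by
  simp only [OnCylinder] at *
  linear_combination hq + q 0 ^ 2 * he.mul_self 0 + q 1 ^ 2 * he.mul_self 1

lemma IsConfig.place {g : V → V} (hg : Function.Involutive g) {e : Fin 3 → ℝ}
    (he : IsMirrorSign e) {p : V → Fin 3 → ℝ} (h : IsConfig g e p) {v : V} {q : Fin 3 → ℝ}
    (hq : OnCylinder q) (hfix : g v = v → ∀ k, q k = e k * q k) :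
    IsConfig g e (place g e p v q) := by
  refine ⟨fun w => ?_, fun w k => ?_⟩
  · by_cases h1 : w = v
    · rwa [h1, place_self]
    by_cases h2 : w = g v
    · rw [h2, place_map fun h => h1 (h2.trans h)]; exact he.onCylinder hq
    · rw [place_of_ne h1 h2]; exact h.on w
  · by_cases hv : g v = v
    · by_cases h1 : w = v
      · subst h1; rw [hv, place_self]; exact hfix hv k
      · have h2 : w ≠ g v := by rwa [hv]
        have h3 : g w ≠ v := fun h3 => h2 (by rw [← h3, hg])
        rw [place_of_ne h1 h2, place_of_ne h3 (by rwa [hv])]; exact h.symm w k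
    · by_cases h1 : w = v
      · subst h1; rw [place_self, place_map hv]
      by_cases h2 : w = g v
      · subst h2
        rw [hg, place_self, place_map hv, ← mul_assoc, he.mul_self, one_mul]
      · have h3 : g w ≠ v := fun h3 => h2 (by rw [← h3, hg])
        rw [place_of_ne h1 h2, place_of_ne h3 fun h4 => h1 (hg.injective h4)]
        exact h.symm w k

/-- Extension of a realization to the new vertices `v`, `g v` and the new orbits `J`. -/
lemma IsRealization.extend {g : V → V} (hg : Function.Involutive g) {e : Fin 3 → ℝ}
    (he : IsMirrorSign e) {S S' : Finset V} {I I' J : Finset ι} {ends ends' : ι → V × V}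
    {geo geo' : ι → Prop} {p : V → Fin 3 → ℝ} {D' E : ι → ℝ × ℝ}
    (hT' : IsLabelledTree g S' I' ends' geo') (hR : IsRealization g e S' I' ends' geo' p D')
    {v : V} (hv : v ∉ S') (hgv : g v ∉ S') {q : Fin 3 → ℝ} (hq : OnCylinder q)
    (hfix : g v = v → ∀ k, q k = e k * q k) (hJ : J ⊆ I)
    (hold : ∀ i ∈ I, i ∉ J → i ∈ I' ∧ ends i = ends' i ∧ (geo i ↔ geo' i))
    (hold' : ∀ i ∈ I', i ∉ J → i ∈ I)
    (hgeo : ∀ i ∈ J, geo i →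
      E i = dirn (_root_.place g e p v q (ends i).1) (_root_.place g e p v q (ends i).2))
    (hdot : ∀ i ∈ J, ¬geo i → g (ends i).1 = (ends i).1 → g (ends i).2 = (ends i).2 →
      _root_.place g e p v q (ends i).1 0 * _root_.place g e p v q (ends i).2 0 +
        _root_.place g e p v q (ends i).1 1 * _root_.place g e p v q (ends i).2 1 ≠ 1)
    (hrow : ∀ σ : ℝ, σ * σ = 1 → ∀ f, (∀ i ∈ J, orbitRow g σ (E i) (ends i) f = 0) →
      ∀ i ∈ I', i ∈ J → orbitRow g σ (D' i) (ends' i) f = 0)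
    (hloc : ∀ σ : ℝ, σ * σ = 1 → ∀ f, (∀ i ∈ J, orbitRow g σ (E i) (ends i) f = 0) →
      ∀ c : ℝ, (∀ u ∈ S', f u = c) → f v = c ∧ f (g v) = c)
    (hS : ∀ u ∈ S, u = v ∨ u = g v ∨ u ∈ S') :
    Realizable g e S I ends geo := by
  classical
  have hne : ∀ i ∈ I, i ∉ J → (ends i).1 ∈ S' ∧ (ends i).2 ∈ S' := fun i hi hiJ => by
    obtain ⟨h1, h2, -⟩ := hold i hi hiJ
    rw [h2]; exact hT'.ends_mem i h1
  have hpl : ∀ u ∈ S', _root_.place g e p v q u = p u := fun u hu =>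
    place_of_ne (ne_of_mem_of_not_mem hu hv) (ne_of_mem_of_not_mem hu hgv) e p q
  refine ⟨_root_.place g e p v q, fun i => if i ∈ J then E i else D' i,
    hR.config.place hg he hq hfix, fun i hi hi' => ?_, fun σ hσ f hf => ?_,
    fun i hi hi' h1 h2 => ?_⟩
  · by_cases hiJ : i ∈ J
    · simp only [hiJ, if_true]; exact hgeo i hiJ hi'
    · obtain ⟨h1, h2, h3⟩ := hold i hi hiJ
      simp only [hiJ, if_false]
      rw [hpl _ (hne i hi hiJ).1, hpl _ (hne i hi hiJ).2, h2]
      exact hR.dir_eq i h1 (h3.1 hi')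
  · have hfJ : ∀ i ∈ J, orbitRow g σ (E i) (ends i) f = 0 := fun i hi => by
      simpa [hi] using hf i (hJ hi)
    have hf' : ∀ i ∈ I', orbitRow g σ (D' i) (ends' i) f = 0 := by
      intro i hi
      by_cases hiJ : i ∈ J
      · exact hrow σ hσ f hfJ i hi hiJ
      · have h0 := hf i (hold' i hi hiJ)
        rw [(hold i (hold' i hi hiJ) hiJ).2.1] at h0
        simpa [hiJ] using h0
    have hc := hR.rigid σ hσ f hf'
    obtain ⟨r, hr⟩ : S'.Nonempty := by
      rw [← Finset.card_pos, ← hT'.card_eq]; exact Nat.succ_pos _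
    have hrc := hloc σ hσ f hfJ (f r) fun u hu => hc u hu r hr
    have hall : ∀ u ∈ S, f u = f r := by
      intro u hu
      rcases hS u hu with rfl | rfl | h
      · exact hrc.1
      · exact hrc.2
      · exact hc u h r hr
    intro a ha b hb
    rw [hall a ha, hall b hb]
  · by_cases hiJ : i ∈ J
    · exact hdot i hiJ hi' h1 h2
    · obtain ⟨h3, h4, h5⟩ := hold i hi hiJ
      rw [hpl _ (hne i hi hiJ).1, hpl _ (hne i hi hiJ).2]
      rw [h4] at h1 h2 ⊢
      exact hR.dot_ne i h3 (fun h => hi' (h5.2 h)) h1 h2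

/-- General position of a symmetric configuration, as far as the symmetry allows it. -/
structure IsGeneric (g : V → V) (e : Fin 3 → ℝ) (p : V → Fin 3 → ℝ) : Prop where
  dirn_ne : ∀ a b, a ≠ b → dirn (p a) (p b) ≠ 0
  -- The excluded pairs are forced by symmetry: `a` and `g a` share a generator for the horizontal
  -- mirror, and two fixed vertices may share one for a mirror containing the axis.
  dot_ne : ∀ a b, a ≠ b → (b = g a → e 0 = -1 ∨ e 1 = -1) →
    (g a = a → g b = b → e ≠ ![1, -1, 1]) → p a 0 * p b 0 + p a 1 * p b 1 ≠ 1
  height_ne : e 2 = -1 → ∀ a, g a ≠ a → p a 2 ≠ 0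
  side_ne : e = ![1, -1, 1] → ∀ a, g a ≠ a → p a 1 ≠ 0

/-- From an injective positive numbering, `h` is the smaller number in the orbit, and `k` is the
same number with a sign that tells the two vertices of the orbit apart. An odd function vanishes at
fixed vertices, so `k` cannot separate those. -/
lemma exists_separating_functions [Finite V] {g : V → V} (hg : Function.Involutive g) :
    ∃ h k : V → ℝ, (∀ v, h (g v) = h v) ∧ (∀ v, k (g v) = -k v) ∧
      (∀ a b, h a = h b → b = a ∨ b = g a) ∧
      ∀ a b, k a = k b → a = b ∨ (g a = a ∧ g b = b) := by
  obtain ⟨n, hn⟩ : ∃ n : V → ℝ, Function.Injective n ∧ ∀ v, 0 < n v := by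
    obtain ⟨N, ⟨f⟩⟩ := Finite.exists_equiv_fin V
    refine ⟨fun v => (f v : ℕ) + 1, fun a b hab => ?_, fun v => by positivity⟩
    have : ((f a : ℕ) : ℝ) = (f b : ℕ) := by simpa using hab
    exact f.injective (Fin.ext (by exact_mod_cast this))
  have hmin : ∀ a b, min (n a) (n (g a)) = min (n b) (n (g b)) → b = a ∨ b = g a := by
    intro a b hab
    rcases min_choice (n a) (n (g a)) with h1 | h1 <;>
      rcases min_choice (n b) (n (g b)) with h2 | h2 <;> rw [h1, h2] at hab
    · exact Or.inl (hn.1 hab).symm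
    · right; rw [hn.1 hab, hg]
    · exact Or.inr (hn.1 hab).symm
    · exact Or.inl (hg.injective (hn.1 hab)).symm
  have hpos : ∀ a, 0 < min (n a) (n (g a)) := fun a => lt_min (hn.2 _) (hn.2 _)
  refine ⟨fun v => min (n v) (n (g v)), fun v => if n v < n (g v) then min (n v) (n (g v)) else
    if n (g v) < n v then -min (n v) (n (g v)) else 0, fun v => ?_, fun v => ?_, hmin, ?_⟩
  · simp only [hg v]; exact min_comm _ _
  · simp only [hg v]
    rcases lt_trichotomy (n v) (n (g v)) with h | h | h
    · simp [h, h.not_gt, h.le]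
    · simp [h]
    · simp [h, h.not_gt, h.le]
  · intro a b hab
    have hfix : ∀ c, n c = n (g c) → g c = c := fun c h => (hn.1 h).symm
    have ha := hpos a
    have hb := hpos b
    by_cases hne : a = b
    · exact Or.inl hne
    right
    simp only at hab
    rcases lt_trichotomy (n a) (n (g a)) with h | h | h <;>
      rcases lt_trichotomy (n b) (n (g b)) with h' | h' | h'
    · simp only [h, h', if_true] at hab
      rcases hmin a b hab with h1 | h1
      · exact absurd h1.symm hne
      · rw [h1, hg] at h'; linarith
    · rw [if_pos h, if_neg h'.not_lt, if_neg h'.not_gt] at hab; linarith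
    · rw [if_pos h, if_neg h'.not_gt, if_pos h'] at hab; linarith
    · rw [if_neg h.not_lt, if_neg h.not_gt, if_pos h'] at hab; linarith
    · exact ⟨hfix a h, hfix b h'⟩
    · rw [if_neg h.not_lt, if_neg h.not_gt, if_neg h'.not_gt, if_pos h'] at hab; linarith
    · rw [if_neg h.not_gt, if_pos h, if_pos h'] at hab; linarith
    · rw [if_neg h.not_gt, if_pos h, if_neg h'.not_lt, if_neg h'.not_gt] at hab; linarith
    · rw [if_neg h.not_gt, if_pos h, if_neg h'.not_gt, if_pos h', neg_inj] at hab
      rcases hmin a b hab with h1 | h1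
      · exact absurd h1.symm hne
      · rw [h1, hg] at h'; linarith

/-- Coincident points are allowed. Both mirrors fix `(1, 0, 0)`; for the inversion, the sign of an
odd nowhere vanishing function chooses between two antipodal points. -/
lemma exists_isConfig [Finite V] {g : V → V} (hg : Function.Involutive g) {e : Fin 3 → ℝ}
    (he : IsMirrorSign e) (hfix : e 0 = -1 → ∀ v, g v ≠ v) : ∃ p, IsConfig g e p := by
  by_cases h0 : e 0 = 1
  · refine ⟨fun _ => ![1, 0, 0], fun v => by simp [OnCylinder], fun v k => ?_⟩
    fin_cases k <;> simp [h0]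
  have he0 : e = ![-1, -1, -1] := by
    rcases he with rfl | rfl | rfl
    · simp at h0
    · rfl
    · simp at h0
  obtain ⟨-, k, -, hk, -, hk'⟩ := exists_separating_functions hg
  have hfix' := hfix (by simp [he0])
  have hk0 : ∀ v, k v ≠ 0 := by
    intro v h
    rcases hk' v (g v) (by rw [hk, h, neg_zero]) with h1 | h1
    · exact hfix' v h1.symm
    · exact hfix' v h1.1
  refine ⟨fun v => ![if 0 < k v then 1 else -1, 0, 0], fun v => ?_, fun v i => ?_⟩
  · simp only [OnCylinder, Matrix.cons_val]
    split_ifs <;> norm_num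
  · rw [he0]
    fin_cases i
    · simp only [hk]
      rcases (hk0 v).lt_or_gt with h | h
      · simp [h, h.not_gt]
      · simp [h, h.not_gt]
    · simp
    · simp

/-- Rotating and translating the points of a symmetric configuration by independent small amounts
gives a realization in which the points differ from each other. -/
lemma IsRealization.exists_perturbation [Finite V] {g : V → V} {e : Fin 3 → ℝ}
    (he : IsMirrorSign e) {S : Finset V} {I : Finset ι} {ends : ι → V × V} {geo : ι → Prop}
    (hT : IsLabelledTree g S I ends geo) {p : V → Fin 3 → ℝ} {D : ι → ℝ × ℝ}
    (hR : IsRealization g e S I ends geo p D) (h k : V → ℝ) (hh : ∀ v, h (g v) = e 0 * e 1 * h v)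
    (hk : ∀ v, k (g v) = e 2 * k v) :
    ∃ p' D', IsRealization g e S I ends geo p' D' ∧
      (∀ a b, h a ≠ h b → p' a 1 * p' b 0 - p' a 0 * p' b 1 ≠ 0) ∧
      ∀ a b, k a ≠ k b → p' a 2 ≠ p' b 2 := by
  classical
  let P : ℝ → V → Fin 3 → ℝ := fun η v =>
    ![p v 0 * Real.cos (η * h v) - p v 1 * Real.sin (η * h v),
      p v 1 * Real.cos (η * h v) + p v 0 * Real.sin (η * h v), p v 2 + η * k v]
  have hP0 : P 0 = p := by
    funext v i
    fin_cases i <;> simp [P]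
  have hc0 : ∀ v, Continuous fun η => P η v 0 := fun v => by
    simp only [P, Matrix.cons_val]; fun_prop
  have hc1 : ∀ v, Continuous fun η => P η v 1 := fun v => by
    simp only [P, Matrix.cons_val]; fun_prop
  have hc2 : ∀ v, Continuous fun η => P η v 2 := fun v => by
    simp only [P, Matrix.cons_val]; fun_prop
  have hconf : ∀ η, IsConfig g e (P η) := by
    intro η
    refine ⟨fun v => ?_, fun v i => ?_⟩
    · have h1 := hR.config.on v
      simp only [OnCylinder, P, Matrix.cons_val] at h1 ⊢
      linear_combination h1 + (p v 0 ^ 2 + p v 1 ^ 2) * Real.sin_sq_add_cos_sq (η * h v)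
    · have s0 := hR.config.symm v 0
      have s1 := hR.config.symm v 1
      have s2 := hR.config.symm v 2
      have t1 := hh v
      have t2 := hk v
      rcases he with rfl | rfl | rfl <;> simp only [Matrix.cons_val] at s0 s1 s2 t1 t2 <;>
        fin_cases i <;> simp [P, s0, s1, s2, t1, t2] <;> ring
  let DD : ℝ → ι → ℝ × ℝ := fun η i =>
    if geo i then dirn (P η (ends i).1) (P η (ends i).2) else D i
  have hDc : Continuous DD := by
    refine continuous_pi fun i => ?_
    by_cases hi : geo i
    · simp only [DD, hi, if_true, dirn]
      exact ((((hc1 _).mul (hc0 _)).sub ((hc0 _).mul (hc1 _))).prodMk ((hc2 _).sub (hc2 _)))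
    · simp only [DD, hi, if_false]; exact continuous_const
  have hD0 : ∀ i ∈ I, DD 0 i = D i := by
    intro i hi
    by_cases hi' : geo i
    · simp only [DD, hi', if_true, hP0]; exact (hR.dir_eq i hi hi').symm
    · simp only [DD, hi', if_false]
  have hrig : ∀ σ : ℝ, σ * σ = 1 → ∀ᶠ η in nhds (0 : ℝ), OrbitRigid g σ S I ends (DD η) := by
    intro σ hσ
    refine OrbitRigid.eventually hT.maps hT.ends_mem hDc fun f hf => ?_
    exact hR.rigid σ hσ f fun i hi => by rw [← hD0 i hi]; exact hf i hi
  have hdot : ∀ᶠ η in nhds (0 : ℝ), ∀ i ∈ I, ¬geo i → g (ends i).1 = (ends i).1 →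
      g (ends i).2 = (ends i).2 →
      P η (ends i).1 0 * P η (ends i).2 0 + P η (ends i).1 1 * P η (ends i).2 1 ≠ 1 := by
    rw [Filter.eventually_all_finset]
    intro i hi
    by_cases hc : ¬geo i ∧ g (ends i).1 = (ends i).1 ∧ g (ends i).2 = (ends i).2
    · have h1 := hR.dot_ne i hi hc.1 hc.2.1 hc.2.2
      have h2 : Continuous fun η =>
          P η (ends i).1 0 * P η (ends i).2 0 + P η (ends i).1 1 * P η (ends i).2 1 :=
        ((hc0 _).mul (hc0 _)).add ((hc1 _).mul (hc1 _))
      rw [← hP0] at h1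
      filter_upwards [h2.continuousAt.eventually_ne h1] with η hη _ _ _
      exact hη
    · exact Filter.Eventually.of_forall fun η h1 h2 h3 => absurd ⟨h1, h2, h3⟩ hc
  have hX : ∀ᶠ η in nhdsWithin (0 : ℝ) {0}ᶜ, ∀ a b, h a ≠ h b →
      P η a 1 * P η b 0 - P η a 0 * P η b 1 ≠ 0 := by
    rw [Filter.eventually_all]; intro a
    rw [Filter.eventually_all]; intro b
    by_cases hab : h a = h b
    · exact Filter.Eventually.of_forall fun η h1 => absurd hab h1
    -- A combination of cosine and sine with `X² + Y² = 1`: near `0` it is nonzero by continuity if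
    -- `X ≠ 0`, and otherwise, away from `0`, because its derivative there is nonzero.
    have hf : ∀ η, P η a 1 * P η b 0 - P η a 0 * P η b 1 =
        (p a 1 * p b 0 - p a 0 * p b 1) * Real.cos (η * (h a - h b)) +
        (p a 0 * p b 0 + p a 1 * p b 1) * Real.sin (η * (h a - h b)) := by
      intro η
      simp only [P, Matrix.cons_val, mul_sub, Real.cos_sub, Real.sin_sub]; ring
    simp only [hf]
    set X := p a 1 * p b 0 - p a 0 * p b 1 with hXdef
    set Y := p a 0 * p b 0 + p a 1 * p b 1 with hYdef
    have hXY : X ^ 2 + Y ^ 2 = 1 := by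
      have h1 := hR.config.on a
      have h2 := hR.config.on b
      simp only [OnCylinder] at h1 h2
      rw [hXdef, hYdef]; linear_combination (p b 0 ^ 2 + p b 1 ^ 2) * h1 + h2
    by_cases hX0 : X = 0
    · have hY0 : Y ≠ 0 := by rintro h0; rw [hX0, h0] at hXY; norm_num at hXY
      have hd : HasDerivAt (fun η : ℝ => X * Real.cos (η * (h a - h b)) +
          Y * Real.sin (η * (h a - h b))) (Y * (h a - h b)) 0 := by
        have h1 : HasDerivAt (fun η : ℝ => η * (h a - h b)) (h a - h b) 0 := by
          simpa using (hasDerivAt_id (0 : ℝ)).mul_const (h a - h b)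
        have h2 := (h1.cos.const_mul X).add (h1.sin.const_mul Y)
        exact h2.congr_deriv (by simp)
      filter_upwards [hd.eventually_ne (c := 0) (mul_ne_zero hY0 (sub_ne_zero.2 hab))] with η hη _
      exact hη
    · have hct : ContinuousAt (fun η : ℝ => X * Real.cos (η * (h a - h b)) +
          Y * Real.sin (η * (h a - h b))) 0 := by fun_prop
      have h0 := hct.eventually_ne (y := 0) (by simpa using hX0)
      filter_upwards [h0.filter_mono nhdsWithin_le_nhds] with η hη _
      exact hη
  have hZ : ∀ᶠ η in nhdsWithin (0 : ℝ) {0}ᶜ, ∀ a b, k a ≠ k b → P η a 2 ≠ P η b 2 := by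
    rw [Filter.eventually_all]; intro a
    rw [Filter.eventually_all]; intro b
    by_cases hab : k a = k b
    · exact Filter.Eventually.of_forall fun η h1 => absurd hab h1
    have hd : HasDerivAt (fun η : ℝ => P η a 2 - P η b 2) (k a - k b) 0 := by
      have h1 : ∀ c, HasDerivAt (fun η : ℝ => p c 2 + η * k c) (k c) 0 := fun c => by
        simpa using ((hasDerivAt_id (0 : ℝ)).mul_const (k c)).const_add (p c 2)
      exact (h1 a).sub (h1 b)
    filter_upwards [hd.eventually_ne (c := 0) (sub_ne_zero.2 hab)] with η hη _
    exact sub_ne_zero.1 hη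
  have hall := ((((hrig 1 (by norm_num)).and (hrig (-1) (by norm_num))).and hdot).filter_mono
    (nhdsWithin_le_nhds (s := {(0 : ℝ)}ᶜ))).and (hX.and hZ)
  obtain ⟨η, ⟨⟨h1, h2⟩, h3⟩, h4, h5⟩ := hall.exists
  refine ⟨P η, DD η, ⟨hconf η, fun i _ hi => by simp only [DD, hi, if_true], fun σ hσ => ?_, h3⟩,
    h4, h5⟩
  rcases mul_self_eq_one_iff.1 hσ with rfl | rfl
  · exact h1
  · exact h2

/-- Of the two velocities, symmetry makes one even and the other odd under `g`. The odd separating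
function drives the odd one and separates all points except pairs of fixed vertices; these are
separated by the even one. -/
lemma IsRealization.exists_generic [Finite V] {g : V → V} (hg : Function.Involutive g)
    {e : Fin 3 → ℝ} (he : IsMirrorSign e) {S : Finset V} {I : Finset ι} {ends : ι → V × V}
    {geo : ι → Prop} (hT : IsLabelledTree g S I ends geo) {p : V → Fin 3 → ℝ} {D : ι → ℝ × ℝ}
    (hR : IsRealization g e S I ends geo p D) :
    ∃ p' D', IsRealization g e S I ends geo p' D' ∧ IsGeneric g e p' := by
  obtain ⟨h, k, hh, hk, hh', hk'⟩ := exists_separating_functions hg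
  have hdot : ∀ q : V → Fin 3 → ℝ, IsConfig g e q → ∀ a b,
      q a 1 * q b 0 - q a 0 * q b 1 ≠ 0 → q a 0 * q b 0 + q a 1 * q b 1 ≠ 1 := by
    intro q hq a b hX hd
    have h1 := hq.on a
    have h2 := hq.on b
    simp only [OnCylinder] at h1 h2
    have : (q a 1 * q b 0 - q a 0 * q b 1) ^ 2 = 0 := by
      linear_combination (q b 0 ^ 2 + q b 1 ^ 2) * h1 + h2 -
        (q a 0 * q b 0 + q a 1 * q b 1 + 1) * hd
    exact hX (pow_eq_zero_iff two_ne_zero |>.1 this)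
  by_cases he2 : e 2 = -1
  · have hκ : e 0 * e 1 = 1 := by
      rcases he with rfl | rfl | rfl <;> simp at he2 ⊢
      norm_num at he2
    obtain ⟨q, D', hq, hX, hZ⟩ := hR.exists_perturbation he hT h k (fun v => by rw [hκ, hh, one_mul])
      (fun v => by rw [he2, hk]; ring)
    refine ⟨q, D', hq, fun a b hab => ?_, fun a b hab hga _ => ?_, fun _ a ha => ?_, fun h0 => ?_⟩
    · by_cases hf : g a = a ∧ g b = b
      · refine dirn_ne_zero_iff.2 (Or.inl (hX a b fun h0 => ?_))
        rcases hh' a b h0 with h1 | h1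
        · exact hab h1.symm
        · exact hab (by rw [h1, hf.1])
      · exact dirn_ne_zero_iff.2 (Or.inr (hZ a b fun h0 => (hk' a b h0).elim hab hf))
    · by_cases hb : b = g a
      · subst hb
        have h1 := hga rfl
        have h2 : e = ![-1, -1, -1] := by
          rcases he with rfl | rfl | rfl
          · norm_num at h1
          · rfl
          · simp at he2; norm_num at he2
        rw [hq.config.symm a 0, hq.config.symm a 1, h2]
        simp only [Matrix.cons_val]
        nlinarith [sq_nonneg (q a 0), sq_nonneg (q a 1)]
      · exact hdot q hq.config a b (hX a b fun h0 => (hh' a b h0).elim (fun h => hab h.symm) hb)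
    · intro h0
      refine hZ a (g a) (fun h1 => (hk' a _ h1).elim (fun h => ha h.symm) fun h => ha h.1) ?_
      rw [hq.config.symm, h0, mul_zero]
    · rw [h0] at he2; simp at he2; norm_num at he2
  · have he' : e = ![1, -1, 1] := by
      rcases he with rfl | rfl | rfl
      · simp at he2
      · simp at he2
      · rfl
    obtain ⟨q, D', hq, hX, hZ⟩ := hR.exists_perturbation he hT k h
      (fun v => by rw [he', hk]; simp) (fun v => by rw [he', hh]; simp)
    refine ⟨q, D', hq, fun a b hab => ?_, fun a b hab _ hf => ?_, fun h0 => absurd h0 he2,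
      fun _ a ha h0 => ?_⟩
    · by_cases hf : g a = a ∧ g b = b
      · refine dirn_ne_zero_iff.2 (Or.inr (hZ a b fun h0 => ?_))
        rcases hh' a b h0 with h1 | h1
        · exact hab h1.symm
        · exact hab (by rw [h1, hf.1])
      · exact dirn_ne_zero_iff.2 (Or.inl (hX a b fun h0 => (hk' a b h0).elim hab hf))
    · exact hdot q hq.config a b (hX a b fun h0 => (hk' a b h0).elim hab fun h => hf h.1 h.2 he')
    · refine hX a (g a) (fun h1 => (hk' a _ h1).elim (fun h => ha h.symm) fun h => ha h.1) ?_
      rw [hq.config.symm a 0, hq.config.symm a 1, h0]; ring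

end LabelledTrees

/-! ### Adding leaves. -/

section TreeExtensions

variable {V ι : Type*}

/-- Two orbits of edges from the pair `v`, `g v` to known vertices, with independent directions,
determine `f` at both `v` and `g v`. -/
lemma orbitRow_pair {σ : ℝ} (hσ : σ * σ = 1) {D E : ℝ × ℝ}
    (hdet : D.1 * E.2 - D.2 * E.1 ≠ 0) {x y : ℝ}
    (h1 : D.1 * (x + σ * y) + D.2 * (x - σ * y) = 0)
    (h2 : E.1 * (x + σ * y) + E.2 * (x - σ * y) = 0) : x = 0 ∧ y = 0 := by
  have h3 : x + σ * y = 0 := (mul_eq_zero.1 (show (D.1 * E.2 - D.2 * E.1) * (x + σ * y) = 0 by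
    linear_combination E.2 * h1 - D.2 * h2)).resolve_left hdet
  have h4 : x - σ * y = 0 := (mul_eq_zero.1 (show (D.1 * E.2 - D.2 * E.1) * (x - σ * y) = 0 by
    linear_combination D.1 * h2 - E.1 * h1)).resolve_left hdet
  refine ⟨by linarith, ?_⟩
  have h5 : σ * y = 0 := by linarith
  linear_combination σ * h5 - y * hσ

/-- The expression is `2 * D.1` for one sign and `2 * D.2` for the other. It is the coefficient that
remains when `f` agrees at `v` and `g v`. -/
lemma mul_sign_ne_zero {σ : ℝ} (hσ : σ * σ = 1) {D : ℝ × ℝ} (h1 : D.1 ≠ 0) (h2 : D.2 ≠ 0) :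
    D.1 * (1 + σ) + D.2 * (1 - σ) ≠ 0 := by
  rcases mul_self_eq_one_iff.1 hσ with rfl | rfl
  · norm_num [h1]
  · norm_num [h2]

lemma IsLabelledTree.of_swap {g : V → V} {S : Finset V} {I : Finset ι} {ends ends' : ι → V × V}
    {geo : ι → Prop} (hT : IsLabelledTree g S I ends geo)
    (h : ∀ i, ends' i = ends i ∨ ends' i = (ends i).swap) : IsLabelledTree g S I ends' geo := by
  refine ⟨hT.maps, fun i hi => ?_, fun f hf => hT.joins f fun i hi => ?_, hT.card_eq,
    fun i hi j hj hi' hj' => ?_⟩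
  · have := hT.ends_mem i hi
    rcases h i with h | h <;> rw [h]
    · exact this
    · exact this.symm
  · have := hf i hi
    rcases h i with h | h <;> rw [h] at this
    · exact this
    · exact this.symm
  · have h1 : s((ends' i).1, (ends' i).2) = s((ends i).1, (ends i).2) := by
      rcases h i with h | h <;> rw [h]
      exact Sym2.eq_swap
    have h2 : s(g (ends' j).1, g (ends' j).2) = s(g (ends j).1, g (ends j).2) := by
      rcases h j with h | h <;> rw [h]
      exact Sym2.eq_swap
    rw [h1, h2]; exact hT.geo_map i hi j hj hi' hj'

/-- One edge fewer is too few by `Joins.card_le`: a tree has no superfluous edge. -/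
lemma IsLabelledTree.not_joins_erase [DecidableEq ι] {g : V → V} {S : Finset V} {I : Finset ι}
    {ends : ι → V × V} {geo : ι → Prop} (hT : IsLabelledTree g S I ends geo) {i : ι}
    (hi : i ∈ I) : ¬Joins S (I.erase i) ends := by
  intro h
  have h1 := h.card_le
  have h2 := hT.card_eq
  have h3 := Finset.card_erase_add_one hi
  omega

lemma IsLabelledTree.ends_ne {g : V → V} {S : Finset V} {I : Finset ι}
    {ends : ι → V × V} {geo : ι → Prop} (hT : IsLabelledTree g S I ends geo) {i : ι}
    (hi : i ∈ I) : (ends i).1 ≠ (ends i).2 := by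
  classical
  intro h
  refine hT.not_joins_erase hi fun f hf => hT.joins f fun j hj => ?_
  by_cases hij : j = i
  · rw [hij, h]
  · exact hf j (Finset.mem_erase.2 ⟨hij, hj⟩)

/-- The labelled tree that is left when the vertices `v`, `g v` and the edges at them are
removed. -/
lemma IsLabelledTree.remove_pair [DecidableEq V] {g : V → V}
    (hg : Function.Involutive g) {S : Finset V} {I I' : Finset ι} {ends ends' : ι → V × V}
    {geo geo' : ι → Prop} (hT : IsLabelledTree g S I ends geo) {v : V} (hv : g v ≠ v) (hvS : v ∈ S)
    (hends : ∀ i ∈ I', (ends' i).1 ∈ (S.erase v).erase (g v) ∧ (ends' i).2 ∈ (S.erase v).erase (g v))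
    (hjoin : ∀ f : V → ℝ, (∀ i ∈ I', f (ends' i).1 = f (ends' i).2) → ∃ x y : ℝ, ∀ i ∈ I,
      (fun w => if w = v then x else if w = g v then y else f w) (ends i).1 =
        (fun w => if w = v then x else if w = g v then y else f w) (ends i).2)
    (hcard : I'.card + 2 = I.card)
    (hgeo : ∀ i ∈ I', geo' i → i ∈ I ∧ geo i ∧ ends' i = ends i) :
    IsLabelledTree g ((S.erase v).erase (g v)) I' ends' geo' := by
  have hc1 := Finset.card_erase_add_one hvS
  have hc2 := Finset.card_erase_add_one (Finset.mem_erase.2 ⟨hv, hT.maps v hvS⟩)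
  refine ⟨fun w hw => ?_, hends, fun f hf => ?_, ?_, fun i hi j hj hi' hj' => ?_⟩
  · simp only [Finset.mem_erase] at hw ⊢
    refine ⟨fun h => hw.2.1 (hg.injective h), fun h => hw.1 ?_, hT.maps w hw.2.2⟩
    rw [← h, hg]
  · obtain ⟨x, y, hxy⟩ := hjoin f hf
    have := hT.joins (fun w => if w = v then x else if w = g v then y else f w) hxy
    intro a ha b hb
    simp only [Finset.mem_erase] at ha hb
    simpa [ha.1, ha.2.1, hb.1, hb.2.1] using this a ha.2.2 b hb.2.2
  · have := hT.card_eq; omega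
  · obtain ⟨h1, h2, h3⟩ := hgeo i hi hi'
    obtain ⟨h4, h5, h6⟩ := hgeo j hj hj'
    rw [h3, h6]; exact hT.geo_map i h1 j h4 h2 h5

variable [Finite V]

/-- A fixed vertex has only one unknown, so one edge suffices provided both coordinates of its
direction are nonzero, one for each sign. The new point must lie in the mirror. -/
lemma realizable_of_fixed_leaf {g : V → V} (hg : Function.Involutive g) {e : Fin 3 → ℝ}
    (he : IsMirrorSign e) {S : Finset V} {I : Finset ι} {ends : ι → V × V} {geo : ι → Prop}
    (hT : IsLabelledTree g S I ends geo)
    (IH : ∀ (S' : Finset V) (I' : Finset ι) (ends' : ι → V × V) (geo' : ι → Prop),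
      S'.card < S.card → IsLabelledTree g S' I' ends' geo' → Realizable g e S' I' ends' geo')
    {v a : V} {i₁ : ι} (hv : g v = v) (hi₁ : i₁ ∈ I) (h₁ : ends i₁ = (v, a))
    (hoth : ∀ i ∈ I, i ≠ i₁ → (ends i).1 ≠ v ∧ (ends i).2 ≠ v) :
    Realizable g e S I ends geo := by
  classical
  have hav : a ≠ v := by have := hT.ends_ne hi₁; rw [h₁] at this; exact this.symm
  have hvS : v ∈ S := by have := (hT.ends_mem i₁ hi₁).1; rwa [h₁] at this
  have haS : a ∈ S := by have := (hT.ends_mem i₁ hi₁).2; rwa [h₁] at this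
  have hcard := Finset.card_erase_add_one hvS
  have hcard' := Finset.card_erase_add_one hi₁
  have hgv : ∀ w, g w = v → w = v := fun w hw => by rw [← hg w, hw, hv]
  have hT' : IsLabelledTree g (S.erase v) (I.erase i₁) ends geo := by
    refine ⟨fun w hw => ?_, fun i hi => ?_, fun f hf => ?_, ?_, fun i hi j hj =>
      hT.geo_map i (Finset.mem_of_mem_erase hi) j (Finset.mem_of_mem_erase hj)⟩
    · rw [Finset.mem_erase] at hw ⊢
      exact ⟨fun h => hw.1 (hgv w h), hT.maps w hw.2⟩
    · rw [Finset.mem_erase] at hi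
      have h2 := hoth i hi.2 hi.1
      have h3 := hT.ends_mem i hi.2
      exact ⟨Finset.mem_erase.2 ⟨h2.1, h3.1⟩, Finset.mem_erase.2 ⟨h2.2, h3.2⟩⟩
    · have hf' := hT.joins (Function.update f v (f a)) fun i hi => by
        by_cases hii : i = i₁
        · subst hii
          simp [h₁, Function.update_of_ne hav]
        · have h2 := hoth i hi hii
          rw [Function.update_of_ne h2.1, Function.update_of_ne h2.2]
          exact hf i (Finset.mem_erase.2 ⟨hii, hi⟩)
      intro x hx y hy
      rw [Finset.mem_erase] at hx hy
      have := hf' x hx.2 y hy.2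
      rwa [Function.update_of_ne hx.1, Function.update_of_ne hy.1] at this
    · have := hT.card_eq; omega
  obtain ⟨p₀, D₀, hR₀⟩ := IH _ _ _ _ (by omega) hT'
  obtain ⟨p, D, hR, hG⟩ := hR₀.exists_generic hg he hT'
  have hpv : OnCylinder (p v) := hR.config.on v
  have hpa : OnCylinder (p a) := hR.config.on a
  -- The inversion would put the fixed point `p v` at the origin, off the cylinder.
  have he' : e = ![1, 1, -1] ∨ e = ![1, -1, 1] := by
    rcases he with h | h | h
    · exact Or.inl h
    · exfalso
      have s0 := hR.config.symm v 0
      have s1 := hR.config.symm v 1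
      rw [hv, h] at s0 s1
      simp only [Matrix.cons_val, OnCylinder] at s0 s1 hpv
      rw [show p v 0 = 0 by linarith, show p v 1 = 0 by linarith] at hpv
      norm_num at hpv
    · exact Or.inr h
  have hq : ∃ (q : Fin 3 → ℝ) (E : ℝ × ℝ), OnCylinder q ∧ (∀ k, q k = e k * q k) ∧
      (geo i₁ → E = dirn q (p a)) ∧
      (¬geo i₁ → g a = a → q 0 * p a 0 + q 1 * p a 1 ≠ 1) ∧ E.1 ≠ 0 ∧ E.2 ≠ 0 := by
    by_cases hgeo : geo i₁
    · have ha : g a ≠ a := fun h => hT.geo_map i₁ hi₁ i₁ hi₁ hgeo hgeo (by simp [h₁, h, hv])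
      simp only [OnCylinder] at hpa
      rcases he' with h | h
      -- A quarter turn from `a` in the horizontal mirror: the direction is `(1, -p a 2)`, and `a`
      -- is off the mirror by genericity.
      · refine ⟨![-p a 1, p a 0, 0], _, ?_, ?_, fun _ => rfl, fun h => absurd hgeo h, ?_, ?_⟩
        · simp only [OnCylinder, Matrix.cons_val]; linarith
        · intro k; fin_cases k <;> simp [h]
        · simp only [dirn, Matrix.cons_val]
          intro h0; nlinarith
        · simpa [dirn] using hG.height_ne (by simp [h]) a ha
      -- The direction is `(-p a 1, 1)`, and `a` is off the mirror by genericity.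
      · refine ⟨![1, 0, p a 2 + 1], _, ?_, ?_, fun _ => rfl, fun h => absurd hgeo h, ?_, ?_⟩
        · simp [OnCylinder]
        · intro k; fin_cases k <;> simp [h]
        · simpa [dirn] using hG.side_ne h a ha
        · simp [dirn]
    · by_cases ha : g a = a
      · have hs : ∀ k, p a k = e k * p a k := fun k => by
          have := hR.config.symm a k; rwa [ha] at this
        -- The opposite generator at the same height: the dot product of the horizontal parts is
        -- `-1`.
        refine ⟨![-p a 0, -p a 1, p a 2], (1, 1), ?_, ?_, fun h => absurd h hgeo, fun _ _ => ?_,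
          by simp, by simp⟩
        · simpa [OnCylinder] using hpa
        · intro k; have := hs k; fin_cases k
          · simp at this ⊢; exact this
          · simp at this ⊢; exact this
          · simp at this ⊢; exact this
        · simp only [Matrix.cons_val]
          nlinarith [sq_nonneg (p a 0), sq_nonneg (p a 1)]
      · refine ⟨p v, (1, 1), hpv, fun k => ?_, fun h => absurd h hgeo, fun _ h => absurd h ha,
          by simp, by simp⟩
        have := hR.config.symm v k; rwa [hv] at this
  obtain ⟨q, E, hq1, hq2, hq3, hq4, hE1, hE2⟩ := hq
  refine IsRealization.extend (J := {i₁}) (E := fun _ => E) hg he hT' hR (v := v) (by simp)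
    (by simp [hv]) hq1 (fun _ => hq2) (by simpa using hi₁) ?_ ?_ ?_ ?_ ?_ ?_ ?_
  · intro i hi hi'
    exact ⟨Finset.mem_erase.2 ⟨by simpa using hi', hi⟩, rfl, Iff.rfl⟩
  · intro i hi _; exact Finset.mem_of_mem_erase hi
  · intro i hi hgeo
    rw [Finset.mem_singleton] at hi; subst hi
    rw [h₁, place_self, place_of_ne hav (by rwa [hv])]; exact hq3 hgeo
  · intro i hi hgeo _ h2
    rw [Finset.mem_singleton] at hi; subst hi
    rw [h₁] at h2 ⊢
    rw [place_self, place_of_ne hav (by rwa [hv])]; exact hq4 hgeo h2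
  · intro σ _ f _ i hi hi'
    exact absurd (Finset.mem_singleton.1 hi') (Finset.ne_of_mem_erase hi)
  · intro σ hσ f hf c hc
    have h0 := hf i₁ (Finset.mem_singleton_self _)
    have ha' : a ∈ S.erase v := Finset.mem_erase.2 ⟨hav, haS⟩
    simp only [h₁, orbitRow, hv, hc a ha', hc (g a) (hT'.maps a ha')] at h0
    have h3 : (E.1 * (1 + σ) + E.2 * (1 - σ)) * (f v - c) = 0 := by linarith
    have h4 := (mul_eq_zero.1 h3).resolve_left (mul_sign_ne_zero hσ hE1 hE2)
    rw [hv]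
    exact ⟨by linarith, by linarith⟩
  · intro u hu
    by_cases h : u = v
    · exact Or.inl h
    · exact Or.inr (Or.inr (Finset.mem_erase.2 ⟨h, hu⟩))

/-- The edge at `g v` is read as the image of an edge from `v` to `c`. The new point only has to see
`a` and `c` in independent directions, which is possible because the labels exclude `a = c` for two
geometric edges. -/
lemma realizable_of_two_leaves {g : V → V} (hg : Function.Involutive g) {e : Fin 3 → ℝ}
    (he : IsMirrorSign e) {S : Finset V} {I : Finset ι} {ends : ι → V × V} {geo : ι → Prop}
    (hT : IsLabelledTree g S I ends geo)
    (IH : ∀ (S' : Finset V) (I' : Finset ι) (ends' : ι → V × V) (geo' : ι → Prop),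
      S'.card < S.card → IsLabelledTree g S' I' ends' geo' → Realizable g e S' I' ends' geo')
    {v a c : V} {i₁ i₃ : ι} (hv : g v ≠ v) (hi₁ : i₁ ∈ I) (hi₃ : i₃ ∈ I) (h₁₃ : i₁ ≠ i₃)
    (h₁ : ends i₁ = (v, a)) (h₃ : ends i₃ = (g v, g c)) (ha : a ≠ v ∧ a ≠ g v)
    (hc : g c ≠ v ∧ g c ≠ g v)
    (hoth : ∀ i ∈ I, i ≠ i₁ → i ≠ i₃ →
      ((ends i).1 ≠ v ∧ (ends i).1 ≠ g v) ∧ (ends i).2 ≠ v ∧ (ends i).2 ≠ g v) :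
    Realizable g e S I ends geo := by
  classical
  have hvS : v ∈ S := by have := (hT.ends_mem i₁ hi₁).1; rwa [h₁] at this
  have haS : a ∈ S := by have := (hT.ends_mem i₁ hi₁).2; rwa [h₁] at this
  have hcS : g c ∈ S := by have := (hT.ends_mem i₃ hi₃).2; rwa [h₃] at this
  have hc1 := Finset.card_erase_add_one hvS
  have hc2 := Finset.card_erase_add_one hi₁
  have hi₃' : i₃ ∈ I.erase i₁ := Finset.mem_erase.2 ⟨h₁₃.symm, hi₃⟩
  have hc3 := Finset.card_erase_add_one hi₃'
  have hmem : ∀ i, i ∈ (I.erase i₁).erase i₃ ↔ i ≠ i₃ ∧ i ≠ i₁ ∧ i ∈ I := by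
    simp [Finset.mem_erase]
  have hS' : ∀ w, w ∈ (S.erase v).erase (g v) ↔ w ≠ g v ∧ w ≠ v ∧ w ∈ S := by
    simp [Finset.mem_erase]
  have hT' : IsLabelledTree g ((S.erase v).erase (g v)) ((I.erase i₁).erase i₃) ends geo := by
    refine hT.remove_pair hg hv hvS (fun i hi => ?_) (fun f hf => ⟨f a, f (g c), fun i hi => ?_⟩)
      (by omega) fun i hi h => ⟨((hmem i).1 hi).2.2, h, rfl⟩
    · rw [hmem] at hi
      have h2 := hoth i hi.2.2 hi.2.1 hi.1
      have h3 := hT.ends_mem i hi.2.2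
      exact ⟨(hS' _).2 ⟨h2.1.2, h2.1.1, h3.1⟩, (hS' _).2 ⟨h2.2.2, h2.2.1, h3.2⟩⟩
    · by_cases hi1 : i = i₁
      · subst hi1; simp [h₁, ha]
      by_cases hi3 : i = i₃
      · subst hi3; simp [h₃, hv, hc]
      have h2 := hoth i hi hi1 hi3
      simpa [h2] using hf i ((hmem i).2 ⟨hi3, hi1, hi⟩)
  obtain ⟨p₀, D₀, hR₀⟩ := IH _ _ _ _
    (lt_of_le_of_lt (Finset.card_erase_le) (by omega)) hT'
  obtain ⟨p, D, hR, hG⟩ := hR₀.exists_generic hg he hT'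
  obtain ⟨κ, hκ, hκ1, hκ2⟩ := he.exists_sign
  -- The direction of a free edge is taken from an auxiliary point in place of its true end.
  have hpts : ∃ xa xc : Fin 3 → ℝ, OnCylinder xa ∧ (geo i₁ → xa = p a) ∧ (geo i₃ → xc = p c) ∧
      dirn xa xc ≠ 0 := by
    by_cases hg3 : geo i₃
    · by_cases hg1 : geo i₁
      · refine ⟨p a, p c, hR.config.on a, fun _ => rfl, fun _ => rfl, hG.dirn_ne a c ?_⟩
        rintro rfl
        exact hT.geo_map i₁ hi₁ i₃ hi₃ hg1 hg3 (by simp [h₁, h₃, hg _])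
      · obtain ⟨x, hx, hx', -⟩ := exists_dirn_ne_zero (hR.config.on c) (p c)
        exact ⟨x, p c, hx, fun h => absurd h hg1, fun _ => rfl, dirn_ne_zero_comm.1 hx'⟩
    · obtain ⟨x, hx, hx', -⟩ := exists_dirn_ne_zero (hR.config.on a) (p a)
      exact ⟨p a, x, hR.config.on a, fun _ => rfl, fun h => absurd h hg3, hx'⟩
  obtain ⟨xa, xc, hxa, hxa', hxc', hx⟩ := hpts
  -- The two forbidden lines are dummies; only the independence of the directions is used.
  obtain ⟨q, hq, -, -, hdet⟩ := exists_not_parallel hxa hx (A := 1) (B := 0) (A' := 1) (B' := 0)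
    (by simp) (by simp)
  have hpc := hR.config.place hg he hq (v := v) fun h => absurd h hv
  have hcv : c ≠ v ∧ c ≠ g v :=
    ⟨fun h => hc.2 (by rw [h]), fun h => hc.1 (by rw [h, hg])⟩
  refine IsRealization.extend (J := {i₁, i₃})
    (E := fun i => if i = i₁ then dirn q xa else κ • ((dirn q xc).1, -(dirn q xc).2))
    hg he hT' hR (v := v) (by simp) (by simp) hq (fun h => absurd h hv) ?_ ?_ ?_ ?_ ?_ ?_ ?_ ?_
  · intro i hi
    rcases Finset.mem_insert.1 hi with rfl | hi
    · exact hi₁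
    · rw [Finset.mem_singleton.1 hi]; exact hi₃
  · intro i hi hi'
    simp only [Finset.mem_insert, Finset.mem_singleton, not_or] at hi'
    exact ⟨(hmem i).2 ⟨hi'.2, hi'.1, hi⟩, rfl, Iff.rfl⟩
  · intro i hi _; exact ((hmem i).1 hi).2.2
  · intro i hi hgeo
    simp only [Finset.mem_insert, Finset.mem_singleton] at hi
    rcases hi with rfl | rfl
    · rw [if_pos rfl, h₁, place_self, place_of_ne ha.1 ha.2, hxa' hgeo]
    · rw [if_neg h₁₃.symm, h₃, hpc.dirn_map hκ1 hκ2, place_self, place_of_ne hcv.1 hcv.2,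
        hxc' hgeo]
  · intro i hi hgeo h
    simp only [Finset.mem_insert, Finset.mem_singleton] at hi
    rcases hi with rfl | rfl
    · rw [h₁] at h; exact absurd h hv
    · rw [h₃] at h; exact absurd (hg.injective h) hv
  · intro σ _ f _ i hi hi'
    simp only [Finset.mem_insert, Finset.mem_singleton] at hi'
    rw [hmem] at hi
    exact absurd hi' (not_or.2 ⟨hi.2.1, hi.1⟩)
  · intro σ hσ f hf k hk
    have r1 := hf i₁ (by simp)
    have r3 := hf i₃ (by simp)
    rw [if_pos rfl, h₁] at r1
    rw [if_neg h₁₃.symm, h₃, orbitRow_mul, orbitRow_map hg hσ (dirn q xc) (v, c)] at r3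
    have hκ0 : κ ≠ 0 := fun h => by rw [h] at hκ; norm_num at hκ
    have hσ0 : σ ≠ 0 := fun h => by rw [h] at hσ; norm_num at hσ
    have r3' := (mul_eq_zero.1 ((mul_eq_zero.1 r3).resolve_left hκ0)).resolve_left hσ0
    have hcS' : c ∈ (S.erase v).erase (g v) := (hS' c).2 ⟨hcv.2, hcv.1, by
      have := hT.maps _ hcS; rwa [hg] at this⟩
    have haS' : a ∈ (S.erase v).erase (g v) := (hS' a).2 ⟨ha.2, ha.1, haS⟩
    simp only [orbitRow, hk a haS', hk _ (hT'.maps a haS')] at r1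
    simp only [orbitRow, hk c hcS', hk _ (hT'.maps c hcS')] at r3'
    obtain ⟨hx, hy⟩ := orbitRow_pair hσ hdet r1 r3'
    exact ⟨by linarith, by linarith⟩
  · intro u hu
    by_cases h : u = v
    · exact Or.inl h
    by_cases h' : u = g v
    · exact Or.inr (Or.inl h')
    · exact Or.inr (Or.inr ((hS' u).2 ⟨h', h, hu⟩))

end TreeExtensions

/-! ### Adding a pendant path or a vertex pair of total degree three. -/

section TreeExtensions

variable {V ι : Type*}

/-- The edge between `v` and `g v` is its own image, hence free, and can be made to identify `f v`
with `f (g v)`. The other edge then has one unknown to determine. -/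
lemma realizable_of_pendant_path {g : V → V} (hg : Function.Involutive g) {e : Fin 3 → ℝ}
    (he : IsMirrorSign e) {S : Finset V} {I : Finset ι} {ends : ι → V × V} {geo : ι → Prop}
    (hT : IsLabelledTree g S I ends geo)
    (IH : ∀ (S' : Finset V) (I' : Finset ι) (ends' : ι → V × V) (geo' : ι → Prop),
      S'.card < S.card → IsLabelledTree g S' I' ends' geo' → Realizable g e S' I' ends' geo')
    {v b : V} {i₁ i₂ : ι} (hv : g v ≠ v) (hi₁ : i₁ ∈ I) (hi₂ : i₂ ∈ I) (h₁₂ : i₁ ≠ i₂)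
    (h₁ : ends i₁ = (v, g v)) (h₂ : ends i₂ = (v, b)) (hb : b ≠ v ∧ b ≠ g v)
    (hoth : ∀ i ∈ I, i ≠ i₁ → i ≠ i₂ →
      ((ends i).1 ≠ v ∧ (ends i).1 ≠ g v) ∧ (ends i).2 ≠ v ∧ (ends i).2 ≠ g v) :
    Realizable g e S I ends geo := by
  classical
  have hvS : v ∈ S := by have := (hT.ends_mem i₁ hi₁).1; rwa [h₁] at this
  have hbS : b ∈ S := by have := (hT.ends_mem i₂ hi₂).2; rwa [h₂] at this
  have hc1 := Finset.card_erase_add_one hvS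
  have hc2 := Finset.card_erase_add_one hi₁
  have hc3 := Finset.card_erase_add_one (Finset.mem_erase.2 ⟨h₁₂.symm, hi₂⟩)
  have hmem : ∀ i, i ∈ (I.erase i₁).erase i₂ ↔ i ≠ i₂ ∧ i ≠ i₁ ∧ i ∈ I := by
    simp [Finset.mem_erase]
  have hS' : ∀ w, w ∈ (S.erase v).erase (g v) ↔ w ≠ g v ∧ w ≠ v ∧ w ∈ S := by
    simp [Finset.mem_erase]
  have hT' : IsLabelledTree g ((S.erase v).erase (g v)) ((I.erase i₁).erase i₂) ends geo := by
    refine hT.remove_pair hg hv hvS (fun i hi => ?_) (fun f hf => ⟨f b, f b, fun i hi => ?_⟩)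
      (by omega) fun i hi h => ⟨((hmem i).1 hi).2.2, h, rfl⟩
    · rw [hmem] at hi
      have h2 := hoth i hi.2.2 hi.2.1 hi.1
      have h3 := hT.ends_mem i hi.2.2
      exact ⟨(hS' _).2 ⟨h2.1.2, h2.1.1, h3.1⟩, (hS' _).2 ⟨h2.2.2, h2.2.1, h3.2⟩⟩
    · by_cases hi1 : i = i₁
      · subst hi1; simp [h₁]
      by_cases hi2 : i = i₂
      · subst hi2; simp [h₂, hb]
      have h2 := hoth i hi hi1 hi2
      simpa [h2] using hf i ((hmem i).2 ⟨hi2, hi1, hi⟩)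
  obtain ⟨p, D, hR⟩ := IH _ _ _ _ (lt_of_le_of_lt (Finset.card_erase_le) (by omega)) hT'
  have hgeo1 : ¬geo i₁ := fun h =>
    hT.geo_map i₁ hi₁ i₁ hi₁ h h (by simp [h₁, hg v, Sym2.eq_swap])
  obtain ⟨x, -, hx', -⟩ := exists_dirn_ne_zero (hR.config.on b) (p b)
  -- The forbidden lines are the coordinate axes, as `mul_sign_ne_zero` requires.
  obtain ⟨q, hq, hq1, hq2, -⟩ := exists_not_parallel (hR.config.on b) hx' (A := 1) (B := 0)
    (A' := 0) (B' := 1) (by simp) (by simp)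
  -- In direction `(1, 1)` the orbit equation of the edge from `v` to `g v` is `2 * (f v - f (g v))
  -- = 0`, for either sign.
  refine IsRealization.extend (J := {i₁, i₂})
    (E := fun i => if i = i₁ then (1, 1) else dirn q (p b))
    hg he hT' hR (v := v) (by simp) (by simp) hq (fun h => absurd h hv) ?_ ?_ ?_ ?_ ?_ ?_ ?_ ?_
  · intro i hi
    rcases Finset.mem_insert.1 hi with rfl | hi
    · exact hi₁
    · rw [Finset.mem_singleton.1 hi]; exact hi₂
  · intro i hi hi'
    simp only [Finset.mem_insert, Finset.mem_singleton, not_or] at hi'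
    exact ⟨(hmem i).2 ⟨hi'.2, hi'.1, hi⟩, rfl, Iff.rfl⟩
  · intro i hi _; exact ((hmem i).1 hi).2.2
  · intro i hi hgeo
    simp only [Finset.mem_insert, Finset.mem_singleton] at hi
    rcases hi with rfl | rfl
    · exact absurd hgeo hgeo1
    · rw [if_neg h₁₂.symm, h₂, place_self, place_of_ne hb.1 hb.2]
  · intro i hi hgeo h
    simp only [Finset.mem_insert, Finset.mem_singleton] at hi
    rcases hi with rfl | rfl
    · rw [h₁] at h; exact absurd h hv
    · rw [h₂] at h; exact absurd h hv
  · intro σ _ f _ i hi hi'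
    simp only [Finset.mem_insert, Finset.mem_singleton] at hi'
    rw [hmem] at hi
    exact absurd hi' (not_or.2 ⟨hi.2.1, hi.1⟩)
  · intro σ hσ f hf k hk
    have r1 := hf i₁ (by simp)
    have r2 := hf i₂ (by simp)
    rw [if_pos rfl, h₁] at r1
    rw [if_neg h₁₂.symm, h₂] at r2
    have hbS' : b ∈ (S.erase v).erase (g v) := (hS' b).2 ⟨hb.2, hb.1, hbS⟩
    simp only [orbitRow, hg v] at r1
    have hfv : f (g v) = f v := by linarith
    simp only [orbitRow, hk b hbS', hk _ (hT'.maps b hbS'), hfv] at r2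
    have hne := mul_sign_ne_zero hσ (D := dirn q (p b)) (by intro h; apply hq1; rw [h]; ring)
      (by intro h; apply hq2; rw [h]; ring)
    have h3 := (mul_eq_zero.1 (show ((dirn q (p b)).1 * (1 + σ) + (dirn q (p b)).2 * (1 - σ)) *
      (f v - k) = 0 by linarith)).resolve_left hne
    exact ⟨by linarith, by linarith⟩
  · intro u hu
    by_cases h : u = v
    · exact Or.inl h
    by_cases h' : u = g v
    · exact Or.inr (Or.inl h')
    · exact Or.inr (Or.inr ((hS' u).2 ⟨h', h, hu⟩))

-- The analogue of a Henneberg 1-extension. If the directions from `v` to `a` and to `b` are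
-- parallel to `E`, the difference of the two equations is the equation of an edge from `a` to `b`
-- in direction `E`, so rigidity of the smaller tree can be used. The third edge then determines `f`
-- at `v` and `g v`. The hypothesis `hne` excludes geometric edges to mirror images `a`, `g a` in a
-- horizontal mirror, which lie on one generator.
variable [Finite V] in
lemma realizable_of_degree_three {g : V → V} (hg : Function.Involutive g) {e : Fin 3 → ℝ}
    (he : IsMirrorSign e) {S : Finset V} {I : Finset ι} {ends : ι → V × V} {geo : ι → Prop}
    (hT : IsLabelledTree g S I ends geo)
    (IH : ∀ (S' : Finset V) (I' : Finset ι) (ends' : ι → V × V) (geo' : ι → Prop),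
      S'.card < S.card → IsLabelledTree g S' I' ends' geo' → Realizable g e S' I' ends' geo')
    {v a b c : V} {i₁ i₂ i₃ : ι} (hv : g v ≠ v) (hi₁ : i₁ ∈ I) (hi₂ : i₂ ∈ I) (hi₃ : i₃ ∈ I)
    (h₁₂ : i₁ ≠ i₂) (h₁₃ : i₁ ≠ i₃) (h₂₃ : i₂ ≠ i₃) (h₁ : ends i₁ = (v, a))
    (h₂ : ends i₂ = (v, b)) (h₃ : ends i₃ = (g v, g c)) (ha : a ≠ v ∧ a ≠ g v)
    (hb : b ≠ v ∧ b ≠ g v) (hc : g c ≠ v ∧ g c ≠ g v)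
    (hne : geo i₁ → geo i₂ → b = g a → e 0 = -1 ∨ e 1 = -1)
    (hoth : ∀ i ∈ I, i ≠ i₁ → i ≠ i₂ → i ≠ i₃ →
      ((ends i).1 ≠ v ∧ (ends i).1 ≠ g v) ∧ (ends i).2 ≠ v ∧ (ends i).2 ≠ g v) :
    Realizable g e S I ends geo := by
  classical
  have hvS : v ∈ S := by have := (hT.ends_mem i₁ hi₁).1; rwa [h₁] at this
  have haS : a ∈ S := by have := (hT.ends_mem i₁ hi₁).2; rwa [h₁] at this
  have hbS : b ∈ S := by have := (hT.ends_mem i₂ hi₂).2; rwa [h₂] at this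
  have hcS : g c ∈ S := by have := (hT.ends_mem i₃ hi₃).2; rwa [h₃] at this
  have hab : a ≠ b := by
    intro hab
    refine hT.not_joins_erase hi₂ fun f hf => hT.joins f fun i hi => ?_
    by_cases hii : i = i₂
    · have := hf i₁ (Finset.mem_erase.2 ⟨h₁₂, hi₁⟩)
      rw [h₁] at this
      rw [hii, h₂, this, hab]
    · exact hf i (Finset.mem_erase.2 ⟨hii, hi⟩)
  have hc1 := Finset.card_erase_add_one hvS
  have hc2 := Finset.card_erase_add_one hi₂
  have hc3 := Finset.card_erase_add_one (Finset.mem_erase.2 ⟨h₂₃.symm, hi₃⟩)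
  have hmem : ∀ i, i ∈ (I.erase i₂).erase i₃ ↔ i ≠ i₃ ∧ i ≠ i₂ ∧ i ∈ I := by
    simp [Finset.mem_erase]
  have hS' : ∀ w, w ∈ (S.erase v).erase (g v) ↔ w ≠ g v ∧ w ≠ v ∧ w ∈ S := by
    simp [Finset.mem_erase]
  have hcv : c ≠ v ∧ c ≠ g v :=
    ⟨fun h => hc.2 (by rw [h]), fun h => hc.1 (by rw [h, hg])⟩
  have haS' : a ∈ (S.erase v).erase (g v) := (hS' a).2 ⟨ha.2, ha.1, haS⟩
  have hbS' : b ∈ (S.erase v).erase (g v) := (hS' b).2 ⟨hb.2, hb.1, hbS⟩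
  have hcS' : c ∈ (S.erase v).erase (g v) := (hS' c).2 ⟨hcv.2, hcv.1, by
    have := hT.maps _ hcS; rwa [hg] at this⟩
  -- The index `i₁` is reused for the new edge from `a` to `b`, and loses its geometric label.
  have hT' : IsLabelledTree g ((S.erase v).erase (g v)) ((I.erase i₂).erase i₃)
      (Function.update ends i₁ (a, b)) (fun i => geo i ∧ i ≠ i₁) := by
    refine hT.remove_pair hg hv hvS (fun i hi => ?_) (fun f hf => ⟨f a, f (g c), fun i hi => ?_⟩)
      (by omega) fun i hi h => ⟨((hmem i).1 hi).2.2, h.1, Function.update_of_ne h.2 _ _⟩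
    · by_cases hi1 : i = i₁
      · rw [hi1, Function.update_self]; exact ⟨haS', hbS'⟩
      rw [Function.update_of_ne hi1]
      rw [hmem] at hi
      have h2 := hoth i hi.2.2 hi1 hi.2.1 hi.1
      have h3 := hT.ends_mem i hi.2.2
      exact ⟨(hS' _).2 ⟨h2.1.2, h2.1.1, h3.1⟩, (hS' _).2 ⟨h2.2.2, h2.2.1, h3.2⟩⟩
    · by_cases hi1 : i = i₁
      · subst hi1; simp [h₁, ha]
      by_cases hi2 : i = i₂
      · have := hf i₁ ((hmem i₁).2 ⟨h₁₃, h₁₂, hi₁⟩)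
        rw [Function.update_self] at this
        subst hi2; simpa [h₂, hb] using this
      by_cases hi3 : i = i₃
      · subst hi3; simp [h₃, hv, hc]
      have h2 := hoth i hi hi1 hi2 hi3
      have h3 := hf i ((hmem i).2 ⟨hi3, hi2, hi⟩)
      rw [Function.update_of_ne hi1] at h3
      simpa [h2] using h3
  obtain ⟨p₀, D₀, hR₀⟩ := IH _ _ _ _ (lt_of_le_of_lt (Finset.card_erase_le) (by omega)) hT'
  obtain ⟨p, D, hR, hG⟩ := hR₀.exists_generic hg he hT'
  obtain ⟨κ, hκ, hκ1, hκ2⟩ := he.exists_sign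
  have hi₁' : i₁ ∈ (I.erase i₂).erase i₃ := (hmem i₁).2 ⟨h₁₃, h₁₂, hi₁⟩
  -- The edge from `a` to `b` is free, so its direction may be exchanged; each sign forbids one
  -- line.
  obtain ⟨A, B, hAB, hex⟩ := (hR.rigid 1 (by norm_num)).exists_exchange hT'.maps hi₁'
    (hT'.ends_mem i₁ hi₁')
  obtain ⟨A', B', hAB', hex'⟩ := (hR.rigid (-1) (by norm_num)).exists_exchange hT'.maps hi₁'
    (hT'.ends_mem i₁ hi₁')
  have hgc : ∀ {i : ι}, i ∈ I → geo i → geo i₃ → (ends i).1 = v → (ends i).2 ≠ c := by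
    intro i hi hgi hg3 h1 h2
    exact hT.geo_map i hi i₃ hi₃ hgi hg3 (by simp [h₃, h1, h2, hg _])
  have hca : geo i₁ → geo i₃ → a ≠ c := fun h h' => by
    have := hgc hi₁ h h' (by rw [h₁]); rwa [h₁] at this
  have hcb : geo i₂ → geo i₃ → b ≠ c := fun h h' => by
    have := hgc hi₂ h h' (by rw [h₂]); rwa [h₂] at this
  have hpts : ∃ (xc q : Fin 3 → ℝ) (E : ℝ × ℝ) (k l : ℝ), (geo i₃ → xc = p c) ∧ OnCylinder q ∧
      k ≠ 0 ∧ l ≠ 0 ∧ (geo i₁ → k • E = dirn q (p a)) ∧ (geo i₂ → l • E = dirn q (p b)) ∧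
      A * E.1 + B * E.2 ≠ 0 ∧ A' * E.1 + B' * E.2 ≠ 0 ∧
      E.1 * (dirn q xc).2 - E.2 * (dirn q xc).1 ≠ 0 := by
    by_cases hgg : geo i₁ ∧ geo i₂
    · obtain ⟨xc, hxc, hxc', h1, h2⟩ : ∃ xc : Fin 3 → ℝ, OnCylinder xc ∧ (geo i₃ → xc = p c) ∧
          dirn (p a) xc ≠ 0 ∧ dirn (p b) xc ≠ 0 := by
        by_cases hg3 : geo i₃
        · exact ⟨p c, hR.config.on c, fun _ => rfl, hG.dirn_ne a c (hca hgg.1 hg3),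
            hG.dirn_ne b c (hcb hgg.2 hg3)⟩
        · obtain ⟨x, hx, hx1, hx2⟩ := exists_dirn_ne_zero (hR.config.on a) (p b)
          exact ⟨x, hx, fun h => absurd h hg3, hx1, hx2⟩
      have hdot : p a 0 * p b 0 + p a 1 * p b 1 ≠ 1 := by
        -- For two fixed ends this is the invariant `dot_ne` of the new free edge; otherwise it is
        -- general position.
        by_cases hf : g a = a ∧ g b = b
        · have := hR.dot_ne i₁ hi₁' (by simp)
          rw [Function.update_self] at this
          exact this hf.1 hf.2
        · exact hG.dot_ne a b hab (hne hgg.1 hgg.2) fun h h' => absurd ⟨h, h'⟩ hf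
      obtain ⟨q, E, k, l, hq, hk, hl, hqa, hqb, h3, h4, h5⟩ :=
        exists_parallel (hR.config.on a) (hR.config.on b) hxc hdot (hG.dirn_ne a b hab) h1 h2
          hAB hAB'
      exact ⟨xc, q, E, k, l, hxc', hq, hk, hl, fun _ => hqa.symm, fun _ => hqb.symm, h3, h4, h5⟩
    -- With at most one of the two edges geometric, its direction can be given to the free one, so
    -- no parallelism of actual lines is needed.
    · obtain ⟨y, xc, hy, hya, hyb, hxc', hne'⟩ : ∃ y xc : Fin 3 → ℝ, OnCylinder y ∧
          (geo i₁ → y = p a) ∧ (geo i₂ → y = p b) ∧ (geo i₃ → xc = p c) ∧ dirn y xc ≠ 0 := by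
        by_cases hg1 : geo i₁
        · have hg2 : ¬geo i₂ := fun h => hgg ⟨hg1, h⟩
          by_cases hg3 : geo i₃
          · exact ⟨p a, p c, hR.config.on a, fun _ => rfl, fun h => absurd h hg2, fun _ => rfl,
              hG.dirn_ne a c (hca hg1 hg3)⟩
          · obtain ⟨x, hx, hx1, -⟩ := exists_dirn_ne_zero (hR.config.on a) (p a)
            exact ⟨p a, x, hR.config.on a, fun _ => rfl, fun h => absurd h hg2,
              fun h => absurd h hg3, hx1⟩
        by_cases hg2 : geo i₂
        · by_cases hg3 : geo i₃
          · exact ⟨p b, p c, hR.config.on b, fun h => absurd h hg1, fun _ => rfl, fun _ => rfl,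
              hG.dirn_ne b c (hcb hg2 hg3)⟩
          · obtain ⟨x, hx, hx1, -⟩ := exists_dirn_ne_zero (hR.config.on b) (p b)
            exact ⟨p b, x, hR.config.on b, fun h => absurd h hg1, fun _ => rfl,
              fun h => absurd h hg3, hx1⟩
        · obtain ⟨x, hx, hx1, -⟩ := exists_dirn_ne_zero (hR.config.on c) (p c)
          exact ⟨x, p c, hx, fun h => absurd h hg1, fun h => absurd h hg2, fun _ => rfl,
            dirn_ne_zero_comm.1 hx1⟩
      obtain ⟨q, hq, h3, h4, h5⟩ := exists_not_parallel hy hne' hAB hAB'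
      exact ⟨xc, q, dirn q y, 1, 1, hxc', hq, one_ne_zero, one_ne_zero,
        fun h => by rw [one_smul, hya h], fun h => by rw [one_smul, hyb h], h3, h4, h5⟩
  obtain ⟨xc, q, E, k, l, hxc', hq, hk, hl, hqa, hqb, hQ, hQ', hdet⟩ := hpts
  have hR' : IsRealization g e ((S.erase v).erase (g v)) ((I.erase i₂).erase i₃)
      (Function.update ends i₁ (a, b)) (fun i => geo i ∧ i ≠ i₁) p (Function.update D i₁ E) := by
    refine ⟨hR.config, fun i hi hi' => ?_, fun σ hσ => ?_, hR.dot_ne⟩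
    · rw [Function.update_of_ne hi'.2]; exact hR.dir_eq i hi hi'
    · rcases mul_self_eq_one_iff.1 hσ with rfl | rfl
      · exact hex E hQ
      · exact hex' E hQ'
  have hpc := hR.config.place hg he hq (v := v) fun h => absurd h hv
  have hJ : ∀ i, i ∈ ({i₁, i₂, i₃} : Finset ι) ↔ i = i₁ ∨ i = i₂ ∨ i = i₃ := by simp
  refine IsRealization.extend (J := {i₁, i₂, i₃})
    (E := fun i => if i = i₁ then k • E else if i = i₂ then l • E else
      κ • ((dirn q xc).1, -(dirn q xc).2))
    hg he hT' hR' (v := v) (by simp) (by simp) hq (fun h => absurd h hv) ?_ ?_ ?_ ?_ ?_ ?_ ?_ ?_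
  · intro i hi
    rcases (hJ i).1 hi with rfl | rfl | rfl
    · exact hi₁
    · exact hi₂
    · exact hi₃
  · intro i hi hi'
    rw [hJ] at hi'
    push Not at hi'
    exact ⟨(hmem i).2 ⟨hi'.2.2, hi'.2.1, hi⟩, (Function.update_of_ne hi'.1 _ _).symm,
      by simp [hi'.1]⟩
  · intro i hi _; exact ((hmem i).1 hi).2.2
  · intro i hi hgeo
    rcases (hJ i).1 hi with rfl | rfl | rfl
    · rw [if_pos rfl, h₁, place_self, place_of_ne ha.1 ha.2, hqa hgeo]
    · rw [if_neg h₁₂.symm, if_pos rfl, h₂, place_self, place_of_ne hb.1 hb.2, hqb hgeo]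
    · rw [if_neg h₁₃.symm, if_neg h₂₃.symm, h₃, hpc.dirn_map hκ1 hκ2, place_self,
        place_of_ne hcv.1 hcv.2, hxc' hgeo]
  · intro i hi hgeo h
    rcases (hJ i).1 hi with rfl | rfl | rfl
    · rw [h₁] at h; exact absurd h hv
    · rw [h₂] at h; exact absurd h hv
    · rw [h₃] at h; exact absurd (hg.injective h) hv
  · intro σ hσ f hf i hi hi'
    rw [hmem] at hi
    have hii : i = i₁ := ((hJ i).1 hi').resolve_right (not_or.2 ⟨hi.2.1, hi.1⟩)
    have r1 := hf i₁ (by simp)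
    have r2 := hf i₂ (by simp)
    rw [if_pos rfl, h₁, orbitRow_mul] at r1
    rw [if_neg h₁₂.symm, if_pos rfl, h₂, orbitRow_mul] at r2
    have r1' := (mul_eq_zero.1 r1).resolve_left hk
    have r2' := (mul_eq_zero.1 r2).resolve_left hl
    rw [hii, Function.update_self, Function.update_self]
    -- The two parallel equations at `v` differ by the equation from `a` to `b`.
    simp only [orbitRow] at r1' r2' ⊢
    linear_combination r2' - r1'
  · intro σ hσ f hf k' hk'
    have r1 := hf i₁ (by simp)
    have r3 := hf i₃ (by simp)
    rw [if_pos rfl, h₁, orbitRow_mul] at r1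
    rw [if_neg h₁₃.symm, if_neg h₂₃.symm, h₃, orbitRow_mul,
      orbitRow_map hg hσ (dirn q xc) (v, c)] at r3
    have hκ0 : κ ≠ 0 := fun h => by rw [h] at hκ; norm_num at hκ
    have hσ0 : σ ≠ 0 := fun h => by rw [h] at hσ; norm_num at hσ
    have r1' := (mul_eq_zero.1 r1).resolve_left hk
    have r3' := (mul_eq_zero.1 ((mul_eq_zero.1 r3).resolve_left hκ0)).resolve_left hσ0
    simp only [orbitRow, hk' a haS', hk' _ (hT'.maps a haS')] at r1'
    simp only [orbitRow, hk' c hcS', hk' _ (hT'.maps c hcS')] at r3'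
    obtain ⟨hx, hy⟩ := orbitRow_pair hσ hdet r1' r3'
    exact ⟨by linarith, by linarith⟩
  · intro u hu
    by_cases h : u = v
    · exact Or.inl h
    by_cases h' : u = g v
    · exact Or.inr (Or.inl h')
    · exact Or.inr (Or.inr ((hS' u).2 ⟨h', h, hu⟩))

end TreeExtensions

/-! ### The induction on labelled trees. -/

section TreeInduction

variable {V ι : Type*}

lemma IsLabelledTree.sym2_ne {g : V → V} {S : Finset V} {I : Finset ι}
    {ends : ι → V × V} {geo : ι → Prop} (hT : IsLabelledTree g S I ends geo) {i j : ι}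
    (hi : i ∈ I) (hj : j ∈ I) (hij : i ≠ j) :
    s((ends i).1, (ends i).2) ≠ s((ends j).1, (ends j).2) := by
  classical
  intro h
  refine hT.not_joins_erase hi fun f hf => hT.joins f fun k hk => ?_
  by_cases hki : k = i
  · subst hki
    have := hf j (Finset.mem_erase.2 ⟨hij.symm, hj⟩)
    rcases Sym2.eq_iff.1 h with h | h <;> rw [h.1, h.2]
    · exact this
    · exact this.symm
  · exact hf k (Finset.mem_erase.2 ⟨hki, hk⟩)

/-- The label condition survives because a clash with another edge would make two edges of the old
tree equal, against `sym2_ne`. -/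
lemma IsLabelledTree.map_edge [DecidableEq ι] {g : V → V} (hg : Function.Involutive g)
    {S : Finset V} {I : Finset ι} {ends : ι → V × V} {geo : ι → Prop}
    (hT : IsLabelledTree g S I ends geo) {j : ι} (hj : j ∈ I)
    (hjoin : Joins S I (Function.update ends j (g (ends j).1, g (ends j).2))) :
    IsLabelledTree g S I (Function.update ends j (g (ends j).1, g (ends j).2)) geo := by
  have hinj : ∀ x y z w : V, s(g x, g y) = s(g z, g w) → s(x, y) = s(z, w) := by
    intro x y z w h
    exact Sym2.map.injective hg.injective (by simpa using h)
  refine ⟨hT.maps, fun i hi => ?_, hjoin, hT.card_eq, fun i hi k hk hgi hgk h => ?_⟩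
  · by_cases hij : i = j
    · subst hij
      rw [Function.update_self]
      exact ⟨hT.maps _ (hT.ends_mem i hi).1, hT.maps _ (hT.ends_mem i hi).2⟩
    · rw [Function.update_of_ne hij]; exact hT.ends_mem i hi
  · by_cases hij : i = j <;> by_cases hkj : k = j
    · subst hij; subst hkj
      simp only [Function.update_self] at h
      exact hT.geo_map _ hi _ hi hgi hgi (hinj _ _ _ _ h)
    · subst hij
      rw [Function.update_self, Function.update_of_ne hkj] at h
      exact hT.sym2_ne hi hk (Ne.symm hkj) (hinj _ _ _ _ h)
    · subst hkj
      rw [Function.update_self, Function.update_of_ne hij] at h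
      simp only [hg _] at h
      exact hT.sym2_ne hi hk hij h
    · rw [Function.update_of_ne hij, Function.update_of_ne hkj] at h
      exact hT.geo_map i hi k hk hgi hgk h

/-- If a vertex `v` is joined to `a` and `g a`, then one of these edges can be replaced by its
image under `g`. -/
lemma IsLabelledTree.joins_map_edge [DecidableEq ι] {g : V → V} (hg : Function.Involutive g)
    {S : Finset V} {I : Finset ι} {ends : ι → V × V} {geo : ι → Prop}
    (hT : IsLabelledTree g S I ends geo) {v a c : V} {i₁ i₂ i₃ : ι} (hv : g v ≠ v)
    (hi₁ : i₁ ∈ I) (hi₂ : i₂ ∈ I) (hi₃ : i₃ ∈ I)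
    (h₁₂ : i₁ ≠ i₂) (h₁₃ : i₁ ≠ i₃) (h₂₃ : i₂ ≠ i₃) (h₁ : ends i₁ = (v, a))
    (h₂ : ends i₂ = (v, g a)) (h₃ : ends i₃ = (g v, g c)) (ha : a ≠ v ∧ a ≠ g v)
    (hb : g a ≠ v ∧ g a ≠ g v) (hc : g c ≠ v ∧ g c ≠ g v)
    (hoth : ∀ i ∈ I, i ≠ i₁ → i ≠ i₂ → i ≠ i₃ →
      ((ends i).1 ≠ v ∧ (ends i).1 ≠ g v) ∧ (ends i).2 ≠ v ∧ (ends i).2 ≠ g v) :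
    Joins S I (Function.update ends i₁ (g (ends i₁).1, g (ends i₁).2)) ∨
      Joins S I (Function.update ends i₂ (g (ends i₂).1, g (ends i₂).2)) := by
  classical
  have haS : a ∈ S := by have := (hT.ends_mem i₁ hi₁).2; rwa [h₁] at this
  have hcS : g c ∈ S := by have := (hT.ends_mem i₃ hi₃).2; rwa [h₃] at this
  set rest : (V → ℝ) → Prop := fun f =>
    ∀ i ∈ I, i ≠ i₁ → i ≠ i₂ → i ≠ i₃ → f (ends i).1 = f (ends i).2 with hrest
  have hopt1 : (∀ f, rest f → f (g a) = f (g c) → f a = f (g a)) →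
      Joins S I (Function.update ends i₁ (g (ends i₁).1, g (ends i₁).2)) := by
    intro H f hf
    have e1 := hf i₁ hi₁
    have e2 := hf i₂ hi₂
    have e3 := hf i₃ hi₃
    simp only [Function.update_self, Function.update_of_ne h₁₂.symm, Function.update_of_ne h₁₃.symm,
      h₁, h₂, h₃] at e1 e2 e3
    have hr : rest f := fun i hi n1 n2 n3 => by
      have := hf i hi; rwa [Function.update_of_ne n1] at this
    have e4 := H f hr (by rw [← e1, e3])
    refine hT.joins f fun i hi => ?_
    by_cases n1 : i = i₁
    · rw [n1, h₁]; simp only; rw [e2, e4]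
    by_cases n2 : i = i₂
    · rw [n2, h₂]; exact e2
    by_cases n3 : i = i₃
    · rw [n3, h₃]; exact e3
    · exact hr i hi n1 n2 n3
  have hopt2 : (∀ f, rest f → f a = f (g c) → f a = f (g a)) →
      Joins S I (Function.update ends i₂ (g (ends i₂).1, g (ends i₂).2)) := by
    intro H f hf
    have e1 := hf i₁ hi₁
    have e2 := hf i₂ hi₂
    have e3 := hf i₃ hi₃
    simp only [Function.update_self, Function.update_of_ne h₁₂, Function.update_of_ne h₂₃.symm,
      h₁, h₂, h₃, hg a] at e1 e2 e3
    have hr : rest f := fun i hi n1 n2 n3 => by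
      have := hf i hi; rwa [Function.update_of_ne n2] at this
    have e4 := H f hr (by rw [← e2, e3])
    refine hT.joins f fun i hi => ?_
    by_cases n1 : i = i₁
    · rw [n1, h₁]; exact e1
    by_cases n2 : i = i₂
    · rw [n2, h₂]; simp only; rw [e1, e4]
    by_cases n3 : i = i₃
    · rw [n3, h₃]; exact e3
    · exact hr i hi n1 n2 n3
  -- Without `v` and `g v` the tree falls into two parts, one containing `a` and the other `g a`; a
  -- function `h` constant along the remaining edges tells them apart. The new edge at `g v` must
  -- lead to the part that does not contain `g c`.
  by_cases hK : ∀ f, rest f → f a = f (g a)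
  · exact Or.inl (hopt1 fun f hf _ => hK f hf)
  push Not at hK
  obtain ⟨h, hh, hne⟩ := hK
  have key : ∀ x ∈ S, x ≠ v → x ≠ g v → h x ≠ h (g c) →
      ∀ f, rest f → f x = f (g c) → f a = f (g a) := by
    intro x hx hxv hxgv hxc f hf hfx
    set lam := (f a - f (g a)) / (h a - h (g a)) with hlam
    have hne' : h a - h (g a) ≠ 0 := sub_ne_zero.2 hne
    have hl : f a - lam * h a = f (g a) - lam * h (g a) := by
      have : lam * (h a - h (g a)) = f a - f (g a) := by rw [hlam]; field_simp
      linarith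
    have hF := hT.joins (fun w => if w = v then f a - lam * h a else
      if w = g v then f (g c) - lam * h (g c) else f w - lam * h w) (fun i hi => by
        by_cases n1 : i = i₁
        · subst n1; simp [h₁, ha]
        by_cases n2 : i = i₂
        · subst n2; simp [h₂, hb, hl]
        by_cases n3 : i = i₃
        · subst n3; simp [h₃, hc, hv]
        have h5 := hoth i hi n1 n2 n3
        simp [h5, hf i hi n1 n2 n3, hh i hi n1 n2 n3]) x hx (g c) hcS
    simp only [hxv, hxgv, hc.1, hc.2, if_false] at hF
    have h6 : lam * (h x - h (g c)) = 0 := by linarith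
    have h7 := (mul_eq_zero.1 h6).resolve_right (sub_ne_zero.2 hxc)
    rw [h7] at hl; linarith
  by_cases hac : h a = h (g c)
  · exact Or.inl (hopt1 (key (g a) (hT.maps a haS) hb.1 hb.2 fun h' => hne (hac.trans h'.symm)))
  · exact Or.inr (hopt2 (key a haS ha.1 ha.2 hac))

/-- The degrees sum to at most `2 * (|S| - 1)`, and `g` permutes `S`, so the sums of the degrees at
`v` and `g v` average less than four. -/
lemma IsLabelledTree.exists_small_degree [DecidableEq V] {g : V → V} (hg : Function.Involutive g)
    {S : Finset V} {I : Finset ι} {ends : ι → V × V} {geo : ι → Prop}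
    (hT : IsLabelledTree g S I ends geo) :
    ∃ v ∈ S, (I.filter fun i => (ends i).1 = v ∨ (ends i).2 = v).card +
      (I.filter fun i => (ends i).1 = g v ∨ (ends i).2 = g v).card ≤ 3 := by
  by_contra! hcon
  have h1 : ∑ v ∈ S, 4 ≤ ∑ v ∈ S, ((I.filter fun i => (ends i).1 = v ∨ (ends i).2 = v).card +
      (I.filter fun i => (ends i).1 = g v ∨ (ends i).2 = g v).card) :=
    Finset.sum_le_sum fun v hv => hcon v hv
  have h2 : ∑ v ∈ S, (I.filter fun i => (ends i).1 = g v ∨ (ends i).2 = g v).card =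
      ∑ v ∈ S, (I.filter fun i => (ends i).1 = v ∨ (ends i).2 = v).card :=
    Finset.sum_nbij' g g hT.maps hT.maps (fun v _ => hg v) (fun v _ => hg v) fun v _ => rfl
  have h3 : ∑ v ∈ S, (I.filter fun i => (ends i).1 = v ∨ (ends i).2 = v).card ≤ I.card * 2 := by
    rw [show ∑ v ∈ S, (I.filter fun i => (ends i).1 = v ∨ (ends i).2 = v).card =
      ∑ i ∈ I, (S.filter fun v => (ends i).1 = v ∨ (ends i).2 = v).card from
        Finset.sum_card_bipartiteAbove_eq_sum_card_bipartiteBelow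
          fun v i => (ends i).1 = v ∨ (ends i).2 = v]
    refine Finset.sum_le_card_nsmul _ _ _ fun i _ => ?_
    refine (Finset.card_le_card fun v hv => ?_).trans
      (Finset.card_le_two (a := (ends i).1) (b := (ends i).2))
    simp only [Finset.mem_filter, Finset.mem_insert, Finset.mem_singleton] at hv ⊢
    exact hv.2.imp Eq.symm Eq.symm
  rw [Finset.sum_add_distrib, h2] at h1
  simp only [Finset.sum_const, smul_eq_mul] at h1
  have := hT.card_eq
  omega

lemma IsLabelledTree.exists_incident {g : V → V} {S : Finset V} {I : Finset ι}
    {ends : ι → V × V} {geo : ι → Prop} (hT : IsLabelledTree g S I ends geo) (hS : 1 < S.card)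
    {v : V} (hv : v ∈ S) : ∃ i ∈ I, (ends i).1 = v ∨ (ends i).2 = v := by
  classical
  by_contra! hcon
  obtain ⟨w, hw, hwv⟩ := Finset.exists_mem_ne hS v
  have := hT.joins (fun x => if x = v then 1 else 0) (fun i hi => by simp [hcon i hi]) w hw v hv
  simp [hwv] at this

variable [Finite V]

/-- Removes `hne`. In the bad case one of the edges to `a`, `g a` is replaced by its image, which
leaves the orbits unchanged. Now `g v` has two edges, and their ends are not exchanged by `g`, since
the old tree would then contain a geometric edge and its image. -/
lemma realizable_of_degree_three' {g : V → V} (hg : Function.Involutive g) {e : Fin 3 → ℝ}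
    (he : IsMirrorSign e) {S : Finset V} {I : Finset ι} {ends : ι → V × V} {geo : ι → Prop}
    (hT : IsLabelledTree g S I ends geo)
    (IH : ∀ (S' : Finset V) (I' : Finset ι) (ends' : ι → V × V) (geo' : ι → Prop),
      S'.card < S.card → IsLabelledTree g S' I' ends' geo' → Realizable g e S' I' ends' geo')
    {v a b c : V} {i₁ i₂ i₃ : ι} (hv : g v ≠ v) (hi₁ : i₁ ∈ I) (hi₂ : i₂ ∈ I) (hi₃ : i₃ ∈ I)
    (h₁₂ : i₁ ≠ i₂) (h₁₃ : i₁ ≠ i₃) (h₂₃ : i₂ ≠ i₃) (h₁ : ends i₁ = (v, a))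
    (h₂ : ends i₂ = (v, b)) (h₃ : ends i₃ = (g v, g c)) (ha : a ≠ v ∧ a ≠ g v)
    (hb : b ≠ v ∧ b ≠ g v) (hc : g c ≠ v ∧ g c ≠ g v)
    (hoth : ∀ i ∈ I, i ≠ i₁ → i ≠ i₂ → i ≠ i₃ →
      ((ends i).1 ≠ v ∧ (ends i).1 ≠ g v) ∧ (ends i).2 ≠ v ∧ (ends i).2 ≠ g v) :
    Realizable g e S I ends geo := by
  classical
  by_cases hne : geo i₁ → geo i₂ → b = g a → e 0 = -1 ∨ e 1 = -1
  · exact realizable_of_degree_three hg he hT IH hv hi₁ hi₂ hi₃ h₁₂ h₁₃ h₂₃ h₁ h₂ h₃ ha hb hc hne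
      hoth
  push Not at hne
  obtain ⟨hg1, hg2, rfl, -⟩ := hne
  have hv' : g (g v) ≠ g v := fun h => hv (hg.injective h)
  have hback : ∀ j, ∀ i ∈ I, ends i = Function.update ends j (g (ends j).1, g (ends j).2) i ∨
      ends i = (Function.update ends j (g (ends j).1, g (ends j).2) i).swap ∨
      ends i = (g (Function.update ends j (g (ends j).1, g (ends j).2) i).1,
        g (Function.update ends j (g (ends j).1, g (ends j).2) i).2) := by
    intro j i _
    by_cases hij : i = j
    · subst hij; right; right; simp [hg _]
    · left; rw [Function.update_of_ne hij]
  rcases hT.joins_map_edge hg hv hi₁ hi₂ hi₃ h₁₂ h₁₃ h₂₃ h₁ h₂ h₃ ha hb hc hoth with hj | hj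
  · refine Realizable.of_orbit hg he ?_ (hback i₁)
    refine realizable_of_degree_three hg he (hT.map_edge hg hi₁ hj) IH (v := g v) (a := g a)
      (b := g c) (c := a) hv' hi₁ hi₃ hi₂ h₁₃ h₁₂ h₂₃.symm (by simp [h₁])
      (by rw [Function.update_of_ne h₁₃.symm, h₃])
      (by rw [Function.update_of_ne h₁₂.symm, h₂, hg]) ⟨hb.2, by rw [hg]; exact hb.1⟩
      ⟨hc.2, by rw [hg]; exact hc.1⟩ ⟨hb.2, by rw [hg]; exact hb.1⟩ (fun _ hg3 h => ?_)
      fun i hi n1 n3 n2 => ?_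
    · exact absurd (by rw [h₃, h₂, h]) (hT.geo_map i₃ hi₃ i₂ hi₂ hg3 hg2)
    · have := hoth i hi n1 n2 n3
      rw [Function.update_of_ne n1, hg]
      exact ⟨this.1.symm, this.2.symm⟩
  · refine Realizable.of_orbit hg he ?_ (hback i₂)
    refine realizable_of_degree_three hg he (hT.map_edge hg hi₂ hj) IH (v := g v) (a := a)
      (b := g c) (c := g a) hv' hi₂ hi₃ hi₁ h₂₃ h₁₂.symm h₁₃.symm (by simp [h₂, hg a])
      (by rw [Function.update_of_ne h₂₃.symm, h₃])
      (by rw [Function.update_of_ne h₁₂, h₁, hg, hg]) ⟨ha.2, by rw [hg]; exact ha.1⟩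
      ⟨hc.2, by rw [hg]; exact hc.1⟩ ⟨by rw [hg]; exact ha.2, by rw [hg, hg]; exact ha.1⟩
      (fun _ hg3 h => ?_) fun i hi n2 n3 n1 => ?_
    · exact absurd (by rw [h₃, h₁, h]) (hT.geo_map i₃ hi₃ i₁ hi₁ hg3 hg1)
    · have := hoth i hi n1 n2 n3
      rw [Function.update_of_ne n2, hg]
      exact ⟨this.1.symm, this.2.symm⟩

/-- Both vertices of the tree are exchanged by `g`. -/
lemma realizable_of_pair {g : V → V} (hg : Function.Involutive g) {e : Fin 3 → ℝ}
    (he : IsMirrorSign e) (hfix : e 0 = -1 → ∀ v, g v ≠ v) {S : Finset V} {I : Finset ι}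
    {ends : ι → V × V} {geo : ι → Prop} (hT : IsLabelledTree g S I ends geo) {v : V} {i₁ : ι}
    (hv : g v ≠ v) (hi₁ : i₁ ∈ I) (h₁ : ends i₁ = (v, g v))
    (hoth : ∀ i ∈ I, i ≠ i₁ →
      ((ends i).1 ≠ v ∧ (ends i).1 ≠ g v) ∧ (ends i).2 ≠ v ∧ (ends i).2 ≠ g v) :
    Realizable g e S I ends geo := by
  classical
  have hvS : v ∈ S := by have := (hT.ends_mem i₁ hi₁).1; rwa [h₁] at this
  have hS : ∀ w ∈ S, w = v ∨ w = g v := by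
    intro w hw
    have := hT.joins (fun x => if x = v ∨ x = g v then 1 else 0) (fun i hi => by
      by_cases hii : i = i₁
      · subst hii; simp [h₁]
      · simp [hoth i hi hii]) w hw v hvS
    by_contra hcon
    simp [hcon] at this
  have hcard : S.card = 2 := by
    rw [show S = {v, g v} from Finset.ext fun w => ⟨fun hw => by simpa using hS w hw, fun hw => by
      rcases Finset.mem_insert.1 hw with rfl | hw
      · exact hvS
      · rw [Finset.mem_singleton.1 hw]; exact hT.maps v hvS⟩]
    exact Finset.card_pair hv.symm
  have hI : ∀ i ∈ I, i = i₁ := by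
    have h1 : I.card ≤ 1 := by have := hT.card_eq; omega
    exact fun i hi => Finset.card_le_one.1 h1 i hi i₁ hi₁
  have hgeo1 : ¬geo i₁ := fun h =>
    hT.geo_map i₁ hi₁ i₁ hi₁ h h (by simp [h₁, hg v, Sym2.eq_swap])
  obtain ⟨p, hp⟩ := exists_isConfig hg he hfix
  refine ⟨p, fun _ => (1, 1), hp, fun i hi h => ?_, fun σ hσ f hf => ?_, fun i hi _ h => ?_⟩
  · rw [hI i hi] at h; exact absurd h hgeo1
  · have r1 := hf i₁ hi₁
    simp only [h₁, orbitRow, hg v] at r1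
    have hfv : f (g v) = f v := by linarith
    intro a ha b hb
    rcases hS a ha with rfl | rfl <;> rcases hS b hb with rfl | rfl <;> simp [hfv]
  · rw [hI i hi, h₁] at h; exact absurd h hv

/-- Every labelled tree is realizable. -/
theorem IsLabelledTree.realizable {g : V → V} (hg : Function.Involutive g) {e : Fin 3 → ℝ}
    (he : IsMirrorSign e) (hfix : e 0 = -1 → ∀ v, g v ≠ v) {S : Finset V} {I : Finset ι}
    {ends : ι → V × V} {geo : ι → Prop} (hT : IsLabelledTree g S I ends geo) :
    Realizable g e S I ends geo := by
  classical
  induction hn : S.card using Nat.strong_induction_on generalizing S I ends geo with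
  | _ n ih =>
  have IH : ∀ (S' : Finset V) (I' : Finset ι) (ends' : ι → V × V) (geo' : ι → Prop),
      S'.card < S.card → IsLabelledTree g S' I' ends' geo' → Realizable g e S' I' ends' geo' :=
    fun S' I' ends' geo' hlt hT' => ih S'.card (hn ▸ hlt) hT' rfl
  clear ih
  have hcard := hT.card_eq
  by_cases hS : S.card ≤ 1
  · have hI : I = ∅ := Finset.card_eq_zero.1 (by omega)
    obtain ⟨p, hp⟩ := exists_isConfig hg he hfix
    subst hI
    exact ⟨p, fun _ => 0, hp, by simp, fun σ _ f _ u hu v hv => by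
      rw [Finset.card_le_one.1 hS u hu v hv], by simp⟩
  push Not at hS
  -- a vertex of small degree, with at least as many edges of the tree at it as at its image
  obtain ⟨v, hvS, hdeg, hle⟩ : ∃ v ∈ S,
      (I.filter fun i => (ends i).1 = v ∨ (ends i).2 = v).card +
        (I.filter fun i => (ends i).1 = g v ∨ (ends i).2 = g v).card ≤ 3 ∧
      (I.filter fun i => (ends i).1 = g v ∨ (ends i).2 = g v).card ≤
        (I.filter fun i => (ends i).1 = v ∨ (ends i).2 = v).card := by
    obtain ⟨v, hv, h⟩ := hT.exists_small_degree hg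
    rcases le_total (I.filter fun i => (ends i).1 = g v ∨ (ends i).2 = g v).card
      (I.filter fun i => (ends i).1 = v ∨ (ends i).2 = v).card with h' | h'
    · exact ⟨v, hv, h, h'⟩
    · refine ⟨g v, hT.maps v hv, ?_, ?_⟩
      · simp only [hg v]; omega
      · simpa only [hg v] using h'
  -- orient the edges away from `v` and `g v`
  set ends' : ι → V × V := fun i =>
    if (ends i).2 = v ∨ ((ends i).2 = g v ∧ (ends i).1 ≠ v) then (ends i).swap else ends i
    with hends'
  have hsw : ∀ i, ends' i = ends i ∨ ends' i = (ends i).swap := fun i => by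
    simp only [hends']; split_ifs <;> simp
  suffices Realizable g e S I ends' geo from
    this.of_orbit hg he fun i _ => (hsw i).imp Eq.symm fun h => Or.inl (by rw [h, Prod.swap_swap])
  have hT' := hT.of_swap hsw
  have hinc : ∀ w, (I.filter fun i => (ends' i).1 = w ∨ (ends' i).2 = w) =
      I.filter fun i => (ends i).1 = w ∨ (ends i).2 = w := fun w => by
    refine Finset.filter_congr fun i _ => ?_
    rcases hsw i with h | h <;> rw [h]
    exact or_comm
  rw [← hinc, ← hinc] at hdeg hle
  have hor : ∀ i ∈ I, ((ends' i).1 = v ∨ (ends' i).2 = v → (ends' i).1 = v) ∧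
      ((ends' i).1 = g v ∨ (ends' i).2 = g v → (ends' i).1 = g v ∨ (ends' i).1 = v) := by
    intro i hi
    have hloop := hT.ends_ne hi
    simp only [hends']
    split_ifs with h
    · simp only [Prod.fst_swap, Prod.snd_swap]
      grind
    · grind
  clear_value ends'
  clear hsw hinc hends' hT ends
  rename' ends' => ends, hT' => hT
  have hgvS := hT.maps v hvS
  set Iv := I.filter fun i => (ends i).1 = v ∨ (ends i).2 = v with hIv
  set Ig := I.filter fun i => (ends i).1 = g v ∨ (ends i).2 = g v with hIg
  have hIv0 : 0 < Iv.card := by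
    obtain ⟨i, hi, h⟩ := hT.exists_incident hS hvS
    exact Finset.card_pos.2 ⟨i, Finset.mem_filter.2 ⟨hi, h⟩⟩
  have hIg0 : 0 < Ig.card := by
    obtain ⟨i, hi, h⟩ := hT.exists_incident hS hgvS
    exact Finset.card_pos.2 ⟨i, Finset.mem_filter.2 ⟨hi, h⟩⟩
  have hmv : ∀ i, i ∈ Iv ↔ i ∈ I ∧ ((ends i).1 = v ∨ (ends i).2 = v) := fun i => by
    rw [hIv, Finset.mem_filter]
  have hmg : ∀ i, i ∈ Ig ↔ i ∈ I ∧ ((ends i).1 = g v ∨ (ends i).2 = g v) := fun i => by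
    rw [hIg, Finset.mem_filter]
  -- Both degrees are positive, their sum is at most three, and the one at `v` is not smaller; so it
  -- is one or two.
  have hIg1 : Ig.card = 1 := by omega
  obtain ⟨i₃, hi₃⟩ := Finset.card_eq_one.1 hIg1
  have hi₃I : i₃ ∈ I := ((hmg i₃).1 (by rw [hi₃]; exact Finset.mem_singleton_self _)).1
  have hend3 := (hor i₃ hi₃I).2 ((hmg i₃).1 (by rw [hi₃]; exact Finset.mem_singleton_self _)).2
  have hfst : ∀ i ∈ Iv, ends i = (v, (ends i).2) := fun i hi =>
    Prod.ext ((hor i ((hmv i).1 hi).1).1 ((hmv i).1 hi).2) rfl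
  have hav : ∀ i ∈ Iv, (ends i).2 ≠ v := fun i hi h => by
    have := hT.ends_ne ((hmv i).1 hi).1
    rw [hfst i hi] at this
    exact this h.symm
  have hnot : ∀ i ∈ I, i ∉ Iv → (ends i).1 ≠ v ∧ (ends i).2 ≠ v := fun i hi h => by
    rw [hmv] at h; push Not at h; exact h hi
  have hnotg : ∀ i ∈ I, i ≠ i₃ → (ends i).1 ≠ g v ∧ (ends i).2 ≠ g v := fun i hi h => by
    have h' : i ∉ Ig := by rwa [hi₃, Finset.mem_singleton]
    rw [hmg] at h'; push Not at h'; exact h' hi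
  by_cases hv : g v = v
  · have hIvg : Iv = Ig := by rw [hIv, hIg, hv]
    have h3 : i₃ ∈ Iv := by rw [hIvg, hi₃]; exact Finset.mem_singleton_self _
    exact realizable_of_fixed_leaf hg he hT IH hv hi₃I (hfst i₃ h3) fun i hi hne => by
      have := hnotg i hi hne
      rwa [hv] at this
  -- Whether the only edge at `g v` leads to `v`.
  by_cases h3v : i₃ ∈ Iv
  · have h2 : (ends i₃).2 = g v := by
      have := ((hmg i₃).1 (by rw [hi₃]; exact Finset.mem_singleton_self _)).2
      rw [hfst i₃ h3v] at this
      exact this.resolve_left fun h => hv h.symm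
    have h3 : ends i₃ = (v, g v) := by rw [hfst i₃ h3v, h2]
    by_cases hIv1 : Iv.card = 1
    · obtain ⟨i₁, hi₁⟩ := Finset.card_eq_one.1 hIv1
      have h13 : i₃ = i₁ := by rwa [hi₁, Finset.mem_singleton] at h3v
      refine realizable_of_pair hg he hfix hT hv hi₃I h3 fun i hi hne => ?_
      have h4 := hnot i hi (by rw [hi₁, Finset.mem_singleton, ← h13]; exact hne)
      have h5 := hnotg i hi hne
      exact ⟨⟨h4.1, h5.1⟩, h4.2, h5.2⟩
    · obtain ⟨i₂, hi₂, h23⟩ := Finset.exists_mem_ne (by omega : 1 < Iv.card) i₃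
      have hIv2 : Iv = {i₃, i₂} := (Finset.eq_of_subset_of_card_le
        (Finset.insert_subset h3v (Finset.singleton_subset_iff.2 hi₂))
        (by rw [Finset.card_pair h23.symm]; omega)).symm
      have hi₂I := ((hmv i₂).1 hi₂).1
      refine realizable_of_pendant_path hg he hT IH hv hi₃I hi₂I h23.symm h3 (hfst i₂ hi₂)
        ⟨hav i₂ hi₂, (hnotg i₂ hi₂I h23).2⟩ fun i hi n3 n2 => ?_
      have h4 := hnot i hi (by rw [hIv2]; simp [n2, n3])
      have h5 := hnotg i hi n3
      exact ⟨⟨h4.1, h5.1⟩, h4.2, h5.2⟩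
  have h3fst : (ends i₃).1 = g v := hend3.resolve_right (hnot i₃ hi₃I h3v).1
  have h3 : ends i₃ = (g v, g (g (ends i₃).2)) := Prod.ext h3fst (hg _).symm
  have hc : g (g (ends i₃).2) ≠ v ∧ g (g (ends i₃).2) ≠ g v := by
    rw [hg]
    refine ⟨(hnot i₃ hi₃I h3v).2, fun h => hT.ends_ne hi₃I ?_⟩
    rw [h, h3fst]
  have hne3 : ∀ i ∈ Iv, i ≠ i₃ := fun i hi => ne_of_mem_of_not_mem hi h3v
  have hag : ∀ i ∈ Iv, (ends i).2 ≠ v ∧ (ends i).2 ≠ g v := fun i hi =>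
    ⟨hav i hi, (hnotg i ((hmv i).1 hi).1 (hne3 i hi)).2⟩
  by_cases hIv1 : Iv.card = 1
  · obtain ⟨i₁, hi₁⟩ := Finset.card_eq_one.1 hIv1
    have h1 : i₁ ∈ Iv := by rw [hi₁]; exact Finset.mem_singleton_self _
    refine realizable_of_two_leaves hg he hT IH hv ((hmv i₁).1 h1).1 hi₃I (hne3 i₁ h1)
      (hfst i₁ h1) h3 (hag i₁ h1) hc fun i hi n1 n3 => ?_
    have h4 := hnot i hi (by rw [hi₁, Finset.mem_singleton]; exact n1)
    have h5 := hnotg i hi n3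
    exact ⟨⟨h4.1, h5.1⟩, h4.2, h5.2⟩
  · obtain ⟨i₁, h1⟩ := Finset.card_pos.1 hIv0
    obtain ⟨i₂, h2, h12⟩ := Finset.exists_mem_ne (by omega : 1 < Iv.card) i₁
    have hIv2 : Iv = {i₁, i₂} := (Finset.eq_of_subset_of_card_le
      (Finset.insert_subset h1 (Finset.singleton_subset_iff.2 h2))
      (by rw [Finset.card_pair h12.symm]; omega)).symm
    refine realizable_of_degree_three' hg he hT IH hv ((hmv i₁).1 h1).1 ((hmv i₂).1 h2).1 hi₃I
      h12.symm (hne3 i₁ h1) (hne3 i₂ h2) (hfst i₁ h1) (hfst i₂ h2) h3 (hag i₁ h1) (hag i₂ h2) hc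
      fun i hi n1 n2 n3 => ?_
    have h4 := hnot i hi (by rw [hIv2]; simp [n1, n2])
    have h5 := hnotg i hi n3
    exact ⟨⟨h4.1, h5.1⟩, h4.2, h5.2⟩

end TreeInduction

/-! ### From frameworks on the cylinder to angular and axial velocities. -/

section CylinderFrameworks

variable {V : Type*}

lemma inner_eq_of_tangent {p q p' q' : E3}
    {x y x' y' : ℝ} (hp0 : p' 0 = -p 1 * x) (hp1 : p' 1 = p 0 * x) (hp2 : p' 2 = y)
    (hq0 : q' 0 = -q 1 * x') (hq1 : q' 1 = q 0 * x') (hq2 : q' 2 = y') :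
    inner ℝ (p - q) (p' - q') = (dirn p q).1 * (x - x') + (dirn p q).2 * (y - y') := by
  simp only [PiLp.inner_apply, Fin.sum_univ_three, PiLp.sub_apply, hp0, hp1, hp2, hq0, hq1, hq2,
    dirn, RCLike.inner_apply, conj_trivial]
  ring

/-- A tangent vector at `p v` is `x` times the rotation field plus `y` times the axial unit vector;
the trivial motions are those with constant `x` and `y`. -/
lemma isInfinitesimallyRigid_iff [Nonempty V] {G : SimpleGraph V} {p : V → E3}
    (hp : ∀ v, p v ∈ cylinder) :
    IsInfinitesimallyRigid G p ↔ ∀ x y : V → ℝ, (∀ u v, G.Adj u v →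
      (dirn (p u) (p v)).1 * (x u - x v) + (dirn (p u) (p v)).2 * (y u - y v) = 0) →
      (∀ u v, x u = x v) ∧ ∀ u v, y u = y v := by
  constructor
  · intro h x y hxy
    obtain ⟨a, b, hab⟩ := h (fun v => !₂[-(p v 1) * x v, p v 0 * x v, y v])
      ⟨fun u v huv => by
        rw [← hxy u v huv]
        exact inner_eq_of_tangent (by simp) (by simp) (by simp) (by simp) (by simp)
          (by simp), fun v => by simp; ring⟩
    have hx : ∀ v, x v = b := by
      intro v
      have h0 := congrArg (fun w : E3 => w 0) (hab v)
      have h1 := congrArg (fun w : E3 => w 1) (hab v)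
      have hv := hp v
      simp at h0 h1
      simp only [cylinder, Set.mem_ofPred_eq] at hv
      linear_combination p v 0 * h1 + p v 1 * h0 + (b - x v) * hv
    have hy : ∀ v, y v = a := by
      intro v
      have h2 := congrArg (fun w : E3 => w 2) (hab v)
      simpa using h2
    exact ⟨fun u v => by rw [hx, hx], fun u v => by rw [hy, hy]⟩
  · intro h p' hp'
    have hv : ∀ v, p' v 0 = -p v 1 * (p v 0 * p' v 1 - p v 1 * p' v 0) ∧
        p' v 1 = p v 0 * (p v 0 * p' v 1 - p v 1 * p' v 0) := by
      intro v
      have h1 := hp v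
      have h2 := hp'.2 v
      simp only [cylinder, Set.mem_ofPred_eq] at h1
      exact ⟨by linear_combination -p' v 0 * h1 + p v 0 * h2,
        by linear_combination -p' v 1 * h1 + p v 1 * h2⟩
    obtain ⟨hx, hy⟩ := h (fun v => p v 0 * p' v 1 - p v 1 * p' v 0) (fun v => p' v 2)
      fun u v huv => by
        rw [← hp'.1 u v huv]
        exact (inner_eq_of_tangent (hv u).1 (hv u).2 rfl (hv v).1 (hv v).2 rfl).symm
    obtain ⟨r⟩ := ‹Nonempty V›
    refine ⟨p' r 2, p r 0 * p' r 1 - p r 1 * p' r 0, fun v => ?_⟩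
    ext k
    fin_cases k
    · simp only [Fin.zero_eta, PiLp.add_apply, PiLp.smul_apply, smul_eq_mul]
      rw [(hv v).1, hx v r]; simp; ring
    · simp only [Fin.mk_one, PiLp.add_apply, PiLp.smul_apply, smul_eq_mul]
      rw [(hv v).2, hx v r]; simp; ring
    · simp only [Fin.reduceFinMk, PiLp.add_apply, PiLp.smul_apply, smul_eq_mul]
      rw [hy v r]; simp

lemma sum_edgeRow_mul [Fintype V] (p : V → E3) (u v : V) (f : V × Fin 3 → ℝ) :
    ∑ wk, edgeRow p s(u, v) wk * f wk = ∑ k, (p u k - p v k) * (f (u, k) - f (v, k)) := by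
  classical
  rw [Fintype.sum_prod_type]
  simp only [edgeRow, Sym2.lift_mk, add_mul, ite_mul, zero_mul, Finset.sum_add_distrib]
  rw [Finset.sum_comm, Finset.sum_comm (s := (Finset.univ : Finset V))]
  simp only [Finset.sum_ite_eq', Finset.mem_univ, if_true, ← Finset.sum_add_distrib]
  exact Finset.sum_congr rfl fun k _ => by ring

lemma sum_vertexRow_mul [Fintype V] (p : V → E3) (v : V) (f : V × Fin 3 → ℝ) :
    ∑ wk, vertexRow p v wk * f wk = p v 0 * f (v, 0) + p v 1 * f (v, 1) := by
  classical
  rw [Fintype.sum_prod_type]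
  simp only [vertexRow, ite_mul, zero_mul]
  rw [Finset.sum_comm]
  simp [Fin.sum_univ_three]

lemma rigidityMatrix_mulVec_eq_zero_iff [Fintype V] {G : SimpleGraph V} {p : V → E3}
    {f : V × Fin 3 → ℝ} : (rigidityMatrix G p).mulVec f = 0 ↔
      IsInfinitesimalMotion G p fun v => WithLp.toLp 2 fun k => f (v, k) := by
  have hedge : ∀ u v, inner ℝ (p u - p v) ((WithLp.toLp 2 fun k => f (u, k) : E3) -
      (WithLp.toLp 2 fun k => f (v, k) : E3)) = ∑ wk, edgeRow p s(u, v) wk * f wk := by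
    intro u v
    rw [sum_edgeRow_mul]
    simp [PiLp.inner_apply, mul_comm]
  constructor
  · intro h
    refine ⟨fun u v huv => ?_, fun v => ?_⟩
    · rw [hedge]; exact congrFun h (Sum.inl ⟨s(u, v), huv⟩)
    · rw [← sum_vertexRow_mul p v f]; exact congrFun h (Sum.inr v)
  · rintro ⟨h1, h2⟩
    funext i
    rcases i with ⟨e, he⟩ | v
    · induction e using Sym2.ind with
      | _ u v => exact (hedge u v).symm.trans (h1 u v he)
    · exact (sum_vertexRow_mul p v f).trans (h2 v)

lemma card_rows [Finite V] (G : SimpleGraph V) [Fintype (G.edgeSet ⊕ V)] :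
    Fintype.card (G.edgeSet ⊕ V) = Nat.card G.edgeSet + Nat.card V := by
  rw [← Nat.card_eq_fintype_card, Nat.card_sum]

/-- Rank-nullity: the kernel contains the plane of trivial motions. -/
lemma card_edgeSet_add_two_le [Finite V] [Nonempty V] {G : SimpleGraph V} {p : V → E3}
    (hp : ∀ v, p v ∈ cylinder) (h : LinearIndependent ℝ (rigidityMatrix G p).row) :
    Nat.card G.edgeSet + 2 ≤ 2 * Nat.card V := by
  classical
  have := Fintype.ofFinite V
  have hrank := h.rank_matrix
  have hker := (rigidityMatrix G p).mulVecLin.finrank_range_add_finrank_ker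
  change (rigidityMatrix G p).rank + _ = _ at hker
  rw [hrank, card_rows, Module.finrank_pi, Fintype.card_prod, Fintype.card_fin,
    ← Nat.card_eq_fintype_card] at hker
  let T : (ℝ × ℝ) →ₗ[ℝ] (V × Fin 3 → ℝ) :=
    { toFun := fun c wk => ![-p wk.1 1 * c.2, p wk.1 0 * c.2, c.1] wk.2
      map_add' := by
        intro c d; funext ⟨v, k⟩; fin_cases k <;> simp <;> ring
      map_smul' := by
        intro c d; funext ⟨v, k⟩; fin_cases k <;> simp <;> ring }
  have hT : ∀ c, T c ∈ LinearMap.ker (rigidityMatrix G p).mulVecLin := by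
    intro c
    rw [LinearMap.mem_ker, Matrix.mulVecLin_apply, rigidityMatrix_mulVec_eq_zero_iff]
    refine ⟨fun u v _ => ?_, fun v => ?_⟩
    · rw [inner_eq_of_tangent (x := c.2) (y := c.1) (x' := c.2) (y' := c.1)] <;>
        simp [T]
    · simp [T]; ring
  have hinj : Function.Injective (T.codRestrict _ hT) := by
    rw [← LinearMap.ker_eq_bot, LinearMap.ker_codRestrict, LinearMap.ker_eq_bot']
    intro c hc
    obtain ⟨v⟩ := ‹Nonempty V›
    have h0 : -p v 1 * c.2 = 0 := congrFun hc (v, 0)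
    have h1 : p v 0 * c.2 = 0 := congrFun hc (v, 1)
    have h2 : c.1 = 0 := congrFun hc (v, 2)
    have h3 := hp v
    simp only [cylinder, Set.mem_ofPred_eq] at h3
    exact Prod.ext h2 (by
      show c.2 = 0
      linear_combination p v 0 * h1 - p v 1 * h0 - c.2 * h3)
  have hdim := LinearMap.finrank_le_finrank_of_injective hinj
  simp only [Module.finrank_prod, Module.finrank_self] at hdim
  omega

/-- Rank-nullity: by rigidity a kernel element is determined by its two velocities at one vertex, so
the rank is at least `3|V| - 2`, the number of rows. -/
lemma linearIndependent_row_of_rigid [Finite V] [Nonempty V] {G : SimpleGraph V} {p : V → E3}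
    (hp : ∀ v, p v ∈ cylinder) (h : IsInfinitesimallyRigid G p)
    (hcard : Nat.card G.edgeSet + 2 = 2 * Nat.card V) :
    LinearIndependent ℝ (rigidityMatrix G p).row := by
  classical
  have := Fintype.ofFinite V
  have hker := (rigidityMatrix G p).mulVecLin.finrank_range_add_finrank_ker
  change (rigidityMatrix G p).rank + _ = _ at hker
  rw [Module.finrank_pi, Fintype.card_prod, Fintype.card_fin, ← Nat.card_eq_fintype_card] at hker
  obtain ⟨r⟩ := ‹Nonempty V›
  let T : (V × Fin 3 → ℝ) →ₗ[ℝ] (ℝ × ℝ) :=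
    { toFun := fun f => (f (r, 2), p r 0 * f (r, 1) - p r 1 * f (r, 0))
      map_add' := by intro c d; ext <;> simp; ring
      map_smul' := by intro c d; ext <;> simp; ring }
  have hinj : Function.Injective (T.domRestrict (LinearMap.ker (rigidityMatrix G p).mulVecLin)) := by
    rw [← LinearMap.ker_eq_bot, LinearMap.ker_eq_bot']
    rintro ⟨f, hf⟩ hTf
    rw [LinearMap.mem_ker, Matrix.mulVecLin_apply, rigidityMatrix_mulVec_eq_zero_iff] at hf
    obtain ⟨a, b, hab⟩ := h _ hf
    have hval : ∀ v k, f (v, k) = (a • !₂[(0 : ℝ), 0, 1] + b • !₂[-(p v 1), p v 0, 0] : E3) k :=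
      fun v k => congrArg (fun w : E3 => w k) (hab v)
    have h1 : f (r, 2) = 0 := congrArg Prod.fst hTf
    have h2 : p r 0 * f (r, 1) - p r 1 * f (r, 0) = 0 := congrArg Prod.snd hTf
    have h3 := hp r
    simp only [cylinder, Set.mem_ofPred_eq] at h3
    rw [hval] at h1
    rw [hval, hval] at h2
    simp at h1 h2
    have hb : b = 0 := by linear_combination h2 - b * h3
    refine Subtype.ext (funext fun ⟨v, k⟩ => ?_)
    change f (v, k) = 0
    rw [hval, h1, hb]; simp
  have hdim := LinearMap.finrank_le_finrank_of_injective hinj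
  simp only [Module.finrank_prod, Module.finrank_self] at hdim
  rw [linearIndependent_iff_card_eq_finrank_span, Set.finrank, ← Matrix.rank_eq_finrank_span_row]
  refine le_antisymm ?_ (Matrix.rank_le_card_height _)
  rw [card_rows]; omega

lemma ne_of_linearIndependent_row {G : SimpleGraph V} {p : V → E3}
    (h : LinearIndependent ℝ (rigidityMatrix G p).row) {u v : V} (huv : G.Adj u v) :
    p u ≠ p v := by
  intro hp
  refine h.ne_zero (Sum.inl ⟨s(u, v), huv⟩) (funext fun wk => ?_)
  simp [rigidityMatrix, Matrix.row, edgeRow, hp]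

/-- Rigidity of a symmetric framework in terms of the orbit equations. -/
lemma isInfinitesimallyRigid_iff_orbitRow [Nonempty V] {G : SimpleGraph V} {p : V → E3}
    (hp : ∀ v, p v ∈ cylinder) {g : V → V} (hg : Function.Involutive g)
    (hG : ∀ u v, G.Adj u v → G.Adj (g u) (g v)) {κ : ℝ} (hκ : κ * κ = 1)
    (hdir : ∀ u v, dirn (p (g u)) (p (g v)) =
      κ • ((dirn (p u) (p v)).1, -(dirn (p u) (p v)).2)) :
    IsInfinitesimallyRigid G p ↔ ∀ σ : ℝ, σ * σ = 1 → ∀ f : V → ℝ,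
      (∀ u v, G.Adj u v → orbitRow g σ (dirn (p u) (p v)) (u, v) f = 0) →
        ∀ u v, f u = f v := by
  rw [isInfinitesimallyRigid_iff hp]
  constructor
  · intro h σ _ f hf u v
    obtain ⟨hx, hy⟩ := h (fun w => f w + σ * f (g w)) (fun w => f w - σ * f (g w))
      fun u v huv => by
        have := hf u v huv
        simp only [orbitRow] at this
        linear_combination this
    have h1 := hx u v
    have h2 := hy u v
    linarith
  · intro h x y hxy
    -- Up to a factor, `(x, y)` is projected to the `σ`-eigenspace of `(x, y) ↦ (x ∘ g, -y ∘ g)`;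
    -- the function `f` of an eigenmotion is a multiple of the sum of its two components.
    have key : ∀ σ : ℝ, σ * σ = 1 → ∀ u v,
        (x u + σ * x (g u)) + (y u - σ * y (g u)) = (x v + σ * x (g v)) + (y v - σ * y (g v)) := by
      intro σ hσ
      refine h σ hσ (fun w => (x w + σ * x (g w)) + (y w - σ * y (g w))) fun u v huv => ?_
      have h1 := hxy u v huv
      have h2 := hxy _ _ (hG u v huv)
      rw [hdir] at h2
      simp only [Prod.smul_mk, smul_eq_mul] at h2
      have hκ0 : κ ≠ 0 := fun h => by rw [h] at hκ; norm_num at hκ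
      have h3 : (dirn (p u) (p v)).1 * (x (g u) - x (g v)) -
          (dirn (p u) (p v)).2 * (y (g u) - y (g v)) = 0 :=
        (mul_eq_zero.1 (show κ * _ = 0 by linear_combination h2)).resolve_left hκ0
      simp only [orbitRow, hg u, hg v]
      linear_combination 2 * h1 + 2 * σ * h3 + ((dirn (p u) (p v)).1 *
        ((x u - x v) - (y u - y v)) - (dirn (p u) (p v)).2 * ((x u - x v) - (y u - y v))) * hσ
    -- Adding the two signs isolates `x + y`; subtracting them at the images isolates `x - y`.
    have hsum : ∀ u v, x u + y u = x v + y v := fun u v => by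
      have h1 := key 1 (by norm_num) u v
      have h2 := key (-1) (by norm_num) u v
      linarith
    have hdiff : ∀ u v, x u - y u = x v - y v := fun u v => by
      have h1 := key 1 (by norm_num) (g u) (g v)
      have h2 := key (-1) (by norm_num) (g u) (g v)
      rw [hg, hg] at h1 h2
      linarith
    exact ⟨fun u v => by linarith [hsum u v, hdiff u v],
      fun u v => by linarith [hsum u v, hdiff u v]⟩

end CylinderFrameworks

/-! ### Trees with one edge from each orbit. -/

section SymmetricTrees

variable {V : Type*}

lemma map_edgeSet_equiv (g : V ≃ V) (T : SimpleGraph V) :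
    (T.map g.toEmbedding).edgeSet = Sym2.map g '' T.edgeSet :=
  T.edgeSet_map g.toEmbedding

/-- All the directions can be changed, one at a time, to one of the two directions for which the
orbit equation is the equation of one edge of the orbit. -/
lemma OrbitRigid.exists_half {ι : Type*} {g : V → V} {σ : ℝ} {S : Finset V} {I : Finset ι}
    {ends : ι → V × V} {D : ι → ℝ × ℝ} (h : OrbitRigid g σ S I ends D) (hgS : ∀ v ∈ S, g v ∈ S)
    (hS : ∀ i ∈ I, (ends i).1 ∈ S ∧ (ends i).2 ∈ S) :
    ∃ D' : ι → ℝ × ℝ, OrbitRigid g σ S I ends D' ∧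
      ∀ i ∈ I, D' i = (1 / 2, 1 / 2) ∨ D' i = (1 / 2, -1 / 2) := by
  classical
  suffices H : ∀ J : Finset ι, J ⊆ I → ∃ D' : ι → ℝ × ℝ, OrbitRigid g σ S I ends D' ∧
      ∀ i ∈ J, D' i = (1 / 2, 1 / 2) ∨ D' i = (1 / 2, -1 / 2) from H I subset_rfl
  intro J
  induction J using Finset.induction_on with
  | empty => exact fun _ => ⟨D, h, by simp⟩
  | insert j J hj ih =>
    intro hJ
    obtain ⟨D', hD', hhalf⟩ := ih fun i hi => hJ (Finset.mem_insert_of_mem hi)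
    have hjI := hJ (Finset.mem_insert_self j J)
    obtain ⟨A, B, hAB, hex⟩ := hD'.exists_exchange hgS hjI (hS j hjI)
    obtain ⟨E, hE, hE'⟩ : ∃ E : ℝ × ℝ, (E = (1 / 2, 1 / 2) ∨ E = (1 / 2, -1 / 2)) ∧
        A * E.1 + B * E.2 ≠ 0 := by
      by_contra! hcon
      have h1 := hcon _ (Or.inl rfl)
      have h2 := hcon _ (Or.inr rfl)
      simp only at h1 h2
      rcases hAB with h' | h' <;> exact h' (by linarith)
    refine ⟨Function.update D' j E, hex E hE', fun i hi => ?_⟩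
    rcases Finset.mem_insert.1 hi with rfl | hi
    · rw [Function.update_self]; exact hE
    · rw [Function.update_of_ne (ne_of_mem_of_not_mem hi hj)]; exact hhalf i hi

lemma connected_of_forall_eq [Nonempty V] {T : SimpleGraph V}
    (h : ∀ f : V → ℝ, (∀ u v, T.Adj u v → f u = f v) → ∀ u v, f u = f v) : T.Connected := by
  classical
  refine (SimpleGraph.connected_iff T).2 ⟨fun u v => ?_, inferInstance⟩
  have := h (fun w => if T.Reachable u w then 1 else 0) (fun a b hab => by
    have : T.Reachable u a ↔ T.Reachable u b :=
      ⟨fun h => h.trans hab.reachable, fun h => h.trans hab.symm.reachable⟩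
    simp [this]) u v
  by_contra hcon
  simp [hcon] at this

lemma eq_of_connected {T : SimpleGraph V} (hT : T.Connected) {f : V → ℝ}
    (hf : ∀ u v, T.Adj u v → f u = f v) (u v : V) : f u = f v := by
  obtain ⟨w⟩ := hT.preconnected u v
  induction w with
  | nil => rfl
  | cons h _ ih => exact (hf _ _ h).trans ih

/-- The sign `-κ` is the one for which the two edges of an orbit give opposite rows, so that a fixed
edge gives the zero row. Comparing the dimension count with `hcard` leaves room for no fixed edge.
-/
lemma exists_transversal_tree [Finite V] [Nonempty V] {G : SimpleGraph V} (g : V ≃ V)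
    (hg : Function.Involutive g) (hG : ∀ u v, G.Adj u v → G.Adj (g u) (g v)) {d : V → V → ℝ × ℝ}
    (hswap : ∀ u v, d v u = -d u v) {κ : ℝ} (hκ : κ * κ = 1)
    (hdir : ∀ u v, d (g u) (g v) = κ • ((d u v).1, -(d u v).2))
    (hrig : ∀ f : V → ℝ, (∀ u v, G.Adj u v → orbitRow g (-κ) (d u v) (u, v) f = 0) →
      ∀ u v, f u = f v)
    (hcard : Nat.card G.edgeSet + 2 ≤ 2 * Nat.card V) :
    ∃ T : SimpleGraph V, T.IsTree ∧ Disjoint (T.map g.toEmbedding).edgeSet T.edgeSet ∧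
      (T.map g.toEmbedding).edgeSet ∪ T.edgeSet = G.edgeSet := by
  classical
  have := Fintype.ofFinite V
  have hex : ∀ e : Sym2 V, ∃ x : V × V, s(x.1, x.2) = e := fun e => by
    induction e using Sym2.ind with
    | _ u v => exact ⟨(u, v), rfl⟩
  choose ends hends using hex
  set m : Sym2 V → Sym2 V := Sym2.map g with hm
  have hmm : ∀ e, m (m e) = e := fun e => by
    rw [hm, Sym2.map_map, show (g : V → V) ∘ g = id from funext hg, Sym2.map_id]; rfl
  have hmG : ∀ e ∈ G.edgeSet, m e ∈ G.edgeSet := fun e => by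
    induction e using Sym2.ind with
    | _ u v => exact fun h => hG u v h
  set E : Finset (Sym2 V) := Finset.univ.filter (· ∈ G.edgeSet) with hE
  have hmE : ∀ e, e ∈ E ↔ e ∈ G.edgeSet := fun e => by simp [hE]
  have hEcard : E.card = Nat.card G.edgeSet := by
    rw [Nat.card_eq_fintype_card, ← Fintype.card_coe]
    exact Fintype.card_congr (Equiv.subtypeEquivRight hmE)
  have n := Fintype.equivFin (Sym2 V)
  -- A numbering of the edges picks one edge from each orbit of size two; fixed edges are neither in
  -- `O` nor in `O'`.
  set O := E.filter fun e => n e < n (m e) with hO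
  set O' := E.filter fun e => n (m e) < n e with hO'
  have hmO : ∀ e, e ∈ O ↔ e ∈ G.edgeSet ∧ n e < n (m e) := fun e => by
    rw [hO, Finset.mem_filter, hmE]
  have hmO' : ∀ e, e ∈ O' ↔ e ∈ G.edgeSet ∧ n (m e) < n e := fun e => by
    rw [hO', Finset.mem_filter, hmE]
  have hOO' : ∀ e ∈ O, m e ∈ O' := fun e he => by
    rw [hmO] at he; rw [hmO', hmm]; exact ⟨hmG e he.1, he.2⟩
  have hO'O : ∀ e ∈ O', m e ∈ O := fun e he => by
    rw [hmO'] at he; rw [hmO, hmm]; exact ⟨hmG e he.1, he.2⟩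
  have hcardO : O.card = O'.card :=
    Finset.card_nbij' m m hOO' hO'O (fun e _ => hmm e) fun e _ => hmm e
  have hdisj : Disjoint O O' := Finset.disjoint_left.2 fun e h h' =>
    lt_asymm ((hmO e).1 h).2 ((hmO' e).1 h').2
  have hsub : O ∪ O' ⊆ E := Finset.union_subset (Finset.filter_subset _ _)
    (Finset.filter_subset _ _)
  have hrigO : OrbitRigid g (-κ) Finset.univ O ends fun e => d (ends e).1 (ends e).2 := by
    intro f hf u _ v _
    refine hrig f (fun u v huv => ?_) u v
    have hsw : ∀ a b, orbitRow g (-κ) (d b a) (b, a) f = orbitRow g (-κ) (d a b) (a, b) f :=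
      fun a b => by rw [hswap a b]; exact orbitRow_swap g (-κ) (d a b) (a, b) f
    have hmap : ∀ a b, orbitRow g (-κ) (d (g a) (g b)) (g a, g b) f =
        -orbitRow g (-κ) (d a b) (a, b) f := fun a b => by
      rw [hdir, orbitRow_mul, orbitRow_map hg (by linarith) (d a b) (a, b)]
      linear_combination -hκ * orbitRow g (-κ) (d a b) (a, b) f
    have hO0 : ∀ a b, s(a, b) ∈ O → orbitRow g (-κ) (d a b) (a, b) f = 0 := by
      intro a b hab
      have h1 : orbitRow g (-κ) (d (ends s(a, b)).1 (ends s(a, b)).2) (ends s(a, b)) f = 0 :=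
        hf _ hab
      have h2 := hends s(a, b)
      generalize ends s(a, b) = x at h1 h2
      rcases Sym2.eq_iff.1 h2 with ⟨h3, h4⟩ | ⟨h3, h4⟩
      · rw [show x = (a, b) from Prod.ext h3 h4] at h1; exact h1
      · rw [show x = (b, a) from Prod.ext h3 h4] at h1; rw [← hsw]; exact h1
    rcases lt_trichotomy (n s(u, v)) (n (m s(u, v))) with h | h | h
    · exact hO0 u v ((hmO _).2 ⟨huv, h⟩)
    -- A fixed edge: its row equals its own negative, whether or not `g` reverses it.
    · have h1 : s(u, v) = s(g u, g v) := n.injective h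
      have h2 := hmap u v
      rcases Sym2.eq_iff.1 h1 with ⟨h3, h4⟩ | ⟨h3, h4⟩
      · rw [← h3, ← h4] at h2; linarith
      · rw [← h3, ← h4, hsw] at h2; linarith
    · have h1 := hO0 (g u) (g v) (hO'O _ ((hmO' _).2 ⟨huv, h⟩))
      rw [hmap] at h1; linarith
  have hVO := hrigO.card_le
  rw [Finset.card_univ, ← Nat.card_eq_fintype_card] at hVO
  have hun : (O ∪ O').card = O.card + O'.card := Finset.card_union_of_disjoint hdisj
  have hle := Finset.card_le_card hsub
  -- From `|V| ≤ |O| + 1`, `|O| + |O'| ≤ |E|` and `|E| + 2 ≤ 2|V|`, all of these are equalities.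
  have hEO : O ∪ O' = E := Finset.eq_of_subset_of_card_le hsub (by omega)
  obtain ⟨D, hD, hhalf⟩ := hrigO.exists_half (fun v _ => Finset.mem_univ _)
    fun i _ => ⟨Finset.mem_univ _, Finset.mem_univ _⟩
  -- The edge of the orbit to which the exchanged equation has been reduced.
  set t : Sym2 V → Sym2 V := fun e => if D e = (1 / 2, 1 / 2) then e else m e with ht
  have htm : ∀ e, t e = e ∨ t e = m e := fun e => by simp only [ht]; split_ifs <;> simp
  have htG : ∀ e ∈ O, t e ∈ G.edgeSet := fun e he => by
    rcases htm e with h | h <;> rw [h]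
    · exact ((hmO e).1 he).1
    · exact hmG _ ((hmO e).1 he).1
  have horb : ∀ e ∈ O, ∀ e' ∈ O, e' = m e → False := fun e he e' he' h =>
    Finset.disjoint_left.1 hdisj he' (h ▸ hOO' e he)
  have hinj : Set.InjOn t O := by
    intro e he e' he' h
    rcases htm e with h1 | h1 <;> rcases htm e' with h2 | h2 <;> rw [h1, h2] at h
    · exact h
    · exact (horb e' he' e he h).elim
    · exact (horb e he e' he' h.symm).elim
    · rw [← hmm e, h, hmm]
  set T := SimpleGraph.fromEdgeSet (t '' O) with hT
  have hTset : T.edgeSet = t '' O := by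
    rw [hT, SimpleGraph.edgeSet_fromEdgeSet, sdiff_eq_left, Set.disjoint_left]
    rintro _ ⟨e, he, rfl⟩ hd
    exact G.not_isDiag_of_mem_edgeSet (htG e he) hd
  have hmT : (T.map g.toEmbedding).edgeSet = m '' T.edgeSet := map_edgeSet_equiv g T
  refine ⟨T, SimpleGraph.isTree_iff_connected_and_card.2 ⟨connected_of_forall_eq fun f hf u v => ?_,
    ?_⟩, ?_, ?_⟩
  · refine hD f (fun e he => ?_) u (Finset.mem_univ _) v (Finset.mem_univ _)
    have hte : t e ∈ T.edgeSet := by rw [hTset]; exact ⟨e, he, rfl⟩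
    rcases hhalf e he with h | h
    · rw [h, orbitRow_half, sub_eq_zero]
      refine hf _ _ ?_
      rw [← SimpleGraph.mem_edgeSet, hends]
      simpa [ht, h] using hte
    · rw [h, orbitRow_half_neg]
      have h3 : f (g (ends e).1) = f (g (ends e).2) := by
        refine hf _ _ ?_
        have h4 : t e = s(g (ends e).1, g (ends e).2) := by
          have h5 : D e ≠ (1 / 2, 1 / 2) := by rw [h]; intro h6; norm_num at h6
          simp only [ht, h5, if_false]
          conv_lhs => rw [← hends e]
          rfl
        rwa [← SimpleGraph.mem_edgeSet, ← h4]
      rw [h3]; ring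
  · rw [hTset, Nat.card_coe_set_eq, hinj.ncard_image, Set.ncard_coe_finset]
    omega
  · rw [hmT, hTset, Set.disjoint_left]
    rintro _ ⟨_, ⟨e, he, rfl⟩, rfl⟩ ⟨e', he', h⟩
    have hself : ∀ e ∈ O, e ≠ m e := fun e he h => horb e he e he h
    rcases htm e with h1 | h1 <;> rcases htm e' with h2 | h2 <;> rw [h1, h2] at h
    · exact horb e he e' he' h
    · have : e' = e := by rw [← hmm e', h, hmm]
      subst this
      rw [h1] at h2; exact hself _ he h2
    · rw [hmm] at h; subst h
      rw [h1] at h2; exact hself _ he h2.symm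
    · rw [hmm] at h; exact horb e' he' e he h.symm
  · rw [hmT, hTset]
    ext e
    constructor
    · rintro (⟨_, ⟨e, he, rfl⟩, rfl⟩ | ⟨e, he, rfl⟩)
      · exact hmG _ (htG e he)
      · exact htG e he
    · intro he
      have key : ∀ e ∈ O, (e ∈ m '' (t '' O) ∪ t '' O) ∧ m e ∈ m '' (t '' O) ∪ t '' O := by
        intro e he
        rcases htm e with h | h
        · exact ⟨Or.inr ⟨e, he, h⟩, Or.inl ⟨e, ⟨e, he, h⟩, rfl⟩⟩
        · exact ⟨Or.inl ⟨m e, ⟨e, he, h⟩, hmm e⟩, Or.inr ⟨e, he, h⟩⟩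
      have h1 : e ∈ O ∪ O' := by rw [hEO, hmE]; exact he
      rcases Finset.mem_union.1 h1 with h1 | h1
      · exact (key e h1).1
      · have := (key _ (hO'O e h1)).2
        rwa [hmm] at this

/-- A tree that is disjoint from its image under an involution has a symmetric configuration in
which the union of the two is rigid. -/
lemma exists_config_of_tree [Finite V] {G T : SimpleGraph V} (g : V ≃ V)
    (hg : Function.Involutive g) {e : Fin 3 → ℝ} (he : IsMirrorSign e)
    (hfix : e 0 = -1 → ∀ v, g v ≠ v) (hT : T.IsTree)
    (hdisj : Disjoint (T.map g.toEmbedding).edgeSet T.edgeSet)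
    (hun : (T.map g.toEmbedding).edgeSet ∪ T.edgeSet = G.edgeSet) :
    ∃ p : V → Fin 3 → ℝ, IsConfig g e p ∧ ∀ σ : ℝ, σ * σ = 1 → ∀ f : V → ℝ,
      (∀ u v, G.Adj u v → orbitRow g σ (dirn (p u) (p v)) (u, v) f = 0) →
        ∀ u v, f u = f v := by
  classical
  have := Fintype.ofFinite V
  have hex : ∀ e : Sym2 V, ∃ x : V × V, s(x.1, x.2) = e := fun e => by
    induction e using Sym2.ind with
    | _ u v => exact ⟨(u, v), rfl⟩
  choose ends hends using hex
  have hadj : ∀ i ∈ T.edgeFinset, T.Adj (ends i).1 (ends i).2 := fun i hi => by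
    rw [← SimpleGraph.mem_edgeSet, hends]; exact SimpleGraph.mem_edgeFinset.1 hi
  -- At the start every edge is geometric, and the label condition is the disjointness of the tree
  -- from its image.
  have hlab : IsLabelledTree g Finset.univ T.edgeFinset ends fun _ => True := by
    refine ⟨fun v _ => Finset.mem_univ _, fun i _ => ⟨Finset.mem_univ _, Finset.mem_univ _⟩,
      fun f hf u _ v _ => eq_of_connected hT.connected (fun a b hab => ?_) u v, ?_,
      fun i hi j hj _ _ h => ?_⟩
    · have h1 := hf s(a, b) (SimpleGraph.mem_edgeFinset.2 hab)
      rcases Sym2.eq_iff.1 (hends s(a, b)) with ⟨h2, h3⟩ | ⟨h2, h3⟩ <;> rw [h2, h3] at h1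
      · exact h1
      · exact h1.symm
    · rw [Finset.card_univ]; exact hT.card_edgeFinset
    · have h1 : i ∈ (T.map g.toEmbedding).edgeSet := by
        rw [map_edgeSet_equiv]
        refine ⟨j, SimpleGraph.mem_edgeFinset.1 hj, ?_⟩
        rw [← hends i, h]
        conv_lhs => rw [← hends j]
        rfl
      exact Set.disjoint_left.1 hdisj h1 (SimpleGraph.mem_edgeFinset.1 hi)
  obtain ⟨p, D, hR⟩ := hlab.realizable hg he hfix
  refine ⟨p, hR.config, fun σ hσ f hf u v => hR.rigid σ hσ f (fun i hi => ?_) u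
    (Finset.mem_univ _) v (Finset.mem_univ _)⟩
  rw [hR.dir_eq i hi trivial]
  refine hf _ _ ?_
  rw [← SimpleGraph.mem_edgeSet, ← hun]
  exact Or.inr (hadj i hi)

lemma card_edgeSet_of_trees [Finite V] {G T T' : SimpleGraph V} (hT : T.IsTree) (hT' : T'.IsTree)
    (hdisj : Disjoint T'.edgeSet T.edgeSet) (hun : T'.edgeSet ∪ T.edgeSet = G.edgeSet) :
    Nat.card G.edgeSet + 2 = 2 * Nat.card V := by
  classical
  have h1 := (SimpleGraph.isTree_iff_connected_and_card.1 hT).2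
  have h2 := (SimpleGraph.isTree_iff_connected_and_card.1 hT').2
  rw [← hun, Nat.card_coe_set_eq, Set.ncard_union_eq hdisj (Set.toFinite _) (Set.toFinite _)]
  rw [Nat.card_coe_set_eq] at h1 h2
  omega

end SymmetricTrees

/-! ### Normal forms of the isometries, and the characterization. -/

section MirrorModels

/-- In the cylindrical coordinates `R`, the isometry `r` multiplies the coordinates by the
signs `e`. -/
structure IsMirrorModel (r : E3 → E3) (e : Fin 3 → ℝ) (R : (Fin 3 → ℝ) ≃ E3) : Prop where
  cyl : ∀ q, R q 0 ^ 2 + R q 1 ^ 2 = q 0 ^ 2 + q 1 ^ 2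
  dirn_eq : ∀ q q', dirn (R q) (R q') = dirn q q'
  map : ∀ q, r (R q) = R fun k => e k * q k

lemma isMirrorModel_neg :
    IsMirrorModel (fun x => -x) ![-1, -1, -1] (WithLp.equiv 2 (Fin 3 → ℝ)).symm := by
  refine ⟨fun q => rfl, fun q q' => rfl, fun q => ?_⟩
  ext k
  fin_cases k <;> simp

lemma reflection_orthogonal_span_apply {K : Submodule ℝ E3} [K.HasOrthogonalProjection] {n : E3}
    (hK : K = Submodule.span ℝ {n}) (x : E3) (hn : n 0 ^ 2 + n 1 ^ 2 + n 2 ^ 2 = 1) (k : Fin 3) :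
    Kᗮ.reflection x k = x k - 2 * (n 0 * x 0 + n 1 * x 1 + n 2 * x 2) * n k := by
  subst hK
  have hnorm : ‖n‖ ^ 2 = 1 := by
    rw [EuclideanSpace.norm_sq_eq, Fin.sum_univ_three]
    simpa using hn
  rw [Submodule.reflection_orthogonal_apply, Submodule.reflection_singleton_apply]
  simp only [RCLike.ofReal_real_eq_id, id_eq, hnorm, PiLp.inner_apply, Fin.sum_univ_three,
    RCLike.inner_apply, conj_trivial, PiLp.neg_apply, PiLp.sub_apply, PiLp.smul_apply, smul_eq_mul,
    nsmul_eq_mul, Nat.cast_ofNat, div_one]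
  ring

/-- A rotation about the axis brings a mirror containing it into a coordinate plane; neither the
cylinder nor `dirn` changes. -/
lemma exists_isMirrorModel {n : E3} (hn : n ≠ 0) (hn' : n 2 = 0 ∨ (n 0 = 0 ∧ n 1 = 0)) :
    ∃ (e : Fin 3 → ℝ) (R : (Fin 3 → ℝ) ≃ E3), IsMirrorSign e ∧ e 0 = 1 ∧
      IsMirrorModel (Submodule.span ℝ {n})ᗮ.reflection e R := by
  obtain ⟨m, hm, hm', hspan⟩ : ∃ m : E3, m 0 ^ 2 + m 1 ^ 2 + m 2 ^ 2 = 1 ∧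
      (m 2 = 0 ∨ (m 0 = 0 ∧ m 1 = 0)) ∧ Submodule.span ℝ {n} = Submodule.span ℝ {m} := by
    have h0 : ‖n‖ ≠ 0 := norm_ne_zero_iff.2 hn
    have hsq : n 0 ^ 2 + n 1 ^ 2 + n 2 ^ 2 = ‖n‖ ^ 2 := by
      rw [EuclideanSpace.norm_sq_eq, Fin.sum_univ_three]; simp
    refine ⟨‖n‖⁻¹ • n, ?_, ?_, ?_⟩
    · simp only [PiLp.smul_apply, smul_eq_mul]
      field_simp
      exact hsq
    · rcases hn' with h | h
      · left; simp [h]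
      · right; simp [h.1, h.2]
    · exact (Submodule.span_singleton_smul_eq (IsUnit.mk0 _ (inv_ne_zero h0)) n).symm
  rcases hm' with h2 | ⟨h0, h1⟩
  · rw [h2] at hm
    refine ⟨![1, -1, 1],
      -- `q 1` is the coordinate along the normal `m`, `q 0` the one along the horizontal vector `(m
      -- 1, -m 0)`.
      { toFun := fun q => !₂[q 0 * m 1 + q 1 * m 0, -q 0 * m 0 + q 1 * m 1, q 2]
        invFun := fun x => ![x 0 * m 1 - x 1 * m 0, x 0 * m 0 + x 1 * m 1, x 2]
        left_inv := fun q => ?_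
        right_inv := fun x => ?_ }, Or.inr (Or.inr rfl), rfl, fun q => ?_, fun q q' => ?_,
      fun q => ?_⟩
    · funext k
      fin_cases k <;> simp
      · linear_combination q 0 * hm
      · linear_combination q 1 * hm
    · ext k
      fin_cases k <;> simp
      · linear_combination x 0 * hm
      · linear_combination x 1 * hm
    · simp
      linear_combination (q 0 ^ 2 + q 1 ^ 2) * hm
    · simp [dirn]
      linear_combination (q 1 * q' 0 - q 0 * q' 1) * hm
    · ext k
      rw [reflection_orthogonal_span_apply hspan _ (by rw [h2]; exact hm), h2]
      fin_cases k <;> simp [h2]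
      · linear_combination -2 * q 1 * m 0 * hm
      · linear_combination -2 * q 1 * m 1 * hm
  · refine ⟨![1, 1, -1], (WithLp.equiv 2 (Fin 3 → ℝ)).symm, Or.inl rfl, rfl, fun q => rfl,
      fun q q' => rfl, fun q => ?_⟩
    ext k
    rw [reflection_orthogonal_span_apply hspan _ hm, h0, h1]
    rw [h0, h1] at hm
    fin_cases k <;> simp [h0, h1]
    linear_combination -2 * q 2 * hm

/-- The characterization for one involution of the graph and one isometry. -/
theorem exists_isostatic_iff {V : Type*} [Finite V] [Nonempty V] {G : SimpleGraph V} (g : G ≃g G)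
    (hg : Function.Involutive g) {r : E3 → E3} {e : Fin 3 → ℝ} {R : (Fin 3 → ℝ) ≃ E3}
    (he : IsMirrorSign e) (hR : IsMirrorModel r e R) (hfix : e 0 = -1 → ∀ v, g v ≠ v) :
    (∃ p : V → E3, (IsCylinderFramework G p ∧ ∀ v, r (p v) = p (g v)) ∧
      IsIsostaticFramework G p) ↔
    ∃ T : SimpleGraph V, T.IsTree ∧
      Disjoint (T.map g.toEquiv.toEmbedding).edgeSet T.edgeSet ∧
      (T.map g.toEquiv.toEmbedding).edgeSet ∪ T.edgeSet = G.edgeSet := by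
  obtain ⟨κ, hκ, hκ1, hκ2⟩ := he.exists_sign
  have hG : ∀ u v, G.Adj u v → G.Adj (g u) (g v) := fun u v h => g.map_adj_iff.2 h
  constructor
  · rintro ⟨p, ⟨hp, hsym⟩, hrig, hind⟩
    obtain ⟨q, rfl⟩ : ∃ q : V → Fin 3 → ℝ, p = fun v => R (q v) :=
      ⟨fun v => R.symm (p v), by simp⟩
    have hq : IsConfig g e q := by
      refine ⟨fun v => (hR.cyl (q v)).symm.trans (hp.1 v), fun v k => ?_⟩
      have := hsym v
      rw [hR.map] at this
      exact (congrFun (R.injective this) k).symm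
    have hdir : ∀ u v, dirn (R (q (g u))) (R (q (g v))) =
        κ • ((dirn (R (q u)) (R (q v))).1, -(dirn (R (q u)) (R (q v))).2) := fun u v => by
      rw [hR.dirn_eq, hR.dirn_eq]; exact hq.dirn_map hκ1 hκ2 u v
    rw [isInfinitesimallyRigid_iff_orbitRow hp.1 hg hG hκ hdir] at hrig
    exact exists_transversal_tree g.toEquiv hg hG (d := fun u v => dirn (R (q u)) (R (q v)))
      (fun u v => dirn_swap _ _) hκ hdir (hrig (-κ) (by linarith))
      (card_edgeSet_add_two_le hp.1 hind)
  · rintro ⟨T, hT, hdisj, hun⟩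
    obtain ⟨q, hq, hrig⟩ := exists_config_of_tree g.toEquiv hg he hfix hT hdisj hun
    have hp : ∀ v, R (q v) ∈ cylinder := fun v => (hR.cyl (q v)).trans (hq.on v)
    have hdir : ∀ u v, dirn (R (q (g u))) (R (q (g v))) =
        κ • ((dirn (R (q u)) (R (q v))).1, -(dirn (R (q u)) (R (q v))).2) := fun u v => by
      rw [hR.dirn_eq, hR.dirn_eq]; exact hq.dirn_map hκ1 hκ2 u v
    have hrig' : IsInfinitesimallyRigid G fun v => R (q v) := by
      rw [isInfinitesimallyRigid_iff_orbitRow hp hg hG hκ hdir]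
      intro σ hσ f hf
      refine hrig σ hσ f fun u v huv => ?_
      rw [← hR.dirn_eq]; exact hf u v huv
    have hind := linearIndependent_row_of_rigid hp hrig' (card_edgeSet_of_trees hT
      ((SimpleGraph.Iso.map g.toEquiv T).isTree_iff.1 hT) hdisj hun)
    -- Adjacent points are distinct because coincident ones would give a zero row.
    refine ⟨fun v => R (q v), ⟨⟨hp, fun u v huv => ne_of_linearIndependent_row hind huv⟩,
      fun v => ?_⟩, hrig', hind⟩
    rw [hR.map]
    congr 1
    funext k
    exact (hq.symm v k).symm

lemma exists_generator {Γ H : Type*} [Group Γ] [Group H] {τ : Γ →* H}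
    (hτ : Function.Injective τ) {r : H} (hr : r ≠ 1) (hrr : r * r = 1)
    (h : τ.range = Subgroup.zpowers r) :
    ∃ γ : Γ, τ γ = r ∧ γ ≠ 1 ∧ γ * γ = 1 ∧ ∀ γ', γ' = 1 ∨ γ' = γ := by
  obtain ⟨γ, hγ⟩ : r ∈ τ.range := h ▸ Subgroup.mem_zpowers r
  refine ⟨γ, hγ, fun h1 => hr (by rw [← hγ, h1, map_one]), hτ (by rw [map_mul, hγ, hrr, map_one]),
    fun γ' => ?_⟩
  have h1 : τ γ' ∈ Subgroup.zpowers r := h ▸ ⟨γ', rfl⟩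
  obtain ⟨k, hk⟩ := Subgroup.mem_zpowers_iff.1 h1
  have h2 : r ^ (2 : ℤ) = 1 := by rw [zpow_two, hrr]
  rcases Int.even_or_odd' k with ⟨j, rfl | rfl⟩
  · left; apply hτ; rw [← hk, zpow_mul, h2, one_zpow, map_one]
  · right; apply hτ; rw [← hk, zpow_add_one, zpow_mul, h2, one_zpow, one_mul, hγ]

variable {V Γ : Type*} [Group Γ] {G : SimpleGraph V} {φ : Γ →* (G ≃g G)}

lemma involutive_of_mul_self {γ : Γ} (h : γ * γ = 1) : Function.Involutive (φ γ) := fun v => by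
  have := congrArg (fun ψ : G ≃g G => ψ v) (map_mul φ γ γ)
  rw [h, map_one] at this
  exact this.symm

lemma isSymmetricIsostatic_iff {τ : Γ →* (E3 ≃ₗᵢ[ℝ] E3)} {γ : Γ} (hall : ∀ γ', γ' = 1 ∨ γ' = γ) :
    IsSymmetricIsostatic φ τ ↔ ∃ p : V → E3,
      (IsCylinderFramework G p ∧ ∀ v, τ γ (p v) = p (φ γ v)) ∧ IsIsostaticFramework G p := by
  refine exists_congr fun p => and_congr_left fun _ => and_congr_right fun _ =>
    ⟨fun h v => h γ v, fun h γ' v => ?_⟩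
  rcases hall γ' with rfl | rfl
  · rw [map_one, map_one]; rfl
  · exact h v

lemma isUnionOfTwoSymmetricTrees_iff {γ : Γ} (hγ : γ ≠ 1) (hall : ∀ γ', γ' = 1 ∨ γ' = γ) :
    IsUnionOfTwoSymmetricTrees φ ↔ ∃ T : SimpleGraph V, T.IsTree ∧
      Disjoint (T.map (φ γ).toEquiv.toEmbedding).edgeSet T.edgeSet ∧
      (T.map (φ γ).toEquiv.toEmbedding).edgeSet ∪ T.edgeSet = G.edgeSet := by
  constructor
  · rintro ⟨T₁, T₂, -, h2, hdisj, hun, γ', hγ', rfl⟩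
    obtain rfl := (hall γ').resolve_left hγ'
    exact ⟨T₂, h2, hdisj, hun⟩
  · rintro ⟨T, hT, hdisj, hun⟩
    exact ⟨_, T, (SimpleGraph.Iso.map (φ γ).toEquiv T).isTree_iff.1 hT, hT, hdisj, hun, γ, hγ, rfl⟩

end MirrorModels

/-! ### The theorem for the inversion and for the reflections. -/

theorem mainTheorem10 {V : Type*} [Finite V] [Nonempty V] {Γ : Type*} [Group Γ]
    (G : SimpleGraph V) (φ : Γ →* (G ≃g G))
    (τ : Γ →* (E3 ≃ₗᵢ[ℝ] E3)) (hτ : Function.Injective τ) :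
    (τ.range = groupCi →
      (IsSymmetricIsostatic φ τ ↔
        (∀ γ : Γ, γ ≠ 1 → ∀ v : V, φ γ v ≠ v) ∧ IsUnionOfTwoSymmetricTrees φ)) ∧
    (IsGroupCs τ.range →
      (IsSymmetricIsostatic φ τ ↔ IsUnionOfTwoSymmetricTrees φ)) := by
  constructor
  · intro h
    obtain ⟨γ, hγ, hγ1, hγγ, hall⟩ := exists_generator hτ (r := LinearIsometryEquiv.neg ℝ)
      (fun h0 => by
        have := congrArg (fun ψ : E3 ≃ₗᵢ[ℝ] E3 => ψ !₂[1, 0, 0] 0) h0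
        simp at this
        norm_num at this)
      (by ext x; simp) h
    have hg := involutive_of_mul_self (φ := φ) hγγ
    -- The inversion fixes only the origin, which is not on the cylinder.
    have hfix : IsSymmetricIsostatic φ τ → ∀ v, φ γ v ≠ v := by
      rintro ⟨p, ⟨hp, hs⟩, -⟩ v hv
      have h1 := hs γ v
      rw [hγ, hv] at h1
      have h2 := hp.1 v
      have h3 : ∀ k, p v k = 0 := fun k => by
        have := congrArg (fun x : E3 => x k) h1
        simp at this
        linarith
      simp [cylinder, h3] at h2
    have hiff : (∀ v, φ γ v ≠ v) →
        (IsSymmetricIsostatic φ τ ↔ IsUnionOfTwoSymmetricTrees φ) := by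
      intro hf
      rw [isSymmetricIsostatic_iff hall, isUnionOfTwoSymmetricTrees_iff hγ1 hall, hγ]
      exact exists_isostatic_iff (φ γ) hg (Or.inr (Or.inl rfl)) isMirrorModel_neg fun _ => hf
    have hall' : (∀ γ' : Γ, γ' ≠ 1 → ∀ v : V, φ γ' v ≠ v) ↔ ∀ v, φ γ v ≠ v :=
      ⟨fun h => h γ hγ1, fun h γ' h' => (hall γ').resolve_left h' ▸ h⟩
    rw [hall']
    exact ⟨fun h => ⟨hfix h, (hiff (hfix h)).1 h⟩, fun h => (hiff h.1).2 h.2⟩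
  · rintro ⟨n, hn, hn', h⟩
    obtain ⟨e, R, he, he0, hR⟩ := exists_isMirrorModel hn hn'
    obtain ⟨γ, hγ, hγ1, hγγ, hall⟩ := exists_generator hτ
      (r := (Submodule.span ℝ {n})ᗮ.reflection) (fun h0 => by
        have h1 := Submodule.reflection_orthogonalComplement_singleton_eq_neg (𝕜 := ℝ) n
        rw [h0] at h1
        have h2 : (2 : ℝ) • n = 0 := by
          rw [two_smul]
          nth_rewrite 1 [show n = -n from h1]
          exact neg_add_cancel n
        exact hn ((smul_eq_zero.1 h2).resolve_left two_ne_zero))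
      (Submodule.reflection_mul_reflection _) h
    rw [isSymmetricIsostatic_iff hall, isUnionOfTwoSymmetricTrees_iff hγ1 hall, hγ]
    exact exists_isostatic_iff (φ γ) (involutive_of_mul_self hγγ) he hR fun h1 => by
      rw [he0] at h1; norm_num at h1
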